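/- **Recursive systems.** A recursive system $S=[A_S;P_S;B_S]$ consists of a finite set $A_S$ of constant/operation symbols, a finite set $P_S$ of predicate symbols (both possibly empty) and a finite, possibly empty, list $B_S$ of R-formulas (the basis R-axioms), with all symbols taken from the pairwise disjoint sets $A_S$, $P_S$, the variables $X=\{\mathbf{x}_1,\mathbf{x}_2,\dots\}$ and $\{\sim,(,),{,},\to\}$. *Lists* are the strings generated by: $a\in A_S$ and $x\in X$ are lists; if $\lambda,\mu$ are lists and $f\in A_S$, then $f(\lambda)$ and $\lambda\mu$ are lists. *Prime R-formulas* are the equations $\sim\lambda,\mu$ and the strings $p\,\lambda_1,\dots,\lambda_n$ ($p\in P_S$, $n\ge 0$), where $\lambda,\mu,\lambda_i$ are lists; the latter is called $n$-ary, and an equation has two argument lists. *R-formulas* are the prime R-formulas and the strings $\to FG$ with $F$ a prime R-formula and $G$ an R-formula. *Elementary* means variable-free. $F\frac{\lambda}{x}$ is the result of replacing the variable $x$ everywhere in $F$ by the list $\lambda$. The R-axioms of $S$ are the members of $B_S$ and the equality axioms, for all variables $x,y,x_i,y_i$, lists $\lambda,\mu$, $p\in P_S$ and $n\ge1$: $$\sim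 x,x;\qquad \to\,(\sim\lambda,\mu)\tfrac{x}{y}\;\to\,\sim x,y\;\sim\lambda,\mu;\qquad \to\,\sim x_1,y_1\cdots\to\,\sim x_n,y_n\,\to\,p\,x_1,\dots,x_n\;p\,y_1,\dots,y_n .$$ An *R-derivation* in $S$ is a finite list of R-formulas built up from the empty list by appending (a) an R-axiom, (b) $G$, if the R-formulas $F$ and $\to FG$ are earlier steps ($F,G$ R-formulas), or (c) $F\frac{\lambda}{x}$, if $F$ is an earlier step, $x$ a variable and $\lambda$ a list. An R-formula is *R-derivable* in $S$ if it is a step of an R-derivation in $S$. A set $R$ of strings over an alphabet $A$ is *recursively enumerable* if there are a recursive system $S$ with $A\subseteq A_S$ and a $p\in P_S$ such that $R$ is exactly the set of the elementary lists $\lambda$ of $S$ for which $p\,\lambda$ is R-derivable in $S$. **Encoding.** Let $A_{11}=[\,a;v;p;\Box;{}';*;\underline\sim;\underline(;\underline);\underline{,};\underline\to\,]$ and let $A_{11}^+$ be the set of nonempty strings over it. If $A_S=[\mathbf a_1;\dots;\mathbf a_k]$ and $P_S=[\mathbf p_1;\dots;\mathbf p_l]$ are ordered, the code $\tilde F\in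 A_{11}^+$ of a formula $F$ results from replacing $\mathbf a_i$, $\mathbf p_i$, $\mathbf x_i$ by $a$, $p$, $v$, respectively, followed by $i$ accents, and $\sim,(,),{,},\to$ by the underlined symbols. The *R-basis string* of $S$ with $B_S=[F_1;\dots;F_m]$ is $\tilde S=u*w*\tilde F_1*\cdots*\tilde F_m*$, and $\tilde S=u*w*\Box*$ if $m=0$, where $u$ is a string of $k$ accents ($\Box$ if $k=0$) and $w$ a string of $l$ accents ($\Box$ if $l=0$). **The universal recursive system $S_{11}$** has $A_{S_{11}}=A_{11}$, the predicate symbols occurring below, and the following basis R-axioms, where $x,y,u,w,z,r,t,s$ are distinct variables and $F_1,\dots,F_j\Rightarrow G$ abbreviates $\to F_1\cdots\to F_j\,G$ (premises are separated by semicolons): - $Acc\,'$; $\quad Acc\,x\Rightarrow Acc\,x'$; $\quad N_0\,\Box$; $\quad Acc\,x\Rightarrow N_0\,x$ - $Acc\,x;\,Acc\,y\Rightarrow\; <x,xy$; $\quad Acc\,x\Rightarrow\;\le x,x$; $\quad <x,y\;\Rightarrow\;\le x,y$ - $\le x,u\Rightarrow A_s\,ax,u$; $\quad \le x,w\Rightarrow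 P_s\,px,w$; $\quad Acc\,x\Rightarrow V\,vx$ - $A_s\,x,u\Rightarrow L\,x,u$; $\quad V\,x;\,N_0\,u\Rightarrow L\,x,u$; $\quad A_s\,x,u;\,L\,y,u\Rightarrow L\,x\underline(y\underline),u$; $\quad L\,x,u;\,L\,y,u\Rightarrow L\,xy,u$ - $A_s\,x,u\Rightarrow EL\,x,u$; $\quad A_s\,x,u;\,EL\,y,u\Rightarrow EL\,x\underline(y\underline),u$; $\quad EL\,x,u;\,EL\,y,u\Rightarrow EL\,xy,u$ - $L\,x,u\Rightarrow LL\,x,u$; $\quad LL\,x,u;\,L\,y,u\Rightarrow LL\,x\underline{,}y,u$ - $N_0\,w;\,L\,x,u;\,L\,y,u\Rightarrow Eq\,\underline\sim x\underline{,}y,u,w$ - $Eq\,x,u,w\Rightarrow PRF\,x,u,w$; $\quad P_s\,x,w;\,N_0\,u\Rightarrow PRF\,x,u,w$; $\quad P_s\,x,w;\,LL\,y,u\Rightarrow PRF\,xy,u,w$ - $EL\,x,u\Rightarrow ELL\,x,u$; $\quad ELL\,x,u;\,EL\,y,u\Rightarrow ELL\,x\underline{,}y,u$ - $N_0\,w;\,EL\,x,u;\,EL\,y,u\Rightarrow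 EPRF\,\underline\sim x\underline{,}y,u,w$; $\quad P_s\,x,w;\,N_0\,u\Rightarrow EPRF\,x,u,w$; $\quad P_s\,x,w;\,ELL\,y,u\Rightarrow EPRF\,xy,u,w$ - $PRF\,x,u,w\Rightarrow RF\,x,u,w$; $\quad PRF\,x,u,w;\,RF\,y,u,w\Rightarrow RF\,\underline\to xy,u,w$ - $<x,y\;\Rightarrow VV\,vx,vy$; $\quad <x,y\;\Rightarrow VV\,vy,vx$ - $A_s\,x,u;\,V\,z;\,L\,r,u\Rightarrow SbL\,x,r,z,x,u$; $\quad V\,x;\,L\,r,u\Rightarrow SbL\,x,r,x,r,u$; $\quad VV\,x,z;\,L\,r,u\Rightarrow SbL\,x,r,z,x,u$; $\quad A_s\,x,u;\,SbL\,y,r,z,t,u\Rightarrow SbL\,x\underline(y\underline),r,z,x\underline(t\underline),u$; $\quad SbL\,x,r,z,s,u;\,SbL\,y,r,z,t,u\Rightarrow SbL\,xy,r,z,st,u$ - $SbL\,x,r,z,s,u\Rightarrow SbLL\,x,r,z,s,u$; $\quad SbLL\,x,r,z,s,u;\,SbL\,y,r,z,t,u\Rightarrow SbLL\,x\underline{,}y,r,z,s\underline{,}t,u$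 - $N_0\,w;\,SbL\,x,r,z,s,u;\,SbL\,y,r,z,t,u\Rightarrow SbPRF\,\underline\sim x\underline{,}y,r,z,\underline\sim s\underline{,}t,u,w$; $\quad P_s\,x,w;\,V\,z;\,L\,r,u\Rightarrow SbPRF\,x,r,z,x,u,w$; $\quad P_s\,x,w;\,SbLL\,y,r,z,t,u\Rightarrow SbPRF\,xy,r,z,xt,u,w$ - $SbPRF\,x,r,z,s,u,w\Rightarrow SbRF\,x,r,z,s,u,w$; $\quad SbPRF\,x,r,z,s,u,w;\,SbRF\,y,r,z,t,u,w\Rightarrow SbRF\,\underline\to xy,r,z,\underline\to st,u,w$ - $RF\,x,u,w\Rightarrow SbRF\,x,x,u,w$; $\quad SbRF\,xz,s,z,rs,u,w\Rightarrow SbRF\,xz,rs,u,w$; $\quad SbRF\,xzy,s,z,rst,u,w\Rightarrow SbRF\,xzy,rst,u,w$ - $V\,x;\,V\,y\Rightarrow AP\,\underline\to\underline\sim x\underline{,}y,x,y$; $\quad V\,x;\,V\,y;\,AP\,r,s,t\Rightarrow AP\,\underline\to\underline\sim x\underline{,}yr,x\underline{,}s,y\underline{,}t$ - $N_0\,u;\,N_0\,w;\,V\,x\Rightarrow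 EqA\,\underline\sim x\underline{,}x,u,w$; $\quad V\,x;\,V\,y;\,Eq\,z,u,w;\,SbPRF\,z,x,y,s,u,w\Rightarrow EqA\,\underline\to s\underline\to\underline\sim x\underline{,}yz,u,w$; $\quad AP\,r,s,t;\,P_s\,z,w;\,N_0\,u\Rightarrow EqA\,r\underline\to zszt,u,w$ - $RF\,x,u,w\Rightarrow RBasis^+\,u*w*x*$; $\quad RF\,x,u,w;\,RBasis^+\,u*w*s*\Rightarrow RBasis^+\,u*w*s*x*$ - $N_0\,u;\,N_0\,w\Rightarrow RBasis\,u*w*\Box*$; $\quad RBasis^+\,x\Rightarrow RBasis\,x$ - $RF\,x,u,w\Rightarrow BRA\,u*w*x*,x$; $\quad RF\,x,u,w;\,RBasis^+\,u*w*s*\Rightarrow BRA\,u*w*s*x*,x$; $\quad RF\,x,u,w;\,BRA\,u*w*s*,y\Rightarrow BRA\,u*w*s*x*,y$ - $EqA\,x,u,w;\,RBasis\,u*w*s*\Rightarrow RA\,u*w*s*,x$; $\quad BRA\,x,y\Rightarrow RA\,x,y$ - $PRF\,x,u,w;\,BRA\,u*w*s*,x\Rightarrow PBRA\,u*w*s*,x$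 - $N_0\,u;\,N_0\,w;\,RA\,u*w*s*,x\Rightarrow D_s^+\,u*w*x*,u*w*s*$; $\quad D_s^+\,x,y;\,RA\,y,z\Rightarrow D_s^+\,xz*,y$ - $D_s^+\,x\underline\to rsz,t;\,BRA\,x\underline\to rsz,\underline\to rs;\,PBRA\,x\underline\to rsz,r;\,RBasis^+\,x\underline\to rszs*\Rightarrow D_s^+\,x\underline\to rszs*,t$ - $D_s^+\,u*wxyz,t;\,BRA\,u*wxyz,y;\,SbRF\,y,s,u,w\Rightarrow D_s^+\,u*wxyzs*,t$ - $N_0\,u;\,N_0\,w;\,RBasis\,u*w*s*\Rightarrow D_s\,u*w*\Box*,u*w*s*$; $\quad D_s^+\,x,y\Rightarrow D_s\,x,y$ - $EPRF\,x,u,w;\,BRA\,t,x;\,D_s\,t,y\Rightarrow\Omega_s\,yx$ **Statements and theorems of $S_{11}$.** An *$n$-ary $S_{11}$-statement* is a string $z=yx$ with $x,y\in A_{11}^+$ such that $y$ is the R-basis string of some recursive system $S$ and $x$ is the code of an $n$-ary elementary prime R-formula, not necessarily of $S$ itself. It is an *$n$-ary $S_{11}$-theorem* if in addition $\Omega_s\,yx$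 is R-derivable in $S_{11}$. **Theorem (a version of Gödel's First Incompleteness Theorem).** Let $B_s^{(1)}\subseteq A_{11}^+$ be the set of all 1-ary $S_{11}$-statements and $\Omega_s^{(1)}$ the set of all 1-ary $S_{11}$-theorems. Then $B_s^{(1)}$ and $\Omega_s^{(1)}$ are recursively enumerable, but the complement $\overline{\Omega}_s^{(1)}=B_s^{(1)}\setminus\Omega_s^{(1)}$ is not recursively enumerable. -/

import Mathlib

namespace RecSys

/-! ## Recursive systems -/

/-- The symbols of a recursive system: the constant and operation symbols (type `A`), the predicate
symbols (type `P`), the variables `x₁, x₂, …` (`var n` is the variable `xₙ₊₁`), and the five symbols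
for equality, the two brackets, the comma and the implication arrow. -/
inductive Sym (A P : Type) : Type
  | const (a : A)
  | pred (p : P)
  | var (n : ℕ)
  | sim
  | lpar
  | rpar
  | comma
  | arrow

/-- Strings of symbols. -/
abbrev Str (A P : Type) : Type := List (Sym A P)

section Basic

variable {A P : Type}

/-- Lists: constants `a` and variables `x` are lists; `f(l)` is a list for every list `l`;
the concatenation of two lists is a list. -/
inductive IsList : Str A P → Prop
  | const (a : A) : IsList [Sym.const a]
  | var (n : ℕ) : IsList [Sym.var n]
  | op (f : A) (l : Str A P) : IsList l →
      IsList (Sym.const f :: Sym.lpar :: (l ++ [Sym.rpar]))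
  | append (l m : Str A P) : IsList l → IsList m → IsList (l ++ m)

/-- A string without variables. -/
def VarFree (s : Str A P) : Prop := ∀ n : ℕ, Sym.var n ∉ s

/-- Elementary lists: lists without variables. -/
def IsElemList (l : Str A P) : Prop := IsList l ∧ VarFree l

/-- The equation `∼ l, m`. -/
def eqn (l m : Str A P) : Str A P := Sym.sim :: (l ++ Sym.comma :: m)

/-- The string `p l₁, l₂, …, lₙ` (just `p` for `n = 0`). -/
def atom (p : P) (ls : List (Str A P)) : Str A P :=
  Sym.pred p :: List.intercalate [Sym.comma] ls

/-- `IsPrime n F`: `F` is a prime R-formula with `n` argument lists. -/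
inductive IsPrime : ℕ → Str A P → Prop
  | eqn (l m : Str A P) : IsList l → IsList m → IsPrime 2 (eqn l m)
  | atom (p : P) (ls : List (Str A P)) : (∀ l ∈ ls, IsList l) → IsPrime ls.length (atom p ls)

/-- `IsElemPrime n F`: `F` is an `n`-ary elementary (i.e. variable-free) prime R-formula. -/
def IsElemPrime (n : ℕ) (F : Str A P) : Prop := IsPrime n F ∧ VarFree F

/-- The string `→ F G`. -/
def imp (F G : Str A P) : Str A P := Sym.arrow :: (F ++ G)

/-- The string `→ F₁ → F₂ … → Fₖ G`. -/
def imps (Fs : List (Str A P)) (G : Str A P) : Str A P := Fs.foldr imp G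

/-- R-formulas. -/
inductive IsFormula : Str A P → Prop
  | prime (n : ℕ) (F : Str A P) : IsPrime n F → IsFormula F
  | imp (n : ℕ) (F G : Str A P) : IsPrime n F → IsFormula G → IsFormula (imp F G)

/-- `subst x l F` replaces the variable `x` everywhere in `F` by `l`. -/
def subst (x : ℕ) (l : Str A P) (F : Str A P) : Str A P :=
  F.flatMap fun c => match c with
    | Sym.var n => if n = x then l else [Sym.var n]
    | c => [c]

/-- The R-axioms of equality. -/
inductive IsEqAxiom : Str A P → Prop
  | refl (x : ℕ) : IsEqAxiom (eqn [Sym.var x] [Sym.var x])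
  | subst (x y : ℕ) (l m : Str A P) : IsList l → IsList m →
      IsEqAxiom (imp (subst y [Sym.var x] (eqn l m))
        (imp (eqn [Sym.var x] [Sym.var y]) (eqn l m)))
  | atom (p : P) (xy : List (ℕ × ℕ)) : xy ≠ [] →
      IsEqAxiom (imps (xy.map fun q => eqn [Sym.var q.1] [Sym.var q.2])
        (imp (atom p (xy.map fun q => [Sym.var q.1])) (atom p (xy.map fun q => [Sym.var q.2]))))

end Basic

/-- A recursive system with finite sets `A` of constant and operation symbols and `P` of predicate
symbols is given by a finite (possibly empty) list of R-formulas, its basis R-axioms. -/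
structure RecursiveSystem (A P : Type) [Finite A] [Finite P] where
  basis : List (Str A P)
  isFormula : ∀ F ∈ basis, IsFormula F

namespace RecursiveSystem

variable {A P : Type} [Finite A] [Finite P]

/-- The R-axioms: the axioms of equality and the basis R-axioms. -/
def IsAxiom (S : RecursiveSystem A P) (F : Str A P) : Prop := IsEqAxiom F ∨ F ∈ S.basis

/-- R-derivations, generated by the Axiom Rule, the Modus Ponens Rule and the Substitution Rule. -/
inductive IsDerivation (S : RecursiveSystem A P) : List (Str A P) → Prop
  | nil : IsDerivation S []
  | ax (D : List (Str A P)) (F : Str A P) :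
      IsDerivation S D → S.IsAxiom F → IsDerivation S (D ++ [F])
  | mp (D : List (Str A P)) (F G : Str A P) :
      IsDerivation S D → IsFormula F → IsFormula G → F ∈ D → imp F G ∈ D →
      IsDerivation S (D ++ [G])
  | subst (D : List (Str A P)) (F : Str A P) (x : ℕ) (l : Str A P) :
      IsDerivation S D → F ∈ D → IsList l → IsDerivation S (D ++ [subst x l F])

/-- An R-formula is R-derivable if it is a step of an R-derivation. -/
def Derivable (S : RecursiveSystem A P) (F : Str A P) : Prop :=
  ∃ D : List (Str A P), S.IsDerivation D ∧ F ∈ D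

/-- The `n`-ary relation between elementary lists represented by the predicate symbol `p`. -/
def rel (S : RecursiveSystem A P) (p : P) (n : ℕ) : Set (Fin n → Str A P) :=
  {ls | (∀ i, IsElemList (ls i)) ∧ S.Derivable (atom p (List.ofFn ls))}

end RecursiveSystem

/-- A string over `B`, read as a string of constant symbols by means of `f : B → A`. -/
def constStr {A P B : Type} (f : B → A) (s : List B) : Str A P := s.map fun b => Sym.const (f b)

/-- A set `R` of strings over the alphabet `B` is recursively enumerable if there are a recursive
system `S` whose constant symbols comprise the alphabet `B` (via the injection `f`) and a predicate
symbol `p` of `S` such that the unary relation represented by `p` in `S` is exactly `R`. -/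
def RecEnum {B : Type} (R : Set (List B)) : Prop :=
  ∃ (A P : Type) (_ : Finite A) (_ : Finite P) (S : RecursiveSystem A P) (f : B ↪ A) (p : P),
    ∀ l : Str A P, (fun _ => l) ∈ S.rel p 1 ↔ ∃ s ∈ R, l = constStr f s

/-! ## The encoding of recursive systems -/

/-- The alphabet `A₁₁ = [a; v; p; □; '; *; ∼; (; ); ,; →]`, where the last five symbols are
the underlined ones. -/
inductive A11 : Type
  | a | v | p | box | acc | star | sim | lpar | rpar | comma | arrow
  deriving DecidableEq

instance : Fintype A11 where
  elems := {A11.a, A11.v, A11.p, A11.box, A11.acc, A11.star, A11.sim, A11.lpar, A11.rpar,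
    A11.comma, A11.arrow}
  complete := by intro c; cases c <;> decide

/-- The code of a symbol; the `i`-th constant symbol is coded by `a` followed by `i` accents,
the `i`-th predicate symbol by `p` followed by `i` accents, the variable `xᵢ` by `v` followed by
`i` accents, where `i` starts from one. -/
def encSym {k l : ℕ} : Sym (Fin k) (Fin l) → List A11
  | Sym.const i => A11.a :: List.replicate (i.val + 1) A11.acc
  | Sym.pred i => A11.p :: List.replicate (i.val + 1) A11.acc
  | Sym.var n => A11.v :: List.replicate (n + 1) A11.acc
  | Sym.sim => [A11.sim]
  | Sym.lpar => [A11.lpar]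
  | Sym.rpar => [A11.rpar]
  | Sym.comma => [A11.comma]
  | Sym.arrow => [A11.arrow]

/-- The code of a string of symbols. -/
def enc {k l : ℕ} (F : Str (Fin k) (Fin l)) : List A11 := F.flatMap encSym

/-- The code of a non-negative integer: `□` for zero, otherwise a string of accents. -/
def encNat (k : ℕ) : List A11 := if k = 0 then [A11.box] else List.replicate k A11.acc

/-- The R-basis string `u * w * F₁ * F₂ * … * Fₘ *`, or `u * w * □ *` if there are no basis
R-axioms. -/
def encSystem {k l : ℕ} (S : RecursiveSystem (Fin k) (Fin l)) : List A11 :=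
  encNat k ++ [A11.star] ++ encNat l ++ [A11.star] ++
    if S.basis = [] then [A11.box, A11.star] else S.basis.flatMap fun F => enc F ++ [A11.star]

/-! ## The universal recursive system -/

/-- The predicate symbols of the universal system. -/
inductive P11 : Type
  | Acc | N0 | lt | le | As | Ps | V | L | EL | LL | Eq | PRF | ELL | EPRF | RF | VV
  | SbL | SbLL | SbPRF | SbRF | AP | EqA | RBasisPlus | RBasis | BRA | RA | PBRA | DsPlus | Ds
  | Omega
  deriving DecidableEq

open P11 in
instance : Fintype P11 where
  elems := {Acc, N0, lt, le, As, Ps, V, L, EL, LL, Eq, PRF, ELL, EPRF, RF, VV, SbL, SbLL, SbPRF,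
    SbRF, AP, EqA, RBasisPlus, RBasis, BRA, RA, PBRA, DsPlus, Ds, Omega}
  complete := by intro c; cases c <;> decide

namespace U11

/-! The variables and the constants of the universal system, as strings of length one. -/

def x : Str A11 P11 := [Sym.var 0]
def y : Str A11 P11 := [Sym.var 1]
def u : Str A11 P11 := [Sym.var 2]
def w : Str A11 P11 := [Sym.var 3]
def z : Str A11 P11 := [Sym.var 4]
def r : Str A11 P11 := [Sym.var 5]
def t : Str A11 P11 := [Sym.var 6]
def s : Str A11 P11 := [Sym.var 7]
def a : Str A11 P11 := [Sym.const A11.a]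
def v : Str A11 P11 := [Sym.const A11.v]
def p : Str A11 P11 := [Sym.const A11.p]
def box : Str A11 P11 := [Sym.const A11.box]
def acc : Str A11 P11 := [Sym.const A11.acc]
def star : Str A11 P11 := [Sym.const A11.star]
def sim : Str A11 P11 := [Sym.const A11.sim]
def lpar : Str A11 P11 := [Sym.const A11.lpar]
def rpar : Str A11 P11 := [Sym.const A11.rpar]
def comma : Str A11 P11 := [Sym.const A11.comma]
def arrow : Str A11 P11 := [Sym.const A11.arrow]

open P11 in
/-- The basis R-axioms of the universal system. -/
def basis : List (Str A11 P11) := [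
  -- nonempty strings of accents, and codes of non-negative integers
  atom Acc [acc],
  imps [atom Acc [x]] (atom Acc [x ++ acc]),
  atom N0 [box],
  imps [atom Acc [x]] (atom N0 [x]),
  -- order
  imps [atom Acc [x], atom Acc [y]] (atom lt [x, x ++ y]),
  imps [atom Acc [x]] (atom le [x, x]),
  imps [atom lt [x, y]] (atom le [x, y]),
  -- constant symbols, predicate symbols, variables
  imps [atom le [x, u]] (atom As [a ++ x, u]),
  imps [atom le [x, w]] (atom Ps [p ++ x, w]),
  imps [atom Acc [x]] (atom V [v ++ x]),
  -- lists
  imps [atom As [x, u]] (atom L [x, u]),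
  imps [atom V [x], atom N0 [u]] (atom L [x, u]),
  imps [atom As [x, u], atom L [y, u]] (atom L [x ++ lpar ++ y ++ rpar, u]),
  imps [atom L [x, u], atom L [y, u]] (atom L [x ++ y, u]),
  -- elementary lists
  imps [atom As [x, u]] (atom EL [x, u]),
  imps [atom As [x, u], atom EL [y, u]] (atom EL [x ++ lpar ++ y ++ rpar, u]),
  imps [atom EL [x, u], atom EL [y, u]] (atom EL [x ++ y, u]),
  -- sequences of lists
  imps [atom L [x, u]] (atom LL [x, u]),
  imps [atom LL [x, u], atom L [y, u]] (atom LL [x ++ comma ++ y, u]),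
  -- equations and prime R-formulas
  imps [atom N0 [w], atom L [x, u], atom L [y, u]]
    (atom Eq [sim ++ x ++ comma ++ y, u, w]),
  imps [atom Eq [x, u, w]] (atom PRF [x, u, w]),
  imps [atom Ps [x, w], atom N0 [u]] (atom PRF [x, u, w]),
  imps [atom Ps [x, w], atom LL [y, u]] (atom PRF [x ++ y, u, w]),
  -- sequences of elementary lists
  imps [atom EL [x, u]] (atom ELL [x, u]),
  imps [atom ELL [x, u], atom EL [y, u]] (atom ELL [x ++ comma ++ y, u]),
  -- elementary prime R-formulas
  imps [atom N0 [w], atom EL [x, u], atom EL [y, u]]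
    (atom EPRF [sim ++ x ++ comma ++ y, u, w]),
  imps [atom Ps [x, w], atom N0 [u]] (atom EPRF [x, u, w]),
  imps [atom Ps [x, w], atom ELL [y, u]] (atom EPRF [x ++ y, u, w]),
  -- R-formulas
  imps [atom PRF [x, u, w]] (atom RF [x, u, w]),
  imps [atom PRF [x, u, w], atom RF [y, u, w]] (atom RF [arrow ++ x ++ y, u, w]),
  -- pairs of different variables
  imps [atom lt [x, y]] (atom VV [v ++ x, v ++ y]),
  imps [atom lt [x, y]] (atom VV [v ++ y, v ++ x]),
  -- substitution in lists
  imps [atom As [x, u], atom V [z], atom L [r, u]] (atom SbL [x, r, z, x, u]),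
  imps [atom V [x], atom L [r, u]] (atom SbL [x, r, x, r, u]),
  imps [atom VV [x, z], atom L [r, u]] (atom SbL [x, r, z, x, u]),
  imps [atom As [x, u], atom SbL [y, r, z, t, u]]
    (atom SbL [x ++ lpar ++ y ++ rpar, r, z, x ++ lpar ++ t ++ rpar, u]),
  imps [atom SbL [x, r, z, s, u], atom SbL [y, r, z, t, u]]
    (atom SbL [x ++ y, r, z, s ++ t, u]),
  -- substitution in sequences of lists
  imps [atom SbL [x, r, z, s, u]] (atom SbLL [x, r, z, s, u]),
  imps [atom SbLL [x, r, z, s, u], atom SbL [y, r, z, t, u]]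
    (atom SbLL [x ++ comma ++ y, r, z, s ++ comma ++ t, u]),
  -- substitution in prime R-formulas
  imps [atom N0 [w], atom SbL [x, r, z, s, u], atom SbL [y, r, z, t, u]]
    (atom SbPRF [sim ++ x ++ comma ++ y, r, z, sim ++ s ++ comma ++ t, u, w]),
  imps [atom Ps [x, w], atom V [z], atom L [r, u]] (atom SbPRF [x, r, z, x, u, w]),
  imps [atom Ps [x, w], atom SbLL [y, r, z, t, u]]
    (atom SbPRF [x ++ y, r, z, x ++ t, u, w]),
  -- substitution in R-formulas
  imps [atom SbPRF [x, r, z, s, u, w]] (atom SbRF [x, r, z, s, u, w]),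
  imps [atom SbPRF [x, r, z, s, u, w], atom SbRF [y, r, z, t, u, w]]
    (atom SbRF [arrow ++ x ++ y, r, z, arrow ++ s ++ t, u, w]),
  imps [atom RF [x, u, w]] (atom SbRF [x, x, u, w]),
  imps [atom SbRF [x ++ z, s, z, r ++ s, u, w]] (atom SbRF [x ++ z, r ++ s, u, w]),
  imps [atom SbRF [x ++ z ++ y, s, z, r ++ s ++ t, u, w]]
    (atom SbRF [x ++ z ++ y, r ++ s ++ t, u, w]),
  -- R-axioms of equality
  imps [atom V [x], atom V [y]] (atom AP [arrow ++ sim ++ x ++ comma ++ y, x, y]),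
  imps [atom V [x], atom V [y], atom AP [r, s, t]]
    (atom AP [arrow ++ sim ++ x ++ comma ++ y ++ r, x ++ comma ++ s, y ++ comma ++ t]),
  imps [atom N0 [u], atom N0 [w], atom V [x]] (atom EqA [sim ++ x ++ comma ++ x, u, w]),
  imps [atom V [x], atom V [y], atom Eq [z, u, w], atom SbPRF [z, x, y, s, u, w]]
    (atom EqA [arrow ++ s ++ arrow ++ sim ++ x ++ comma ++ y ++ z, u, w]),
  imps [atom AP [r, s, t], atom Ps [z, w], atom N0 [u]]
    (atom EqA [r ++ arrow ++ z ++ s ++ z ++ t, u, w]),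
  -- R-basis strings
  imps [atom RF [x, u, w]] (atom RBasisPlus [u ++ star ++ w ++ star ++ x ++ star]),
  imps [atom RF [x, u, w], atom RBasisPlus [u ++ star ++ w ++ star ++ s ++ star]]
    (atom RBasisPlus [u ++ star ++ w ++ star ++ s ++ star ++ x ++ star]),
  imps [atom N0 [u], atom N0 [w]] (atom RBasis [u ++ star ++ w ++ star ++ box ++ star]),
  imps [atom RBasisPlus [x]] (atom RBasis [x]),
  -- basis R-axioms, R-axioms and prime basis R-axioms
  imps [atom RF [x, u, w]] (atom BRA [u ++ star ++ w ++ star ++ x ++ star, x]),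
  imps [atom RF [x, u, w], atom RBasisPlus [u ++ star ++ w ++ star ++ s ++ star]]
    (atom BRA [u ++ star ++ w ++ star ++ s ++ star ++ x ++ star, x]),
  imps [atom RF [x, u, w], atom BRA [u ++ star ++ w ++ star ++ s ++ star, y]]
    (atom BRA [u ++ star ++ w ++ star ++ s ++ star ++ x ++ star, y]),
  imps [atom EqA [x, u, w], atom RBasis [u ++ star ++ w ++ star ++ s ++ star]]
    (atom RA [u ++ star ++ w ++ star ++ s ++ star, x]),
  imps [atom BRA [x, y]] (atom RA [x, y]),
  imps [atom PRF [x, u, w], atom BRA [u ++ star ++ w ++ star ++ s ++ star, x]]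
    (atom PBRA [u ++ star ++ w ++ star ++ s ++ star, x]),
  -- R-derivations
  imps [atom N0 [u], atom N0 [w], atom RA [u ++ star ++ w ++ star ++ s ++ star, x]]
    (atom DsPlus [u ++ star ++ w ++ star ++ x ++ star, u ++ star ++ w ++ star ++ s ++ star]),
  imps [atom DsPlus [x, y], atom RA [y, z]] (atom DsPlus [x ++ z ++ star, y]),
  imps [atom DsPlus [x ++ arrow ++ r ++ s ++ z, t],
      atom BRA [x ++ arrow ++ r ++ s ++ z, arrow ++ r ++ s],
      atom PBRA [x ++ arrow ++ r ++ s ++ z, r],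
      atom RBasisPlus [x ++ arrow ++ r ++ s ++ z ++ s ++ star]]
    (atom DsPlus [x ++ arrow ++ r ++ s ++ z ++ s ++ star, t]),
  imps [atom DsPlus [u ++ star ++ w ++ x ++ y ++ z, t],
      atom BRA [u ++ star ++ w ++ x ++ y ++ z, y],
      atom SbRF [y, s, u, w]]
    (atom DsPlus [u ++ star ++ w ++ x ++ y ++ z ++ s ++ star, t]),
  imps [atom N0 [u], atom N0 [w], atom RBasis [u ++ star ++ w ++ star ++ s ++ star]]
    (atom Ds [u ++ star ++ w ++ star ++ box ++ star, u ++ star ++ w ++ star ++ s ++ star]),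
  imps [atom DsPlus [x, y]] (atom Ds [x, y]),
  -- derivable elementary prime R-formulas
  imps [atom EPRF [x, u, w], atom BRA [t, x], atom Ds [t, y]] (atom Omega [y ++ x])]

end U11

theorem isFormula_imps {A P : Type} {G : Str A P} (hG : ∃ n, IsPrime n G) :
    ∀ Fs : List (Str A P), (∀ F ∈ Fs, ∃ n, IsPrime n F) → IsFormula (imps Fs G)
  | [], _ => by obtain ⟨n, hn⟩ := hG; exact IsFormula.prime n G hn
  | F :: Fs, h => by
    obtain ⟨n, hn⟩ := h F (by simp)
    exact IsFormula.imp n F _ hn (isFormula_imps hG Fs fun F' h' => h F' (by simp [h']))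

theorem isFormula_atom {A P : Type} (p : P) (ls : List (Str A P)) (h : ∀ l ∈ ls, IsList l) :
    IsFormula (atom p ls) := IsFormula.prime _ _ (IsPrime.atom p ls h)

theorem U11.isFormula_basis : ∀ F ∈ U11.basis, IsFormula F := by
  have hc : ∀ c : A11, IsList (P := P11) [Sym.const c] := fun c => IsList.const c
  have hv : ∀ n : ℕ, IsList (A := A11) (P := P11) [Sym.var n] := fun n => IsList.var n
  have ha : ∀ l m : Str A11 P11, IsList l → IsList m → IsList (l ++ m) := IsList.append
  have hp : ∀ (p : P11) (ls : List (Str A11 P11)), (∀ l ∈ ls, IsList l) →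
      ∃ n, IsPrime n (atom p ls) := fun p ls h => ⟨_, IsPrime.atom p ls h⟩
  have hn : ∀ l ∈ ([] : List (Str A11 P11)), IsList l := by simp
  have hn' : ∀ l ∈ ([] : List (Str A11 P11)), ∃ n, IsPrime n l := by simp
  have hn'' : ∀ l ∈ ([] : List (Str A11 P11)), IsFormula l := by simp
  unfold U11.basis
  repeat' first
    | exact hn
    | exact hn'
    | exact hn''
    | exact hc _
    | exact hv _
    | apply hp
    | apply isFormula_atom
    | apply isFormula_imps
    | apply ha
    | (rw [List.forall_mem_cons]; apply And.intro)

/-- The universal recursive system `S₁₁`. -/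
def S11 : RecursiveSystem A11 P11 where
  basis := U11.basis
  isFormula := U11.isFormula_basis

/-! ## Statements and theorems of the universal system -/

/-- `y` is an R-basis string which represents a recursive system. -/
def IsBasisString (y : List A11) : Prop :=
  ∃ (k l : ℕ) (S : RecursiveSystem (Fin k) (Fin l)), y = encSystem S

/-- `x` represents an `n`-ary elementary prime R-formula (of any recursive system). -/
def RepresentsElemPrime (n : ℕ) (x : List A11) : Prop :=
  ∃ (k l : ℕ) (F : Str (Fin k) (Fin l)), IsElemPrime n F ∧ x = enc F

/-- `n`-ary `S₁₁`-statements. The formula represented by `x` need not belong to the system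
represented by `y`. -/
def IsStatement (n : ℕ) (z : List A11) : Prop :=
  ∃ y x : List A11, IsBasisString y ∧ RepresentsElemPrime n x ∧ z = y ++ x

/-- `n`-ary `S₁₁`-theorems. -/
def IsTheorem (n : ℕ) (z : List A11) : Prop :=
  IsStatement n z ∧ S11.Derivable (atom P11.Omega [constStr id z])

/-- The set of all 1-ary `S₁₁`-statements. -/
def Bs1 : Set (List A11) := {z | IsStatement 1 z}

/-- The set of all 1-ary `S₁₁`-theorems. -/
def Omegas1 : Set (List A11) := {z | IsTheorem 1 z}

end RecSys

/-! R-formulas are Horn clauses, and the derivable elementary prime formulas of a recursive system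
form its least model on the elementary lists. A set of elementary prime formulas that respects the
equality axioms and all elementary instances of the basis axioms contains every derivable elementary
prime formula (`IsModel.sound`), and the derivable formulas themselves satisfy these conditions
(`derivable_isModel`). Hence underivability is always shown by exhibiting a model, and derivability
by applying clauses. The reading as Horn clauses rests on unique readability (`imps_inj`): no list
contains a symbol with which a formula can begin.

The clauses of the universal system contain no equations, and every variable of a conclusion occurs
in a premise. Equality can therefore be interpreted as identity, and derivable atoms speak only of
words of constants (`U11.sound`). The intended meanings of the predicate symbols satisfy the clauses
(`sem_closed`), which gives soundness; inductions on lists, formulas and derivations give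
completeness (`der_derivation`). Together: for an elementary prime formula `F` in the language of
`S`, the universal system derives `Omega` of the code of `S` followed by the code of `F` exactly
when `S` derives `F` (`der_omega_iff`).

For enumerability one clause suffices: a unary statement is an R-basis string followed by the code
of a predicate symbol and the code of an elementary list. Adding this clause to the universal
system, with the further premise `Omega` for theorems, represents the two sets
(`recEnum_isDescribed`).

For the complement, suppose that `p` represents it in `S`. Extend `S` by a predicate symbol for the
graph of the encoding of words and by a symbol `diag` with the clause: if `y` is the code of `x` and
`p (x π y)`, then `diag x`, where `π` is the code of `diag` itself. Let `y` be the R-basis string of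
the extension. The string `y π code(y)` is the statement that the extension derives `diag y`. If it
is no theorem, then `p` holds of it and `diag y` is derivable, so it is a theorem. If it is a
theorem, then `diag y` can only come from `p (y π code(s))` with `s` derivably equal to `y`; so
`diag s` is underivable, although it follows from `diag y` by congruence. The detour through `s` is
forced because `S` may derive equations between different words. -/

namespace RecSys

variable {A P A' P' : Type}

/-! ## Strings, lists and formulas -/

/-- Simultaneous substitution of strings for all variables. -/
def inst (σ : ℕ → Str A P) (F : Str A P) : Str A P :=
  F.flatMap fun c => match c with
    | Sym.var n => σ n
    | c => [c]

theorem subst_eq_inst (x : ℕ) (l F : Str A P) :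
    subst x l F = inst (fun n => if n = x then l else [Sym.var n]) F := rfl

@[simp] theorem inst_nil (σ : ℕ → Str A P) : inst σ [] = [] := rfl

@[simp] theorem inst_append (σ : ℕ → Str A P) (F G : Str A P) :
    inst σ (F ++ G) = inst σ F ++ inst σ G := List.flatMap_append

@[simp] theorem inst_var (σ : ℕ → Str A P) (n : ℕ) (F : Str A P) :
    inst σ (Sym.var n :: F) = σ n ++ inst σ F := rfl

@[simp] theorem inst_const (σ : ℕ → Str A P) (a : A) (F : Str A P) :
    inst σ (Sym.const a :: F) = Sym.const a :: inst σ F := rfl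

@[simp] theorem inst_pred (σ : ℕ → Str A P) (p : P) (F : Str A P) :
    inst σ (Sym.pred p :: F) = Sym.pred p :: inst σ F := rfl

@[simp] theorem inst_sim (σ : ℕ → Str A P) (F : Str A P) :
    inst σ (Sym.sim :: F) = Sym.sim :: inst σ F := rfl

@[simp] theorem inst_lpar (σ : ℕ → Str A P) (F : Str A P) :
    inst σ (Sym.lpar :: F) = Sym.lpar :: inst σ F := rfl

@[simp] theorem inst_rpar (σ : ℕ → Str A P) (F : Str A P) :
    inst σ (Sym.rpar :: F) = Sym.rpar :: inst σ F := rfl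

@[simp] theorem inst_comma (σ : ℕ → Str A P) (F : Str A P) :
    inst σ (Sym.comma :: F) = Sym.comma :: inst σ F := rfl

@[simp] theorem inst_arrow (σ : ℕ → Str A P) (F : Str A P) :
    inst σ (Sym.arrow :: F) = Sym.arrow :: inst σ F := rfl

@[simp] theorem inst_eqn (σ : ℕ → Str A P) (l m : Str A P) :
    inst σ (eqn l m) = eqn (inst σ l) (inst σ m) := by simp [eqn]

theorem inst_intercalate (σ : ℕ → Str A P) (ls : List (Str A P)) :
    inst σ ([Sym.comma].intercalate ls) = [Sym.comma].intercalate (ls.map (inst σ)) := by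
  induction ls with
  | nil => rfl
  | cons l ls ih => cases ls <;> simp_all

@[simp] theorem inst_atom (σ : ℕ → Str A P) (p : P) (ls : List (Str A P)) :
    inst σ (atom p ls) = atom p (ls.map (inst σ)) := by simp [atom, inst_intercalate]

@[simp] theorem inst_imp (σ : ℕ → Str A P) (F G : Str A P) :
    inst σ (imp F G) = imp (inst σ F) (inst σ G) := by simp [imp]

@[simp] theorem inst_imps (σ : ℕ → Str A P) (Fs : List (Str A P)) (G : Str A P) :
    inst σ (imps Fs G) = imps (Fs.map (inst σ)) (inst σ G) := by
  induction Fs with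
  | nil => rfl
  | cons F Fs ih => simp_all [imps]

theorem inst_inst (σ τ : ℕ → Str A P) (F : Str A P) :
    inst σ (inst τ F) = inst (fun n => inst σ (τ n)) F := by
  induction F with
  | nil => rfl
  | cons c F ih => cases c <;> simp [ih]

theorem inst_varFree (σ : ℕ → Str A P) {F : Str A P} (h : VarFree F) : inst σ F = F := by
  induction F with
  | nil => rfl
  | cons c F ih =>
    have ih := ih fun n hn => h n (List.mem_cons_of_mem _ hn)
    cases c <;> simp [ih]
    exact (h _ List.mem_cons_self).elim

theorem inst_self (F : Str A P) : inst (fun n => [Sym.var n]) F = F := by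
  induction F with
  | nil => rfl
  | cons c F ih => cases c <;> simp [ih]

theorem VarFree.inst {σ : ℕ → Str A P} (h : ∀ n, VarFree (σ n)) (F : Str A P) :
    VarFree (inst σ F) := by
  induction F with
  | nil => intro n hn; simp at hn
  | cons c F ih => intro n hn; cases c <;> simp at hn; all_goals grind [VarFree]

@[simp] theorem varFree_append {F G : Str A P} :
    VarFree (F ++ G) ↔ VarFree F ∧ VarFree G := by
  simp [VarFree, forall_and]

theorem IsList.inst {σ : ℕ → Str A P} (h : ∀ n, IsList (σ n)) {l : Str A P} (hl : IsList l) :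
    IsList (inst σ l) := by
  induction hl with
  | const a => exact IsList.const a
  | var n => simpa using h n
  | op f l _ ih => simpa using IsList.op f _ ih
  | append l m _ _ ih ih' => simpa using IsList.append _ _ ih ih'

theorem IsElemList.inst {σ : ℕ → Str A P} (h : ∀ n, IsElemList (σ n)) {l : Str A P}
    (hl : IsList l) : IsElemList (inst σ l) :=
  ⟨hl.inst fun n => (h n).1, VarFree.inst (fun n => (h n).2) l⟩

theorem IsPrime.inst {σ : ℕ → Str A P} (h : ∀ n, IsList (σ n)) {k : ℕ} {F : Str A P}
    (hF : IsPrime k F) : IsPrime k (inst σ F) := by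
  cases hF with
  | eqn l m hl hm => simpa using IsPrime.eqn _ _ (hl.inst h) (hm.inst h)
  | atom p ls hls =>
    have := IsPrime.atom p (ls.map (RecSys.inst σ)) (by
      intro l hl
      obtain ⟨l', hl', rfl⟩ := List.mem_map.1 hl
      exact (hls l' hl').inst h)
    simpa using this

theorem IsFormula.inst {σ : ℕ → Str A P} (h : ∀ n, IsList (σ n)) {F : Str A P}
    (hF : IsFormula F) : IsFormula (inst σ F) := by
  induction hF with
  | prime n F hF => exact .prime n _ (hF.inst h)
  | imp n F G hF _ ih => simpa using IsFormula.imp n _ _ (hF.inst h) ih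

theorem isList_subst_values {l : Str A P} (hl : IsList l) (x n : ℕ) :
    IsList (if n = x then l else [Sym.var n] : Str A P) := by
  split
  · exact hl
  · exact .var n

theorem IsFormula.subst {l F : Str A P} (hl : IsList l) (x : ℕ) (hF : IsFormula F) :
    IsFormula (subst x l F) := hF.inst (isList_subst_values hl x)

/-! ### Unique readability of prime formulas and implications. -/

/-- Symbols that occur in lists. -/
def Sym.IsTerm : Sym A P → Prop
  | .const _ | .var _ | .lpar | .rpar => True
  | _ => False

/-- Symbols with which formulas begin. -/
def Sym.IsHead : Sym A P → Prop
  | .pred _ | .sim | .arrow => True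
  | _ => False

theorem IsList.ne_nil {l : Str A P} (h : IsList l) : l ≠ [] := by
  induction h <;> simp_all

theorem IsList.isTerm {l : Str A P} (h : IsList l) : ∀ c ∈ l, c.IsTerm := by
  induction h with
  | const a => simp [Sym.IsTerm]
  | var n => simp [Sym.IsTerm]
  | op f l _ ih =>
    intro c hc
    simp at hc
    rcases hc with rfl | rfl | hc | rfl
    all_goals first | exact ih _ hc | trivial
  | append l m _ _ ih ih' => intro c hc; rcases List.mem_append.1 hc with hc | hc <;> grind

theorem IsList.comma_notMem {l : Str A P} (h : IsList l) : Sym.comma ∉ l :=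
  fun hc => h.isTerm _ hc

theorem mem_intercalate {α : Type} {s c : α} {ls : List (List α)}
    (h : c ∈ [s].intercalate ls) : c = s ∨ ∃ l ∈ ls, c ∈ l := by
  induction ls with
  | nil => simp at h
  | cons l ls ih => cases ls <;> simp_all; tauto

/-- Lists and commas contribute no symbol with which a formula can begin, so such a symbol stands
only at the front. This is the marker that shows where the second part of `→ F G` starts. -/
theorem IsPrime.shape {n : ℕ} {F : Str A P} (h : IsPrime n F) :
    ∃ c G, F = c :: G ∧ (c = .sim ∨ ∃ p, c = .pred p) ∧ ∀ d ∈ G, ¬ d.IsHead := by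
  have key : ∀ l : Str A P, IsList l → ∀ d ∈ l, ¬ d.IsHead := by
    intro l hl d hd
    have := hl.isTerm d hd
    cases d <;> simp_all [Sym.IsTerm, Sym.IsHead]
  cases h with
  | eqn l m hl hm =>
    refine ⟨_, _, rfl, Or.inl rfl, fun d hd => ?_⟩
    simp at hd
    rcases hd with hd | rfl | hd
    · exact key l hl d hd
    · exact id
    · exact key m hm d hd
  | atom p ls hls =>
    refine ⟨_, _, rfl, Or.inr ⟨p, rfl⟩, fun d hd => ?_⟩
    rcases mem_intercalate hd with rfl | ⟨l, hl, hd⟩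
    · exact id
    · exact key l (hls l hl) d hd

theorem IsFormula.shape {F : Str A P} (h : IsFormula F) : ∃ c G, F = c :: G ∧ c.IsHead := by
  cases h with
  | prime n F hF =>
    obtain ⟨c, G, rfl, h, -⟩ := hF.shape
    refine ⟨c, G, rfl, ?_⟩
    rcases h with rfl | ⟨p, rfl⟩ <;> trivial
  | imp n F G hF hG => exact ⟨_, _, rfl, trivial⟩

theorem IsPrime.ne_imp {n : ℕ} {F : Str A P} (h : IsPrime n F) (G H : Str A P) :
    F ≠ imp G H := by
  obtain ⟨c, G, rfl, h, -⟩ := h.shape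
  rcases h with rfl | ⟨p, rfl⟩ <;> simp [imp]

/-- If one prime formula were a proper prefix of the other, the head symbol of the formula following
the shorter one would lie in the tail of the longer one, contrary to `IsPrime.shape`. -/
theorem IsPrime.append_inj {n n' : ℕ} {F F' G G' : Str A P} (hF : IsPrime n F)
    (hF' : IsPrime n' F') (hG : IsFormula G) (hG' : IsFormula G') (h : F ++ G = F' ++ G') :
    F = F' ∧ G = G' := by
  have key : ∀ {n n' : ℕ} {F F' G G' : Str A P}, IsPrime n F → IsPrime n' F' → IsFormula G →
      ∀ d, F' = F ++ d → G = d ++ G' → F = F' ∧ G = G' := by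
    intro n n' F F' G G' hF hF' hG d h1 h2
    rcases d with - | ⟨c, d⟩
    · simp_all
    · obtain ⟨b, E, rfl, -⟩ := hF.shape
      obtain ⟨b', E', rfl, -, hE⟩ := hF'.shape
      obtain ⟨e, G₀, rfl, he⟩ := hG.shape
      simp at h1 h2
      exact (hE c (by simp [h1]) (h2.1 ▸ he)).elim
  rcases List.append_eq_append_iff.1 h with ⟨d, h1, h2⟩ | ⟨d, h1, h2⟩
  · exact key hF hF' hG d h1 h2
  · have := key hF' hF hG' d h1 h2
    exact ⟨this.1.symm, this.2.symm⟩

/-- A formula never starts with two arrows. Modus ponens is stated for arbitrary formulas `F`, but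
this confines it to prime premises, as the Horn clause reading requires. -/
theorem IsFormula.isPrime_of_imp {F G : Str A P} (hF : IsFormula F)
    (h : IsFormula (RecSys.imp F G)) :
    ∃ n, IsPrime n F := by
  cases hF with
  | prime n F hF => exact ⟨n, hF⟩
  | imp n F H hF hH =>
    generalize hE : RecSys.imp (RecSys.imp F H) G = E at h
    cases h with
    | prime n _ h => exact (h.ne_imp _ _ hE.symm).elim
    | imp n F' G' hF' hG' =>
      obtain ⟨c, K, rfl, h, -⟩ := hF'.shape
      rcases h with rfl | ⟨p, rfl⟩ <;> simp [RecSys.imp] at hE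

theorem imps_isFormula {Fs : List (Str A P)} {G : Str A P} (hFs : ∀ F ∈ Fs, ∃ n, IsPrime n F)
    (hG : IsFormula G) : IsFormula (imps Fs G) := by
  induction Fs with
  | nil => exact hG
  | cons F Fs ih =>
    obtain ⟨n, hn⟩ := hFs F (by simp)
    exact .imp n _ _ hn (ih fun F' h' => hFs F' (by simp [h']))

theorem imps_inj {Fs Fs' : List (Str A P)} {G G' : Str A P}
    (hFs : ∀ F ∈ Fs, ∃ n, IsPrime n F) (hFs' : ∀ F ∈ Fs', ∃ n, IsPrime n F)
    (hG : ∃ n, IsPrime n G) (hG' : ∃ n, IsPrime n G') (h : imps Fs G = imps Fs' G') :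
    Fs = Fs' ∧ G = G' := by
  have hGf : IsFormula G := hG.elim fun n hn => .prime n _ hn
  have hGf' : IsFormula G' := hG'.elim fun n hn => .prime n _ hn
  induction Fs generalizing Fs' with
  | nil =>
    cases Fs' with
    | nil => exact ⟨rfl, h⟩
    | cons F' Fs' => exact (hG.choose_spec.ne_imp _ _ h).elim
  | cons F Fs ih =>
    cases Fs' with
    | nil => exact (hG'.choose_spec.ne_imp _ _ h.symm).elim
    | cons F' Fs' =>
      simp only [List.forall_mem_cons] at hFs hFs'
      obtain ⟨⟨n, hn⟩, hFs⟩ := hFs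
      obtain ⟨⟨n', hn'⟩, hFs'⟩ := hFs'
      have h : F ++ imps Fs G = F' ++ imps Fs' G' := List.cons_injective h
      obtain ⟨rfl, h'⟩ := hn.append_inj hn' (imps_isFormula hFs hGf) (imps_isFormula hFs' hGf') h
      obtain ⟨rfl, rfl⟩ := ih hFs hFs' h'
      exact ⟨rfl, rfl⟩

/-- Splitting at the separator recovers the pieces. Nonemptiness of the pieces is what separates
`[]` from `[[]]`, which have the same intercalation. -/
theorem intercalate_inj {α : Type} {s : α} {ls ls' : List (List α)} (h1 : ∀ l ∈ ls, l ≠ [] ∧ s ∉ l)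
    (h2 : ∀ l ∈ ls', l ≠ [] ∧ s ∉ l) (h : [s].intercalate ls = [s].intercalate ls') : ls = ls' := by
  classical
  have ne : ∀ ls : List (List α), (∀ l ∈ ls, l ≠ [] ∧ s ∉ l) → [s].intercalate ls = [] → ls = [] := by
    intro ls h h'
    rcases ls with - | ⟨l, - | ⟨l', ls⟩⟩ <;> simp_all
  rcases eq_or_ne ls [] with rfl | hls
  · exact (ne ls' h2 (by simpa using h.symm)).symm
  · rcases eq_or_ne ls' [] with rfl | hls'
    · exact ne ls h1 (by simpa using h)
    · rw [← List.splitOn_intercalate s (fun l hl => (h1 l hl).2) hls, h,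
        List.splitOn_intercalate s (fun l hl => (h2 l hl).2) hls']

theorem atom_inj {p p' : P} {ls ls' : List (Str A P)} (h1 : ∀ l ∈ ls, IsList l)
    (h2 : ∀ l ∈ ls', IsList l) (h : atom p ls = atom p' ls') : p = p' ∧ ls = ls' := by
  simp only [atom, List.cons.injEq, Sym.pred.injEq] at h
  exact ⟨h.1, intercalate_inj (fun l hl => ⟨(h1 l hl).ne_nil, (h1 l hl).comma_notMem⟩)
    (fun l hl => ⟨(h2 l hl).ne_nil, (h2 l hl).comma_notMem⟩) h.2⟩

theorem append_cons_inj {α : Type} {c : α} {l l' m m' : List α} (h : c ∉ l) (h' : c ∉ l')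
    (e : l ++ c :: m = l' ++ c :: m') : l = l' ∧ m = m' := by
  induction l generalizing l' with
  | nil =>
    cases l' with
    | nil => exact ⟨rfl, List.cons_injective e⟩
    | cons b' l' => exact (h' (List.head_eq_of_cons_eq e ▸ List.mem_cons_self)).elim
  | cons b l ih =>
    cases l' with
    | nil => exact (h (List.head_eq_of_cons_eq e ▸ List.mem_cons_self)).elim
    | cons b' l' =>
      simp only [List.mem_cons, not_or] at h h'
      obtain ⟨rfl, e'⟩ := List.cons.inj e
      obtain ⟨rfl, rfl⟩ := ih h.2 h'.2 e'
      exact ⟨rfl, rfl⟩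

theorem eqn_inj {l m l' m' : Str A P} (h1 : IsList l) (h2 : IsList l') (h : eqn l m = eqn l' m') :
    l = l' ∧ m = m' := by
  simp only [eqn, List.cons.injEq, true_and] at h
  exact append_cons_inj h1.comma_notMem h2.comma_notMem h

/-! ### Renaming of symbols -/

/-- Renaming of constant and predicate symbols. -/
def Sym.map (f : A → A') (g : P → P') : Sym A P → Sym A' P'
  | .const a => .const (f a)
  | .pred p => .pred (g p)
  | .var n => .var n
  | .sim => .sim
  | .lpar => .lpar
  | .rpar => .rpar
  | .comma => .comma
  | .arrow => .arrow

/-- Renaming of constant and predicate symbols in a string. -/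
abbrev mapStr (f : A → A') (g : P → P') (F : Str A P) : Str A' P' := List.map (Sym.map f g) F

section map

variable (f : A → A') (g : P → P')

theorem mapStr_injective (hf : f.Injective) (hg : g.Injective) : (mapStr f g).Injective := by
  apply List.map_injective_iff.2
  intro c d h
  cases c <;> cases d <;> simp_all [Sym.map, hf.eq_iff, hg.eq_iff]

@[simp] theorem mapStr_eqn (l m : Str A P) :
    mapStr f g (eqn l m) = eqn (mapStr f g l) (mapStr f g m) := by simp [eqn, mapStr, Sym.map]

@[simp] theorem mapStr_atom (p : P) (ls : List (Str A P)) :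
    mapStr f g (atom p ls) = atom (g p) (ls.map (mapStr f g)) := by
  simp only [mapStr, atom, List.map_cons, Sym.map, List.cons.injEq, true_and]
  induction ls with
  | nil => rfl
  | cons l ls ih => cases ls <;> simp_all [Sym.map]

@[simp] theorem mapStr_imp (F G : Str A P) :
    mapStr f g (imp F G) = imp (mapStr f g F) (mapStr f g G) := by simp [imp, mapStr, Sym.map]

@[simp] theorem mapStr_imps (Fs : List (Str A P)) (G : Str A P) :
    mapStr f g (imps Fs G) = imps (Fs.map (mapStr f g)) (mapStr f g G) := by
  induction Fs with
  | nil => rfl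
  | cons F Fs ih => simp_all [imps]

theorem mapStr_inst (σ : ℕ → Str A P) (F : Str A P) :
    mapStr f g (inst σ F) = inst (fun n => mapStr f g (σ n)) (mapStr f g F) := by
  induction F with
  | nil => rfl
  | cons c F ih => cases c <;> simp_all [Sym.map, mapStr]

@[simp] theorem mapStr_subst (x : ℕ) (l F : Str A P) :
    mapStr f g (subst x l F) = subst x (mapStr f g l) (mapStr f g F) := by
  simp only [subst_eq_inst, mapStr_inst]
  congr 1
  funext n
  split <;> rfl

@[simp] theorem varFree_mapStr {F : Str A P} : VarFree (mapStr f g F) ↔ VarFree F := by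
  refine forall_congr' fun n => not_congr ?_
  simp only [mapStr, List.mem_map]
  constructor
  · rintro ⟨c, hc, h⟩
    cases c <;> simp_all [Sym.map]
  · exact fun h => ⟨_, h, rfl⟩

variable {f g}

theorem IsList.map {l : Str A P} (h : IsList l) : IsList (mapStr f g l) := by
  induction h with
  | const a => exact .const _
  | var n => exact .var n
  | op a l _ ih => simpa [mapStr, Sym.map] using IsList.op (f a) _ ih
  | append l m _ _ ih ih' => simpa [mapStr] using IsList.append _ _ ih ih'

theorem IsElemList.map {l : Str A P} (h : IsElemList l) : IsElemList (mapStr f g l) :=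
  ⟨h.1.map, (varFree_mapStr f g).2 h.2⟩

theorem IsPrime.map {n : ℕ} {F : Str A P} (h : IsPrime n F) : IsPrime n (mapStr f g F) := by
  cases h with
  | eqn l m hl hm => simpa using IsPrime.eqn _ _ (hl.map (f := f) (g := g)) hm.map
  | atom p ls hls =>
    have := IsPrime.atom (g p) (ls.map (mapStr f g)) (by
      intro l hl
      obtain ⟨l', hl', rfl⟩ := List.mem_map.1 hl
      exact (hls l' hl').map)
    simpa using this

theorem IsFormula.map {F : Str A P} (h : IsFormula F) : IsFormula (mapStr f g F) := by
  induction h with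
  | prime n F hF => exact .prime n _ hF.map
  | imp n F G hF _ ih => simpa using IsFormula.imp n _ _ hF.map ih

theorem IsEqAxiom.map {F : Str A P} (h : IsEqAxiom F) : IsEqAxiom (mapStr f g F) := by
  cases h with
  | refl x => exact .refl x
  | subst x y l m hl hm =>
    simpa [Sym.map] using IsEqAxiom.subst x y _ _ (hl.map (f := f) (g := g)) hm.map
  | atom p xy h => simpa [Sym.map, Function.comp_def] using IsEqAxiom.atom (g p) xy h

/-- A list in an extended language without new constants is a list of the original language. -/
theorem IsList.exists_map {l : Str A' P'} (h : IsList l) (f : A ≃ A') (g : P → P') :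
    ∃ m : Str A P, IsList m ∧ mapStr f g m = l := by
  induction h with
  | const a => exact ⟨_, .const (f.symm a), by simp [mapStr, Sym.map]⟩
  | var n => exact ⟨_, .var n, rfl⟩
  | op a l _ ih =>
    obtain ⟨m, hm, rfl⟩ := ih
    exact ⟨_, .op (f.symm a) m hm, by simp [mapStr, Sym.map]⟩
  | append l l' _ _ ih ih' =>
    obtain ⟨m, hm, rfl⟩ := ih
    obtain ⟨m', hm', rfl⟩ := ih'
    exact ⟨_, .append m m' hm hm', by simp [mapStr]⟩

theorem IsElemList.exists_map {l : Str A' P'} (h : IsElemList l) (f : A ≃ A') (g : P → P') :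
    ∃ m : Str A P, IsElemList m ∧ mapStr f g m = l := by
  obtain ⟨m, hm, rfl⟩ := h.1.exists_map f g
  exact ⟨m, ⟨hm, (varFree_mapStr f g).1 h.2⟩, rfl⟩

end map

end RecSys

namespace RecSys

variable {A P A' P' : Type}

/-! ## Derivability -/

theorem IsEqAxiom.isFormula {F : Str A P} (h : IsEqAxiom F) : IsFormula F := by
  have hv : ∀ x y : ℕ, IsPrime 2 (eqn [Sym.var x] [Sym.var y] : Str A P) :=
    fun x y => .eqn _ _ (.var x) (.var y)
  cases h with
  | refl x => exact .prime 2 _ (hv x x)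
  | subst x y l m hl hm =>
    refine .imp 2 _ _ ?_ (.imp 2 _ _ (hv x y) (.prime 2 _ (.eqn _ _ hl hm)))
    exact (IsPrime.eqn _ _ hl hm).inst (isList_subst_values (.var x) y)
  | atom p xy h =>
    refine imps_isFormula ?_ (.imp _ _ _ (.atom p _ ?_) (.prime _ _ (.atom p _ ?_)))
    · simp only [List.mem_map]
      rintro F ⟨q, -, rfl⟩
      exact ⟨2, hv _ _⟩
    all_goals
      simp only [List.mem_map]
      rintro F ⟨q, -, rfl⟩
      exact .var _

theorem exists_var_bound (F : Str A P) : ∃ N, ∀ n, Sym.var n ∈ F → n < N := by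
  induction F with
  | nil => exact ⟨0, by simp⟩
  | cons c F ih =>
    obtain ⟨N, hN⟩ := ih
    cases c with
    | var m =>
      refine ⟨max N (m + 1), fun n hn => ?_⟩
      simp at hn
      rcases hn with rfl | hn
      · simp
      · exact (hN n hn).trans_le (le_max_left _ _)
    | _ => exact ⟨N, fun n hn => hN n (by simpa using hn)⟩

theorem inst_congr {σ τ : ℕ → Str A P} {F : Str A P} (h : ∀ n, Sym.var n ∈ F → σ n = τ n) :
    inst σ F = inst τ F := by
  induction F with
  | nil => rfl
  | cons c F ih => cases c <;> simp_all

theorem exists_elemList [Nonempty A] : ∃ σ : ℕ → Str A P, ∀ n, IsElemList (σ n) :=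
  ⟨fun _ => [.const (Classical.arbitrary A)], fun _ => ⟨.const _, by simp [VarFree]⟩⟩

/-! ### Closure properties of derivability. -/

namespace RecursiveSystem

variable [Finite A] [Finite P] [Finite A'] [Finite P']

theorem IsDerivation.isFormula {S : RecursiveSystem A P} {D : List (Str A P)}
    (h : S.IsDerivation D) : ∀ F ∈ D, IsFormula F := by
  induction h with
  | nil => simp
  | ax D F _ h ih =>
    have := h.elim IsEqAxiom.isFormula (S.isFormula F)
    grind
  | mp D F G _ hF hG h h' ih => grind
  | subst D F x l _ hF hl ih =>
    have := (ih F hF).subst hl x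
    grind

theorem IsDerivation.append {S : RecursiveSystem A P} {D E : List (Str A P)}
    (hD : S.IsDerivation D) (hE : S.IsDerivation E) : S.IsDerivation (D ++ E) := by
  induction hE with
  | nil => simpa using hD
  | ax E F _ h ih => simpa using ih.ax _ F h
  | mp E F G _ hF hG h h' ih => simpa using ih.mp _ F G hF hG (by simp [h]) (by simp [h'])
  | subst E F x l _ hF hl ih => simpa using ih.subst _ F x l (by simp [hF]) hl

variable {S : RecursiveSystem A P} {F G : Str A P}

theorem Derivable.isFormula (h : S.Derivable F) : IsFormula F := by
  obtain ⟨D, hD, hF⟩ := h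
  exact hD.isFormula F hF

theorem IsAxiom.derivable (h : S.IsAxiom F) : S.Derivable F :=
  ⟨[] ++ [F], .ax _ _ .nil h, by simp⟩

theorem Derivable.mp (hF : S.Derivable F) (h : S.Derivable (imp F G)) (hG : IsFormula G) :
    S.Derivable G := by
  have hF' := hF.isFormula
  obtain ⟨D, hD, hF⟩ := hF
  obtain ⟨E, hE, h⟩ := h
  exact ⟨_, (hD.append hE).mp _ F G hF' hG (by simp [hF]) (by simp [h]), by simp⟩

theorem Derivable.subst (hF : S.Derivable F) (x : ℕ) {l : Str A P} (hl : IsList l) :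
    S.Derivable (subst x l F) := by
  obtain ⟨D, hD, hF⟩ := hF
  exact ⟨_, hD.subst _ F x l hF hl, by simp⟩

/-- An induction principle for derivable formulas. -/
theorem Derivable.induction {C : Str A P → Prop} (ax : ∀ F, S.IsAxiom F → C F)
    (mp : ∀ n F G, IsPrime n F → IsFormula G → C F → C (imp F G) → C G)
    (subst : ∀ F x l, IsList l → C F → C (RecSys.subst x l F)) (h : S.Derivable F) : C F := by
  obtain ⟨D, hD, hF⟩ := h
  induction hD generalizing F with
  | nil => simp at hF
  | ax D F' _ h ih => grind
  | mp D F' G hD hF' hG h h' ih =>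
    obtain ⟨n, hn⟩ := hF'.isPrime_of_imp (hD.isFormula _ h')
    grind
  | subst D F' x l _ hF' hl ih => grind

theorem Derivable.map {S' : RecursiveSystem A' P'} {f : A → A'} {g : P → P'}
    (hS : ∀ F ∈ S.basis, mapStr f g F ∈ S'.basis) (h : S.Derivable F) :
    S'.Derivable (mapStr f g F) := by
  refine Derivable.induction (C := fun F => S'.Derivable (mapStr f g F)) ?_ ?_ ?_ h
  · exact fun F h => IsAxiom.derivable (h.imp IsEqAxiom.map (hS F))
  · exact fun n F G hF hG h h' => h.mp (by simpa using h') hG.map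
  · exact fun F x l hl h => by simpa using h.subst x (hl.map (f := f) (g := g))

/-- Simultaneous substitution of variable-free lists for the variables `< N`. -/
def instBelow (N : ℕ) (σ : ℕ → Str A P) (n : ℕ) : Str A P := if n < N then σ n else [Sym.var n]

/-- The Substitution Rule treats one variable at a time. Since the inserted lists are variable-free,
later replacements leave them alone, and the successive replacements amount to a simultaneous one.
-/
theorem Derivable.instBelow {σ : ℕ → Str A P} (hσ : ∀ n, IsElemList (σ n)) (N : ℕ)
    (h : S.Derivable F) : S.Derivable (inst (instBelow N σ) F) := by
  induction N with
  | zero =>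
    convert h
    exact inst_self F
  | succ N ih =>
    convert ih.subst N (hσ N).1 using 1
    rw [subst_eq_inst, inst_inst]
    congr 1
    funext n
    unfold RecursiveSystem.instBelow
    rcases lt_trichotomy n N with h | rfl | h
    · rw [if_pos (by omega), if_pos h, inst_varFree _ (hσ n).2]
    · simp
    · rw [if_neg (by omega), if_neg (by omega)]
      simp [show n ≠ N by omega]

theorem Derivable.inst {σ : ℕ → Str A P} (hσ : ∀ n, IsElemList (σ n)) (h : S.Derivable F) :
    S.Derivable (inst σ F) := by
  obtain ⟨N, hN⟩ := exists_var_bound F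
  convert h.instBelow hσ N using 1
  exact inst_congr fun n hn => (if_pos (hN n hn)).symm

end RecursiveSystem

/-! ## Truth -/

/-- The truth of `F₁, …, Fₖ ⇒ G` with respect to a set `T` of true prime formulas. -/
def Holds (T : Str A P → Prop) (F : Str A P) : Prop :=
  ∀ Fs G, (∀ F' ∈ Fs, ∃ n, IsPrime n F') → (∃ n, IsPrime n G) → F = imps Fs G →
    (∀ F' ∈ Fs, T F') → T G

/-- By unique readability the visible decomposition is the only one over which `Holds` quantifies.
-/
theorem holds_imps {T : Str A P → Prop} {Fs : List (Str A P)} {G : Str A P}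
    (hFs : ∀ F ∈ Fs, ∃ n, IsPrime n F) (hG : ∃ n, IsPrime n G) :
    Holds T (imps Fs G) ↔ ((∀ F ∈ Fs, T F) → T G) := by
  refine ⟨fun h => h Fs G hFs hG rfl, fun h Fs' G' hFs' hG' e => ?_⟩
  obtain ⟨rfl, rfl⟩ := imps_inj hFs hFs' hG hG' e
  exact h

theorem holds_prime {T : Str A P → Prop} {n : ℕ} {F : Str A P} (hF : IsPrime n F) :
    Holds T F ↔ T F := by
  have := holds_imps (T := T) (Fs := []) (by simp) ⟨n, hF⟩
  simpa [imps] using this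

theorem IsFormula.exists_imps {F : Str A P} (h : IsFormula F) :
    ∃ Fs G, (∀ F' ∈ Fs, ∃ n, IsPrime n F') ∧ (∃ n, IsPrime n G) ∧ F = imps Fs G := by
  induction h with
  | prime n F hF => exact ⟨[], F, by simp, ⟨n, hF⟩, rfl⟩
  | imp n F G hF _ ih =>
    obtain ⟨Fs, G, h1, h2, rfl⟩ := ih
    exact ⟨F :: Fs, G, by simpa using ⟨⟨n, hF⟩, h1⟩, h2, rfl⟩

variable [Finite A] [Finite P]

/-- `T` is the set of true elementary prime formulas of a model of `S` on the elementary lists. -/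
structure IsModel (S : RecursiveSystem A P) (T : Str A P → Prop) : Prop where
  refl : ∀ l, IsElemList l → T (eqn l l)
  subst : ∀ σ : ℕ → Str A P, (∀ n, IsElemList (σ n)) → ∀ x y l m, IsList l → IsList m →
    T (inst σ (subst y [Sym.var x] (eqn l m))) → T (eqn (σ x) (σ y)) → T (inst σ (eqn l m))
  atom : ∀ p, ∀ ls : List (Str A P × Str A P),
    (∀ q ∈ ls, IsElemList q.1 ∧ IsElemList q.2 ∧ T (eqn q.1 q.2)) →
    T (atom p (ls.map Prod.fst)) → T (atom p (ls.map Prod.snd))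
  basis : ∀ F ∈ S.basis, ∀ σ : ℕ → Str A P, (∀ n, IsElemList (σ n)) → Holds T (inst σ F)

namespace RecursiveSystem

variable {S : RecursiveSystem A P} {F G : Str A P}

/-- Induction on the derivation, for all elementary valuations at once: a substitution followed by a
valuation is again an elementary valuation, which settles the Substitution Rule, and modus ponens
removes the first premise of a true clause. -/
theorem _root_.RecSys.IsModel.holds {T : Str A P → Prop} (hT : IsModel S T) (h : S.Derivable F)
    {σ : ℕ → Str A P} (hσ : ∀ n, IsElemList (σ n)) : Holds T (RecSys.inst σ F) := by
  refine Derivable.induction (C := fun F => ∀ σ : ℕ → Str A P, (∀ n, IsElemList (σ n)) →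
    Holds T (RecSys.inst σ F)) ?_ ?_ ?_ h σ hσ
  · intro F h σ hσ
    rcases h with h | h
    · cases h with
      | refl x =>
        have : IsPrime 2 (RecSys.inst σ (eqn [Sym.var x] [Sym.var x])) :=
          (IsPrime.eqn _ _ (.var x) (.var x)).inst fun n => (hσ n).1
        rw [holds_prime this]
        simpa using hT.refl _ (hσ x)
      | subst x y l m hl hm =>
        have hp := IsPrime.eqn _ _ hl hm
        have := holds_imps (T := T) (Fs := [RecSys.inst σ (RecSys.subst y [Sym.var x] (eqn l m)),
          eqn (σ x) (σ y)]) (G := RecSys.inst σ (eqn l m)) (by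
            simp only [List.forall_mem_cons]
            exact ⟨⟨2, (hp.inst (isList_subst_values (.var x) y)).inst fun n => (hσ n).1⟩,
              ⟨2, .eqn _ _ (hσ x).1 (hσ y).1⟩, by simp⟩) ⟨2, hp.inst fun n => (hσ n).1⟩
        simp only [List.forall_mem_cons, imps, List.foldr] at this
        simpa [imp] using this.2 fun h => hT.subst σ hσ x y l m hl hm h.1 h.2.1
      | atom p xy hne =>
        -- The inner implication contributes one more premise, so that the conclusion becomes prime
        -- and `holds_imps` applies.
        have e : RecSys.inst σ (imps (xy.map fun q => eqn [Sym.var q.1] [Sym.var q.2])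
            (imp (RecSys.atom p (xy.map fun q => [Sym.var q.1]))
              (RecSys.atom p (xy.map fun q => [Sym.var q.2])))) =
            imps ((xy.map fun q => eqn (σ q.1) (σ q.2)) ++
              [RecSys.atom p (xy.map fun q => σ q.1)])
              (RecSys.atom p (xy.map fun q => σ q.2)) := by
          rw [inst_imps, inst_imp]
          simp [imps, List.foldr_append, Function.comp_def, List.foldr_map]
        rw [e, holds_imps]
        · intro h
          have := hT.atom p (xy.map fun q => (σ q.1, σ q.2))
          simp only [List.map_map, Function.comp_def] at this
          refine this ?_ (h _ (by simp))
          simp only [List.mem_map]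
          rintro _ ⟨q, hq, rfl⟩
          exact ⟨hσ _, hσ _, h _ (by simp; exact Or.inl ⟨q.1, q.2, hq, rfl⟩)⟩
        · simp only [List.mem_append, List.mem_map, List.mem_singleton]
          rintro F (⟨q, -, rfl⟩ | rfl)
          · exact ⟨2, .eqn _ _ (hσ _).1 (hσ _).1⟩
          · refine ⟨_, .atom p _ ?_⟩
            simp only [List.mem_map]
            rintro _ ⟨q, -, rfl⟩
            exact (hσ _).1
        · refine ⟨_, .atom p _ ?_⟩
          simp only [List.mem_map]
          rintro _ ⟨q, -, rfl⟩
          exact (hσ _).1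
    · exact hT.basis F h σ hσ
  · intro n F G hF hG h h' σ hσ
    have h := (holds_prime (hF.inst fun n => (hσ n).1)).1 (h σ hσ)
    intro Fs G' hFs hG' e hT'
    have h' := h' σ hσ
    rw [inst_imp, e] at h'
    exact h' (RecSys.inst σ F :: Fs) G' (by simpa using ⟨⟨n, hF.inst fun n => (hσ n).1⟩, hFs⟩) hG' rfl
      (by simpa using ⟨h, hT'⟩)
  · intro F x l hl h σ hσ
    rw [subst_eq_inst, inst_inst]
    refine h _ fun n => ?_
    split
    · exact IsElemList.inst hσ hl
    · simpa using hσ n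

/-- An elementary formula is its own instance under any valuation; a constant symbol is needed for
an elementary valuation to exist. -/
theorem _root_.RecSys.IsModel.sound [Nonempty A] {T : Str A P → Prop} (hT : IsModel S T) {n : ℕ}
    (hF : IsElemPrime n F) (h : S.Derivable F) : T F := by
  obtain ⟨σ, hσ⟩ := exists_elemList (A := A) (P := P)
  have := hT.holds h hσ
  rwa [inst_varFree _ hF.2, holds_prime hF.1] at this

theorem Derivable.holds (h : S.Derivable F) : Holds S.Derivable F := by
  rintro Fs G hFs ⟨n, hG⟩ rfl hd
  induction Fs with
  | nil => exact h
  | cons F Fs ih =>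
    simp only [List.forall_mem_cons] at hFs hd
    exact ih hFs.2 (hd.1.mp h (imps_isFormula hFs.2 (.prime n _ hG))) hd.2

/-- The derivable elementary prime formulas form a model. -/
theorem derivable_isModel (S : RecursiveSystem A P) : IsModel S S.Derivable where
  refl l hl := by
    have := (IsAxiom.derivable (S := S) (Or.inl (.refl 0))).inst (σ := fun _ => l) fun _ => hl
    simpa using this
  subst σ hσ x y l m hl hm h1 h2 := by
    have := (IsAxiom.derivable (S := S) (Or.inl (.subst x y l m hl hm))).inst hσ
    rw [inst_imp, inst_imp] at this
    have hf : IsFormula (RecSys.inst σ (eqn l m)) :=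
      .prime 2 _ ((IsPrime.eqn _ _ hl hm).inst fun n => (hσ n).1)
    have hf' := IsPrime.eqn _ _ (hσ x).1 (hσ y).1
    refine h2.mp (h1.mp (by simpa using this) ?_) hf
    exact .imp _ _ _ hf' hf
  atom p ls hls h := by
    -- The congruence axioms exist only for at least one argument; without arguments the two atoms
    -- coincide.
    rcases eq_or_ne ls [] with rfl | hne
    · simpa using h
    obtain ⟨N, hN⟩ : ∃ N, N = ls.length := ⟨_, rfl⟩
    have hpos : 0 < ls.length := List.length_pos_iff.2 hne
    -- The default is a member of `ls`, so that every value of the valuation below is an elementary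
    -- list.
    let g : ℕ → Str A P × Str A P := fun n => ls.getD n (ls[0])
    have hg : ∀ n, g n ∈ ls := by
      intro n
      simp only [g, List.getD_eq_getElem?_getD]
      rcases lt_or_ge n ls.length with h | h <;> simp [h]
    -- Distinct variables are used for all arguments: an even one `2 * i` for the left side of the
    -- `i`-th pair, the odd one `2 * i + 1` for its right side.
    let σ : ℕ → Str A P := fun n => if n % 2 = 0 then (g (n / 2)).1 else (g (n / 2)).2
    have hσ : ∀ n, IsElemList (σ n) := by
      intro n
      simp only [σ]
      split
      · exact (hls _ (hg _)).1
      · exact (hls _ (hg _)).2.1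
    let xy : List (ℕ × ℕ) := (List.range ls.length).map fun i => (2 * i, 2 * i + 1)
    have hxy : xy.map (fun q => (σ q.1, σ q.2)) = ls := by
      apply List.ext_getElem
      · simp [xy]
      · intro i h1 h2
        have : (2 * i + 1) / 2 = i := by omega
        simp [xy, σ, g, this, h2, Nat.add_mod]
    have ax := (IsAxiom.derivable (S := S) (Or.inl (.atom p xy (by
      simpa [xy] using hne)))).inst hσ
    have e : RecSys.inst σ (imps (xy.map fun q => eqn [Sym.var q.1] [Sym.var q.2])
        (imp (RecSys.atom p (xy.map fun q => [Sym.var q.1]))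
          (RecSys.atom p (xy.map fun q => [Sym.var q.2])))) =
        imps ((ls.map fun q => eqn q.1 q.2) ++ [RecSys.atom p (ls.map Prod.fst)])
          (RecSys.atom p (ls.map Prod.snd)) := by
      rw [← hxy, inst_imps, inst_imp]
      simp [imps, List.foldr_append, Function.comp_def, List.foldr_map]
    rw [e] at ax
    have hp : ∀ q : Str A P × Str A P → Str A P, (∀ r ∈ ls, IsList (q r)) →
        ∃ n, IsPrime n (RecSys.atom p (ls.map q)) := by
      intro q hq
      refine ⟨_, .atom p _ ?_⟩
      simp only [List.mem_map]
      rintro _ ⟨r, hr, rfl⟩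
      exact hq r hr
    refine (holds_imps ?_ (hp _ fun r hr => (hls r hr).2.1.1)).1 ax.holds ?_
    · simp only [List.mem_append, List.mem_map, List.mem_singleton]
      rintro F (⟨q, hq, rfl⟩ | rfl)
      · exact ⟨2, .eqn _ _ (hls q hq).1.1 (hls q hq).2.1.1⟩
      · exact hp _ fun r hr => (hls r hr).1.1
    · simp only [List.mem_append, List.mem_map, List.mem_singleton]
      rintro F (⟨q, hq, rfl⟩ | rfl)
      · exact (hls q hq).2.2
      · exact h
  basis F hF σ hσ := ((IsAxiom.derivable (Or.inr hF)).inst hσ).holds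

end RecursiveSystem

end RecSys

namespace RecSys

variable {A P A' P' Q N : Type}

/-! ## Horn clauses, extensions and renamings of recursive systems -/

/-- A Horn clause with predicate symbols from `Q` between lists. -/
structure Clause (A P Q : Type) where
  /-- the premises -/
  prems : List (Q × List (Str A P))
  /-- the conclusion -/
  concl : Q × List (Str A P)

namespace Clause

/-- All terms of the clause are lists. -/
def Wf (c : Clause A P Q) : Prop := ∀ q ∈ c.concl :: c.prems, ∀ l ∈ q.2, IsList l

/-- The R-formula given by a clause; `g` embeds the predicate symbols. -/
def toFormula (g : P → Q) (c : Clause A P Q) : Str A Q :=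
  imps (c.prems.map fun q => atom q.1 (q.2.map (mapStr id g)))
    (atom c.concl.1 (c.concl.2.map (mapStr id g)))

variable {g : P → Q} {c : Clause A P Q}

theorem isPrime_atom_map (g : P → Q) {σ : ℕ → Str A P} (hσ : ∀ n, IsList (σ n))
    {q : Q × List (Str A P)} (hq : ∀ l ∈ q.2, IsList l) :
    ∃ n, IsPrime n (atom q.1 (q.2.map fun l => mapStr id g (inst σ l))) := by
  refine ⟨_, .atom _ _ ?_⟩
  simp only [List.mem_map]
  rintro _ ⟨l, hl, rfl⟩
  exact ((hq l hl).inst hσ).map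

theorem inst_toFormula (σ : ℕ → Str A P) :
    inst (fun n => mapStr id g (σ n)) (c.toFormula g) =
      imps (c.prems.map fun q => atom q.1 (q.2.map fun l => mapStr id g (inst σ l)))
        (atom c.concl.1 (c.concl.2.map fun l => mapStr id g (inst σ l))) := by
  simp [toFormula, inst_imps, Function.comp_def, mapStr_inst]

theorem Wf.holds_iff (hc : c.Wf) {σ : ℕ → Str A P} (hσ : ∀ n, IsList (σ n)) (T : Str A Q → Prop) :
    Holds T (inst (fun n => mapStr id g (σ n)) (c.toFormula g)) ↔
      ((∀ q ∈ c.prems, T (atom q.1 (q.2.map fun l => mapStr id g (inst σ l)))) →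
        T (atom c.concl.1 (c.concl.2.map fun l => mapStr id g (inst σ l)))) := by
  rw [inst_toFormula, holds_imps]
  · simp only [List.mem_map, forall_exists_index, and_imp, forall_apply_eq_imp_iff₂]
  · simp only [List.mem_map, forall_exists_index, and_imp, forall_apply_eq_imp_iff₂]
    exact fun q hq => isPrime_atom_map g hσ (hc q (by simp [hq]))
  · exact isPrime_atom_map g hσ (hc _ (by simp))

theorem Wf.isFormula (hc : c.Wf) : IsFormula (c.toFormula g) := by
  have := imps_isFormula (A := A) (P := Q)
    (Fs := c.prems.map fun q => atom q.1 (q.2.map (mapStr id g)))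
    (G := atom c.concl.1 (c.concl.2.map (mapStr id g))) ?_ (.prime _ _ (.atom _ _ ?_))
  · exact this
  · simp only [List.mem_map, forall_exists_index, and_imp, forall_apply_eq_imp_iff₂]
    refine fun q hq => ⟨_, .atom _ _ ?_⟩
    simp only [List.mem_map, forall_exists_index, and_imp, forall_apply_eq_imp_iff₂]
    exact fun l hl => (hc q (by simp [hq]) l hl).map
  · simp only [List.mem_map, forall_exists_index, and_imp, forall_apply_eq_imp_iff₂]
    exact fun l hl => (hc _ (by simp) l hl).map

/-- The inference rule given by a clause among the basis axioms. -/
theorem Wf.derivable [Finite A] [Finite Q] {S : RecursiveSystem A Q} (hc : c.Wf)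
    (hS : c.toFormula g ∈ S.basis) {σ : ℕ → Str A P} (hσ : ∀ n, IsElemList (σ n))
    (h : ∀ q ∈ c.prems, S.Derivable (atom q.1 (q.2.map fun l => mapStr id g (inst σ l)))) :
    S.Derivable (atom c.concl.1 (c.concl.2.map fun l => mapStr id g (inst σ l))) :=
  (hc.holds_iff (fun n => (hσ n).1) _).1
    ((RecursiveSystem.derivable_isModel S).basis _ hS _ fun n => (hσ n).map) h

end Clause

/-- The embedding of strings into those over an extended set of predicate symbols. -/
abbrev lift : Str A P → Str A (P ⊕ N) := mapStr id Sum.inl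

theorem lift_injective : (lift : Str A P → Str A (P ⊕ N)).Injective :=
  mapStr_injective _ _ Function.injective_id Sum.inl_injective

theorem mapStr_symm_mapStr (f : A ≃ A') (g : P ≃ P') (F : Str A P) :
    mapStr f.symm g.symm (mapStr f g F) = F := by
  have : ∀ c : Sym A P, Sym.map f.symm g.symm (Sym.map f g c) = c := by
    intro c
    cases c <;> simp [Sym.map]
  simp [mapStr, this, Function.comp_def]

/-- Lists contain no predicate symbols, so new predicate symbols bring no new lists and valuations
descend to the smaller language. -/
theorem exists_lift_valuation {σ : ℕ → Str A (P ⊕ N)} (hσ : ∀ n, IsElemList (σ n)) :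
    ∃ τ : ℕ → Str A P, (∀ n, IsElemList (τ n)) ∧ σ = fun n => lift (τ n) := by
  choose τ h1 h2 using fun n => (hσ n).exists_map (Equiv.refl A) (Sum.inl (α := P) (β := N))
  exact ⟨τ, h1, funext fun n => (h2 n).symm⟩

namespace RecursiveSystem

variable [Finite A] [Finite P] [Finite A'] [Finite P']

/-- Truth of atoms in the extended language. -/
def ExtRel (S : RecursiveSystem A P) (R : N → List (Str A P) → Prop) :
    P ⊕ N → List (Str A P) → Prop
  | .inl p, ls => S.Derivable (atom p ls)
  | .inr n, ls => R n ls

/-- Truth of prime formulas in the extended language. -/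
def ExtTruth (S : RecursiveSystem A P) (R : N → List (Str A P) → Prop) (F : Str A (P ⊕ N)) : Prop :=
  (∃ F₀, F = lift F₀ ∧ S.Derivable F₀) ∨
    ∃ n ls, (∀ l ∈ ls, IsList l) ∧ F = atom (.inr n) (ls.map lift) ∧ R n ls

variable {S : RecursiveSystem A P} {R : N → List (Str A P) → Prop}

theorem extTruth_lift {F : Str A P} : ExtTruth S R (lift F) ↔ S.Derivable F := by
  constructor
  · rintro (⟨F₀, h, hF⟩ | ⟨n, ls, -, h, -⟩)
    · rwa [lift_injective h]
    · cases F with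
      | nil => simp [atom] at h
      | cons c F => cases c <;> simp [atom, Sym.map] at h
  · exact fun h => Or.inl ⟨F, rfl, h⟩

theorem extTruth_atom {p : P ⊕ N} {ls : List (Str A P)} (hls : ∀ l ∈ ls, IsList l) :
    ExtTruth S R (atom p (ls.map lift)) ↔ ExtRel S R p ls := by
  cases p with
  | inl p => rw [← mapStr_atom id Sum.inl, extTruth_lift, ExtRel]
  | inr n =>
    constructor
    · rintro (⟨F, h, -⟩ | ⟨n', ls', hls', h, hR⟩)
      · cases F with
        | nil => simp [atom] at h
        | cons c F => cases c <;> simp [atom, Sym.map] at h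
      · have hm : ∀ ls : List (Str A P), (∀ l ∈ ls, IsList l) →
            ∀ l ∈ ls.map (lift (N := N)), IsList l := by
          intro ls hls l hl
          obtain ⟨l', hl', rfl⟩ := List.mem_map.1 hl
          exact (hls l' hl').map
        obtain ⟨h1, h2⟩ := atom_inj (hm ls hls) (hm ls' hls') h
        cases h1
        rwa [List.map_injective_iff.2 lift_injective h2]
    · exact fun h => Or.inr ⟨n, ls, hls, rfl, h⟩

variable [Finite N]

/-- The extension of a recursive system by new predicate symbols and clauses for them. -/
def extend (S : RecursiveSystem A P) (B : List (Clause A P (P ⊕ N))) (hB : ∀ c ∈ B, c.Wf) :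
    RecursiveSystem A (P ⊕ N) where
  basis := S.basis.map lift ++ B.map (Clause.toFormula Sum.inl)
  isFormula F hF := by
    simp only [List.mem_append, List.mem_map] at hF
    rcases hF with ⟨F, hF, rfl⟩ | ⟨c, hc, rfl⟩
    · exact (S.isFormula F hF).map
    · exact (hB c hc).isFormula

variable {B : List (Clause A P (P ⊕ N))} {hB : ∀ c ∈ B, c.Wf}

/-- The relations `R` form, together with the derivable formulas of `S`, a model of an extension. -/
theorem extTruth_isModel
    (hR : ∀ n, ∀ ls : List (Str A P × Str A P),
      (∀ q ∈ ls, IsElemList q.1 ∧ IsElemList q.2 ∧ S.Derivable (eqn q.1 q.2)) →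
      R n (ls.map Prod.fst) → R n (ls.map Prod.snd))
    (hc : ∀ c ∈ B, ∀ σ : ℕ → Str A P, (∀ n, IsElemList (σ n)) →
      (∀ q ∈ c.prems, ExtRel S R q.1 (q.2.map (RecSys.inst σ))) →
      ExtRel S R c.concl.1 (c.concl.2.map (RecSys.inst σ))) :
    IsModel (S.extend B hB) (ExtTruth S R) where
  refl l hl := by
    obtain ⟨m, hm, rfl⟩ := hl.exists_map (Equiv.refl A) (Sum.inl (α := P) (β := N))
    exact Or.inl ⟨eqn m m, by simp, (derivable_isModel S).refl m hm⟩
  subst σ hσ x y l m hl hm := by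
    -- Equations involve no predicate symbol, hence all three formulas are lifts and the claim is
    -- the one for `S`.
    obtain ⟨τ, hτ, rfl⟩ := exists_lift_valuation hσ
    obtain ⟨l, hl', rfl⟩ := hl.exists_map (Equiv.refl A) (Sum.inl (α := P) (β := N))
    obtain ⟨m, hm', rfl⟩ := hm.exists_map (Equiv.refl A) (Sum.inl (α := P) (β := N))
    have := (derivable_isModel S).subst τ hτ x y l m hl' hm'
    rw [← extTruth_lift (R := R), ← extTruth_lift (R := R), ← extTruth_lift (R := R)] at this
    simpa [subst_eq_inst, mapStr_inst, apply_ite, Sym.map] using this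
  atom p ls hls := by
    have : ∃ ls' : List (Str A P × Str A P), (∀ q ∈ ls', IsElemList q.1 ∧ IsElemList q.2 ∧
        S.Derivable (eqn q.1 q.2)) ∧ ls = ls'.map (Prod.map lift lift) := by
      clear hc hR
      induction ls with
      | nil => exact ⟨[], by simp, rfl⟩
      | cons q ls ih =>
        simp only [List.forall_mem_cons] at hls
        obtain ⟨⟨h1, h2, h3⟩, hls⟩ := hls
        obtain ⟨ls', h, rfl⟩ := ih hls
        obtain ⟨l, hl, e⟩ := h1.exists_map (Equiv.refl A) (Sum.inl (α := P) (β := N))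
        obtain ⟨m, hm, e'⟩ := h2.exists_map (Equiv.refl A) (Sum.inl (α := P) (β := N))
        rw [← e, ← e', ← mapStr_eqn] at h3
        have h3 := extTruth_lift.1 h3
        refine ⟨(l, m) :: ls', by simpa using ⟨⟨hl, hm, h3⟩, fun a b hq => h (a, b) hq⟩, ?_⟩
        simp only [List.map_cons, Prod.map, List.cons.injEq, and_true]
        exact Prod.ext e.symm e'.symm
    obtain ⟨ls, hls', rfl⟩ := this
    have e1 : (ls.map (Prod.map (lift (N := N)) (lift (N := N)))).map Prod.fst =
        (ls.map Prod.fst).map lift := by simp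
    have e2 : (ls.map (Prod.map (lift (N := N)) (lift (N := N)))).map Prod.snd =
        (ls.map Prod.snd).map lift := by simp
    rw [e1, e2, extTruth_atom, extTruth_atom]
    · cases p with
      | inl p => exact (derivable_isModel S).atom p ls hls'
      | inr n => exact hR n ls hls'
    all_goals
      simp only [List.mem_map]
      rintro _ ⟨q, hq, rfl⟩
    · exact (hls' q hq).2.1.1
    · exact (hls' q hq).1.1
  basis F hF σ hσ := by
    obtain ⟨τ, hτ, rfl⟩ := exists_lift_valuation hσ
    simp only [extend, List.mem_append, List.mem_map] at hF
    rcases hF with ⟨F, hF, rfl⟩ | ⟨c, hcB, rfl⟩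
    · have h := (derivable_isModel S).basis F hF τ hτ
      have hf := (S.isFormula F hF).inst fun n => (hτ n).1
      rw [← mapStr_inst]
      -- An old axiom is split into its premises and conclusion; these are lifts, and on lifts truth
      -- is derivability in `S`.
      obtain ⟨Fs, G, hFs, ⟨n, hG⟩, e⟩ := hf.exists_imps
      rw [e, holds_imps hFs ⟨n, hG⟩] at h
      rw [e, mapStr_imps, holds_imps]
      · simp only [List.mem_map, forall_exists_index, and_imp, forall_apply_eq_imp_iff₂,
          extTruth_lift]
        exact h
      · simp only [List.mem_map, forall_exists_index, and_imp, forall_apply_eq_imp_iff₂]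
        exact fun F hF => (hFs F hF).imp fun n h => h.map
      · exact ⟨n, hG.map⟩
    · have key : ∀ q ∈ c.concl :: c.prems, ∀ l ∈ q.2.map (RecSys.inst τ), IsList l := by
        intro q hq l hl
        obtain ⟨l', hl', rfl⟩ := List.mem_map.1 hl
        exact (hB c hcB q hq l' hl').inst fun n => (hτ n).1
      have e : ∀ ls : List (Str A P), (ls.map fun l => lift (N := N) (RecSys.inst τ l)) =
        (ls.map (RecSys.inst τ)).map lift := by simp
      rw [(hB c hcB).holds_iff fun n => (hτ n).1]
      simp only [e]
      rw [extTruth_atom (key _ (by simp))]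
      refine fun h => hc c hcB τ hτ fun q hq => ?_
      exact (extTruth_atom (key q (by simp [hq]))).1 (h q hq)

theorem Derivable.lift {F : Str A P} (h : S.Derivable F) :
    (S.extend B hB).Derivable (lift F) :=
  h.map fun F hF => by simpa [extend] using Or.inl ⟨F, hF, rfl⟩

/-- Renaming of the constant and predicate symbols of a recursive system. -/
def rename (S : RecursiveSystem A P) (f : A → A') (g : P → P') : RecursiveSystem A' P' where
  basis := S.basis.map (mapStr f g)
  isFormula F hF := by
    obtain ⟨F', hF', rfl⟩ := List.mem_map.1 hF
    exact (S.isFormula F' hF').map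

theorem derivable_rename (f : A ≃ A') (g : P ≃ P') {F : Str A P} :
    (S.rename f g).Derivable (mapStr f g F) ↔ S.Derivable F := by
  constructor
  · intro h
    have := h.map (S' := S) (f := f.symm) (g := g.symm) (by
      simp only [rename, List.mem_map]
      rintro _ ⟨F, hF, rfl⟩
      rwa [mapStr_symm_mapStr])
    rwa [mapStr_symm_mapStr] at this
  · exact fun h => h.map fun F hF => List.mem_map_of_mem hF

end RecursiveSystem

end RecSys

namespace RecSys

/-! ## The universal system as a system of Horn clauses -/

namespace U11

open P11 in
/-- The basis R-axioms of the universal system as clauses. -/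
def clauses : List (Clause A11 P11 P11) := [
  ⟨[], (Acc, [acc])⟩,
  ⟨[(Acc, [x])], (Acc, [x ++ acc])⟩,
  ⟨[], (N0, [box])⟩,
  ⟨[(Acc, [x])], (N0, [x])⟩,
  ⟨[(Acc, [x]), (Acc, [y])], (lt, [x, x ++ y])⟩,
  ⟨[(Acc, [x])], (le, [x, x])⟩,
  ⟨[(lt, [x, y])], (le, [x, y])⟩,
  ⟨[(le, [x, u])], (As, [a ++ x, u])⟩,
  ⟨[(le, [x, w])], (Ps, [p ++ x, w])⟩,
  ⟨[(Acc, [x])], (V, [v ++ x])⟩,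
  ⟨[(As, [x, u])], (L, [x, u])⟩,
  ⟨[(V, [x]), (N0, [u])], (L, [x, u])⟩,
  ⟨[(As, [x, u]), (L, [y, u])], (L, [x ++ lpar ++ y ++ rpar, u])⟩,
  ⟨[(L, [x, u]), (L, [y, u])], (L, [x ++ y, u])⟩,
  ⟨[(As, [x, u])], (EL, [x, u])⟩,
  ⟨[(As, [x, u]), (EL, [y, u])], (EL, [x ++ lpar ++ y ++ rpar, u])⟩,
  ⟨[(EL, [x, u]), (EL, [y, u])], (EL, [x ++ y, u])⟩,
  ⟨[(L, [x, u])], (LL, [x, u])⟩,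
  ⟨[(LL, [x, u]), (L, [y, u])], (LL, [x ++ comma ++ y, u])⟩,
  ⟨[(N0, [w]), (L, [x, u]), (L, [y, u])], (Eq, [sim ++ x ++ comma ++ y, u, w])⟩,
  ⟨[(Eq, [x, u, w])], (PRF, [x, u, w])⟩,
  ⟨[(Ps, [x, w]), (N0, [u])], (PRF, [x, u, w])⟩,
  ⟨[(Ps, [x, w]), (LL, [y, u])], (PRF, [x ++ y, u, w])⟩,
  ⟨[(EL, [x, u])], (ELL, [x, u])⟩,
  ⟨[(ELL, [x, u]), (EL, [y, u])], (ELL, [x ++ comma ++ y, u])⟩,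
  ⟨[(N0, [w]), (EL, [x, u]), (EL, [y, u])], (EPRF, [sim ++ x ++ comma ++ y, u, w])⟩,
  ⟨[(Ps, [x, w]), (N0, [u])], (EPRF, [x, u, w])⟩,
  ⟨[(Ps, [x, w]), (ELL, [y, u])], (EPRF, [x ++ y, u, w])⟩,
  ⟨[(PRF, [x, u, w])], (RF, [x, u, w])⟩,
  ⟨[(PRF, [x, u, w]), (RF, [y, u, w])], (RF, [arrow ++ x ++ y, u, w])⟩,
  ⟨[(lt, [x, y])], (VV, [v ++ x, v ++ y])⟩,
  ⟨[(lt, [x, y])], (VV, [v ++ y, v ++ x])⟩,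
  ⟨[(As, [x, u]), (V, [z]), (L, [r, u])], (SbL, [x, r, z, x, u])⟩,
  ⟨[(V, [x]), (L, [r, u])], (SbL, [x, r, x, r, u])⟩,
  ⟨[(VV, [x, z]), (L, [r, u])], (SbL, [x, r, z, x, u])⟩,
  ⟨[(As, [x, u]), (SbL, [y, r, z, t, u])],
    (SbL, [x ++ lpar ++ y ++ rpar, r, z, x ++ lpar ++ t ++ rpar, u])⟩,
  ⟨[(SbL, [x, r, z, s, u]), (SbL, [y, r, z, t, u])], (SbL, [x ++ y, r, z, s ++ t, u])⟩,
  ⟨[(SbL, [x, r, z, s, u])], (SbLL, [x, r, z, s, u])⟩,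
  ⟨[(SbLL, [x, r, z, s, u]), (SbL, [y, r, z, t, u])],
    (SbLL, [x ++ comma ++ y, r, z, s ++ comma ++ t, u])⟩,
  ⟨[(N0, [w]), (SbL, [x, r, z, s, u]), (SbL, [y, r, z, t, u])],
    (SbPRF, [sim ++ x ++ comma ++ y, r, z, sim ++ s ++ comma ++ t, u, w])⟩,
  ⟨[(Ps, [x, w]), (V, [z]), (L, [r, u])], (SbPRF, [x, r, z, x, u, w])⟩,
  ⟨[(Ps, [x, w]), (SbLL, [y, r, z, t, u])], (SbPRF, [x ++ y, r, z, x ++ t, u, w])⟩,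
  ⟨[(SbPRF, [x, r, z, s, u, w])], (SbRF, [x, r, z, s, u, w])⟩,
  ⟨[(SbPRF, [x, r, z, s, u, w]), (SbRF, [y, r, z, t, u, w])],
    (SbRF, [arrow ++ x ++ y, r, z, arrow ++ s ++ t, u, w])⟩,
  ⟨[(RF, [x, u, w])], (SbRF, [x, x, u, w])⟩,
  ⟨[(SbRF, [x ++ z, s, z, r ++ s, u, w])], (SbRF, [x ++ z, r ++ s, u, w])⟩,
  ⟨[(SbRF, [x ++ z ++ y, s, z, r ++ s ++ t, u, w])], (SbRF, [x ++ z ++ y, r ++ s ++ t, u, w])⟩,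
  ⟨[(V, [x]), (V, [y])], (AP, [arrow ++ sim ++ x ++ comma ++ y, x, y])⟩,
  ⟨[(V, [x]), (V, [y]), (AP, [r, s, t])],
    (AP, [arrow ++ sim ++ x ++ comma ++ y ++ r, x ++ comma ++ s, y ++ comma ++ t])⟩,
  ⟨[(N0, [u]), (N0, [w]), (V, [x])], (EqA, [sim ++ x ++ comma ++ x, u, w])⟩,
  ⟨[(V, [x]), (V, [y]), (Eq, [z, u, w]), (SbPRF, [z, x, y, s, u, w])],
    (EqA, [arrow ++ s ++ arrow ++ sim ++ x ++ comma ++ y ++ z, u, w])⟩,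
  ⟨[(AP, [r, s, t]), (Ps, [z, w]), (N0, [u])], (EqA, [r ++ arrow ++ z ++ s ++ z ++ t, u, w])⟩,
  ⟨[(RF, [x, u, w])], (RBasisPlus, [u ++ star ++ w ++ star ++ x ++ star])⟩,
  ⟨[(RF, [x, u, w]), (RBasisPlus, [u ++ star ++ w ++ star ++ s ++ star])],
    (RBasisPlus, [u ++ star ++ w ++ star ++ s ++ star ++ x ++ star])⟩,
  ⟨[(N0, [u]), (N0, [w])], (RBasis, [u ++ star ++ w ++ star ++ box ++ star])⟩,
  ⟨[(RBasisPlus, [x])], (RBasis, [x])⟩,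
  ⟨[(RF, [x, u, w])], (BRA, [u ++ star ++ w ++ star ++ x ++ star, x])⟩,
  ⟨[(RF, [x, u, w]), (RBasisPlus, [u ++ star ++ w ++ star ++ s ++ star])],
    (BRA, [u ++ star ++ w ++ star ++ s ++ star ++ x ++ star, x])⟩,
  ⟨[(RF, [x, u, w]), (BRA, [u ++ star ++ w ++ star ++ s ++ star, y])],
    (BRA, [u ++ star ++ w ++ star ++ s ++ star ++ x ++ star, y])⟩,
  ⟨[(EqA, [x, u, w]), (RBasis, [u ++ star ++ w ++ star ++ s ++ star])],
    (RA, [u ++ star ++ w ++ star ++ s ++ star, x])⟩,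
  ⟨[(BRA, [x, y])], (RA, [x, y])⟩,
  ⟨[(PRF, [x, u, w]), (BRA, [u ++ star ++ w ++ star ++ s ++ star, x])],
    (PBRA, [u ++ star ++ w ++ star ++ s ++ star, x])⟩,
  ⟨[(N0, [u]), (N0, [w]), (RA, [u ++ star ++ w ++ star ++ s ++ star, x])],
    (DsPlus, [u ++ star ++ w ++ star ++ x ++ star, u ++ star ++ w ++ star ++ s ++ star])⟩,
  ⟨[(DsPlus, [x, y]), (RA, [y, z])], (DsPlus, [x ++ z ++ star, y])⟩,
  ⟨[(DsPlus, [x ++ arrow ++ r ++ s ++ z, t]),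
    (BRA, [x ++ arrow ++ r ++ s ++ z, arrow ++ r ++ s]),
    (PBRA, [x ++ arrow ++ r ++ s ++ z, r]),
    (RBasisPlus, [x ++ arrow ++ r ++ s ++ z ++ s ++ star])],
    (DsPlus, [x ++ arrow ++ r ++ s ++ z ++ s ++ star, t])⟩,
  ⟨[(DsPlus, [u ++ star ++ w ++ x ++ y ++ z, t]),
    (BRA, [u ++ star ++ w ++ x ++ y ++ z, y]),
    (SbRF, [y, s, u, w])],
    (DsPlus, [u ++ star ++ w ++ x ++ y ++ z ++ s ++ star, t])⟩,
  ⟨[(N0, [u]), (N0, [w]), (RBasis, [u ++ star ++ w ++ star ++ s ++ star])],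
    (Ds, [u ++ star ++ w ++ star ++ box ++ star, u ++ star ++ w ++ star ++ s ++ star])⟩,
  ⟨[(DsPlus, [x, y])], (Ds, [x, y])⟩,
  ⟨[(EPRF, [x, u, w]), (BRA, [t, x]), (Ds, [t, y])], (Omega, [y ++ x])⟩]

theorem basis_eq : basis = clauses.map (Clause.toFormula id) := rfl

end U11

section

variable {A P Q : Type}

/-- Nonempty strings of constants and variables. -/
def IsWord (l : Str A P) : Bool := !l.isEmpty && l.all fun c => match c with
  | .const _ | .var _ => true
  | _ => false

/-- The occurrence of a variable. -/
def HasVar (n : ℕ) (l : Str A P) : Bool := l.any fun c => match c with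
  | .var m => n = m
  | _ => false

/-- All terms are words, and the variables of the conclusion occur in the premises. -/
def Clause.IsSafe (c : Clause A P Q) : Bool :=
  ((c.concl :: c.prems).all fun q => q.2.all IsWord) &&
    c.concl.2.all fun l => l.all fun s => match s with
      | .var n => c.prems.any fun q => q.2.any (HasVar n)
      | _ => true

theorem isList_of_isWord {l : Str A P} (h : IsWord l) : IsList l := by
  induction l with
  | nil => simp [IsWord] at h
  | cons c l ih =>
    have hc : IsList [c] := by
      cases c <;> simp [IsWord] at h
      · exact .const _
      · exact .var _
    rcases eq_or_ne l [] with rfl | hl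
    · exact hc
    · exact .append _ _ hc (ih (by simp_all [IsWord]))

theorem Clause.isWord_of_isSafe {c : Clause A P Q} (h : c.IsSafe) :
    ∀ q ∈ c.concl :: c.prems, ∀ l ∈ q.2, IsWord l := by
  simp only [IsSafe, Bool.and_eq_true, List.all_eq_true] at h
  exact h.1

theorem Clause.wf_of_isSafe {c : Clause A P Q} (h : c.IsSafe) : c.Wf :=
  fun q hq l hl => isList_of_isWord (Clause.isWord_of_isSafe h q hq l hl)

end

/-- A finite check by evaluation. Elementary lists of the universal system may contain genuine
operation terms `f(l)`; since all variables of a conclusion occur in the premises, such terms never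
get into derivable atoms. -/
theorem U11.isSafe_clauses : ∀ c ∈ U11.clauses, c.IsSafe := by
  have : U11.clauses.all Clause.IsSafe = true := by decide +kernel
  simpa using this

/-! ### Words of constants and their substitution. -/

section

variable {P : Type}

/-- The string of the constants in a string of symbols. -/
def consts (F : Str A11 P) : List A11 := F.filterMap fun c => match c with
  | .const b => some b
  | _ => none

/-- Simultaneous substitution of strings of constants. -/
def ev (σ : ℕ → List A11) (F : Str A11 P) : List A11 := F.flatMap fun c => match c with
  | .const b => [b]
  | .var n => σ n
  | _ => []

@[simp] theorem constStr_append {A B : Type} (f : B → A) (s t : List B) :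
    (constStr f (s ++ t) : Str A P) = constStr f s ++ constStr f t := by simp [constStr]

theorem isElemList_constStr {A B : Type} (f : B → A) {s : List B} (hs : s ≠ []) :
    IsElemList (constStr f s : Str A P) := by
  constructor
  · induction s with
    | nil => exact (hs rfl).elim
    | cons c s ih =>
      rcases eq_or_ne s [] with rfl | h
      · exact .const _
      · exact .append [_] _ (.const _) (ih h)
  · simp [VarFree, constStr]

theorem consts_constStr (s : List A11) : consts (constStr id s : Str A11 P) = s := by
  simp [consts, constStr, List.filterMap_map]

theorem constStr_injective : (constStr id : List A11 → Str A11 P).Injective :=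
  Function.LeftInverse.injective consts_constStr

theorem constStr_consts {F : Str A11 P} (h : ∀ c ∈ F, ∃ b, c = .const b) :
    constStr id (consts F) = F := by
  induction F with
  | nil => rfl
  | cons c F ih =>
    simp only [List.forall_mem_cons] at h
    obtain ⟨⟨b, rfl⟩, h⟩ := h
    have := ih h
    simp_all [consts, constStr]

theorem consts_append (F G : Str A11 P) : consts (F ++ G) = consts F ++ consts G := by
  simp [consts]

/-- Every variable-free list contains a constant, so erasing its brackets still gives an admissible
value for a variable. -/
theorem consts_ne_nil {l : Str A11 P} (h : IsList l) (hv : VarFree l) : consts l ≠ [] := by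
  induction h with
  | const b => simp [consts]
  | var n => exact (hv n (by simp)).elim
  | op f l _ ih => simp [consts]
  | append l m _ _ ih ih' =>
    rw [varFree_append] at hv
    simp [consts_append, ih hv.1]

theorem consts_inst (σ : ℕ → Str A11 P) {l : Str A11 P} (hl : IsWord l) :
    consts (inst σ l) = ev (fun n => consts (σ n)) l := by
  have : ∀ c ∈ l, (∃ b, c = .const b) ∨ ∃ n, c = .var n := by
    simp only [IsWord, Bool.and_eq_true, List.all_eq_true] at hl
    intro c hc
    have := hl.2 c hc
    cases c <;> simp_all
  clear hl
  induction l with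
  | nil => rfl
  | cons c l ih =>
    simp only [List.forall_mem_cons] at this
    have ih := ih this.2
    obtain ⟨⟨b, rfl⟩ | ⟨n, rfl⟩, -⟩ := this
    · simpa [consts, ev] using ih
    · rw [inst_var, consts_append, ih]
      rfl

theorem inst_constStr (σ : ℕ → List A11) {l : Str A11 P} (hl : IsWord l) :
    inst (fun n => constStr id (σ n)) l = constStr id (ev σ l) := by
  rw [← constStr_consts (F := inst (fun n => constStr id (σ n)) l), consts_inst _ hl]
  · simp [consts_constStr]
  · simp only [IsWord, Bool.and_eq_true, List.all_eq_true] at hl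
    intro c hc
    simp only [inst, List.mem_flatMap] at hc
    obtain ⟨d, hd, hc⟩ := hc
    have := hl.2 d hd
    cases d <;> simp_all
    simp only [constStr, List.mem_map] at hc
    obtain ⟨b, -, rfl⟩ := hc
    exact ⟨b, rfl⟩

theorem ev_ne_nil {σ : ℕ → List A11} (hσ : ∀ n, σ n ≠ []) {l : Str A11 P} (hl : IsWord l) :
    ev σ l ≠ [] := by
  cases l with
  | nil => simp [IsWord] at hl
  | cons c l => cases c <;> simp_all [IsWord, ev]

end

/-- Derivability of an atom in the universal system. -/
def U11.Der (p : P11) (args : List (List A11)) : Prop :=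
  (∀ s ∈ args, s ≠ []) ∧ S11.Derivable (atom p (args.map (constStr id)))

theorem mapStr_id {A P : Type} (F : Str A P) : mapStr id id F = F := by
  have : Sym.map id id = (id : Sym A P → Sym A P) := by
    funext c
    cases c <;> rfl
  simp [mapStr, this]

theorem U11.Der.of_clause {c : Clause A11 P11 P11} (hc : c ∈ U11.clauses) (σ : ℕ → List A11)
    (hσ : ∀ n, σ n ≠ []) (h : ∀ q ∈ c.prems, Der q.1 (q.2.map (ev σ))) :
    Der c.concl.1 (c.concl.2.map (ev σ)) := by
  have hs := U11.isSafe_clauses c hc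
  constructor
  · simp only [List.mem_map]
    rintro _ ⟨l, hl, rfl⟩
    exact ev_ne_nil hσ (Clause.isWord_of_isSafe hs _ (by simp) l hl)
  · have e : ∀ q ∈ c.concl :: c.prems, (q.2.map (ev σ)).map (constStr id) =
        q.2.map fun l => mapStr id id (inst (fun n => constStr id (σ n)) l) := by
      intro q hq
      rw [List.map_map]
      refine List.map_congr_left fun l hl => ?_
      rw [mapStr_id, inst_constStr σ (Clause.isWord_of_isSafe hs q hq l hl), Function.comp]
    rw [e _ (by simp)]
    refine (Clause.wf_of_isSafe hs).derivable (S := S11) ?_ (fun n => isElemList_constStr id (hσ n)) fun q hq => ?_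
    · change _ ∈ U11.basis
      rw [U11.basis_eq]
      exact List.mem_map_of_mem hc
    · rw [← e q (by simp [hq])]
      exact (h q hq).2

/-- The truth of prime formulas, if `M` interprets the predicate symbols by relations between
strings and equality is interpreted as identity. -/
def AtomTruth {P : Type} (M : P → List (List A11) → Prop) (F : Str A11 P) : Prop :=
  (∃ l, IsList l ∧ F = eqn l l) ∨
    ∃ p args, (∀ s ∈ args, s ≠ []) ∧ F = atom p (args.map (constStr id)) ∧ M p args

section

variable {P : Type} {M : P → List (List A11) → Prop}

theorem atomTruth_eqn {l m : Str A11 P} (hl : IsList l) : AtomTruth M (eqn l m) ↔ l = m := by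
  constructor
  · rintro (⟨l', hl', e⟩ | ⟨p, args, -, e, -⟩)
    · obtain ⟨rfl, rfl⟩ := eqn_inj hl hl' e
      rfl
    · simp [eqn, atom] at e
  · rintro rfl
    exact Or.inl ⟨l, hl, rfl⟩

theorem AtomTruth.exists_args {p : P} {ls : List (Str A11 P)} (hls : ∀ l ∈ ls, IsList l)
    (h : AtomTruth M (atom p ls)) :
    ∃ args : List (List A11), ls = args.map (constStr id) ∧ M p args := by
  rcases h with ⟨l, -, e⟩ | ⟨p', args, hs, e, h⟩
  · simp [eqn, atom] at e
  · have hlist : ∀ l ∈ args.map (constStr id : List A11 → Str A11 P), IsList l := by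
      intro l hl
      obtain ⟨s, hs', rfl⟩ := List.mem_map.1 hl
      exact (isElemList_constStr id (hs s hs')).1
    obtain ⟨rfl, rfl⟩ := atom_inj hls hlist e
    exact ⟨args, rfl, h⟩

end

/-! ### Models of the universal system in which equality is identity. -/

namespace U11

variable {M : P11 → List (List A11) → Prop}

/-- The hypothesis concerns valuations by words, whereas a model must cope with all elementary
lists. An arbitrary valuation is replaced by the one that keeps only the constants; if the premises
are true, the two agree wherever it matters. -/
theorem atomTruth_isModel
    (hM : ∀ c ∈ U11.clauses, ∀ σ : ℕ → List A11,
      (∀ n, σ n ≠ []) → (∀ q ∈ c.prems, M q.1 (q.2.map (ev σ))) →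
        M c.concl.1 (c.concl.2.map (ev σ))) : IsModel S11 (AtomTruth M) := by
  refine ⟨fun l hl => Or.inl ⟨l, hl.1, rfl⟩, ?_, ?_, ?_⟩
  · intro σ hσ x y l m hl hm h h'
    rw [atomTruth_eqn (hσ x).1] at h'
    rw [subst_eq_inst, inst_inst] at h
    convert h using 2
    funext n
    split
    · simp_all
    · simp
  · intro p ls hls h
    convert h using 2
    refine List.map_congr_left fun q hq => ?_
    have := hls q hq
    exact ((atomTruth_eqn this.1.1).1 this.2.2).symm
  · intro F hF σ hσ
    change F ∈ U11.basis at hF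
    rw [U11.basis_eq] at hF
    obtain ⟨c, hc, rfl⟩ := List.mem_map.1 hF
    have hs := U11.isSafe_clauses c hc
    have := ((Clause.wf_of_isSafe hs).holds_iff (g := id) (fun n => (hσ n).1) (AtomTruth M)).2
    simp only [mapStr_id] at this
    refine this fun h => ?_
    have hi : ∀ q ∈ c.concl :: c.prems, ∀ l ∈ q.2.map (inst σ), IsList l := by
      intro q hq l hl
      obtain ⟨l', hl', rfl⟩ := List.mem_map.1 hl
      exact (isList_of_isWord (Clause.isWord_of_isSafe hs q hq l' hl')).inst fun n => (hσ n).1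
    -- A true atom has words as arguments, so erasing brackets leaves the arguments of a premise
    -- unchanged.
    have hprem : ∀ q ∈ c.prems, (∀ l ∈ q.2, constStr id (consts (inst σ l)) = inst σ l) ∧
        M q.1 (q.2.map (ev fun n => consts (σ n))) := by
      intro q hq
      obtain ⟨args, e, hM⟩ := (h q hq).exists_args (hi q (by simp [hq]))
      have e' : args = q.2.map (ev fun n => consts (σ n)) := by
        have := congrArg (List.map consts) e
        simp only [List.map_map] at this
        have h1 : args.map (consts ∘ (constStr id : List A11 → Str A11 P11)) = args := by
          conv_rhs => rw [← List.map_id args]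
          exact List.map_congr_left fun s _ => consts_constStr s
        rw [h1] at this
        rw [← this]
        exact List.map_congr_left fun l hl => consts_inst σ (Clause.isWord_of_isSafe hs q (by simp [hq]) l hl)
      refine ⟨fun l hl => ?_, e' ▸ hM⟩
      have : inst σ l ∈ args.map (constStr id) := e ▸ List.mem_map_of_mem hl
      obtain ⟨s, -, hs⟩ := List.mem_map.1 this
      rw [← hs, consts_constStr]
    -- Here safety enters: the value of a variable of the conclusion is part of an argument of some
    -- premise, hence itself a word.
    have hvar : ∀ l ∈ c.concl.2, inst σ l = constStr id (ev (fun n => consts (σ n)) l) := by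
      intro l hl
      have hw := Clause.isWord_of_isSafe hs _ List.mem_cons_self l hl
      rw [← inst_constStr _ hw]
      refine inst_congr fun n hn => ?_
      simp only [Clause.IsSafe, Bool.and_eq_true, List.all_eq_true] at hs
      have := hs.2 l hl _ hn
      simp only [List.any_eq_true] at this
      obtain ⟨q, hq, l', hl', hv⟩ := this
      have := (hprem q hq).1 l' hl'
      have hmem : Sym.var n ∈ l' := by
        simp only [HasVar, List.any_eq_true] at hv
        obtain ⟨d, hd, h⟩ := hv
        cases d <;> simp_all
      refine (constStr_consts fun d hd => ?_).symm
      have : d ∈ constStr id (consts (inst σ l')) := by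
        rw [this]
        exact List.mem_flatMap.2 ⟨_, hmem, hd⟩
      obtain ⟨b, -, rfl⟩ := List.mem_map.1 this
      exact ⟨b, rfl⟩
    refine Or.inr ⟨_, c.concl.2.map (ev fun n => consts (σ n)), ?_, ?_,
      hM c hc _ (fun n => consts_ne_nil (hσ n).1 (hσ n).2) fun q hq => (hprem q hq).2⟩
    · simp only [List.mem_map]
      rintro _ ⟨l, hl, rfl⟩
      exact ev_ne_nil (fun n => consts_ne_nil (hσ n).1 (hσ n).2)
        (Clause.isWord_of_isSafe hs _ List.mem_cons_self l hl)
    · rw [List.map_map]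
      congr 1
      exact List.map_congr_left hvar

/-- A family of relations between strings that satisfies the clauses of the universal system
contains all derivable atoms. -/
theorem sound
    (hM : ∀ c ∈ U11.clauses, ∀ σ : ℕ → List A11,
      (∀ n, σ n ≠ []) → (∀ q ∈ c.prems, M q.1 (q.2.map (ev σ))) →
        M c.concl.1 (c.concl.2.map (ev σ)))
    {p : P11} {ls : List (Str A11 P11)} (hls : ∀ l ∈ ls, IsElemList l)
    (h : S11.Derivable (atom p ls)) : ∃ args, ls = args.map (constStr id) ∧ M p args := by
  have : IsElemPrime ls.length (atom p ls) := by
    refine ⟨.atom p ls fun l hl => (hls l hl).1, fun n hn => ?_⟩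
    simp only [atom, List.mem_cons, reduceCtorEq, false_or] at hn
    rcases mem_intercalate hn with h | ⟨l, hl, h⟩
    · exact absurd h (by simp)
    · exact (hls l hl).2 n h
  have : Nonempty A11 := ⟨A11.a⟩
  exact ((atomTruth_isModel hM).sound ‹IsElemPrime _ _› h).exists_args fun l hl => (hls l hl).1

/-- If `M` accepts everything, the conditions on the clauses are void, and the resulting model still
interprets equality as identity. -/
theorem eq_of_derivable_eqn {l m : Str A11 P11} (hl : IsElemList l) (hm : IsElemList m)
    (h : S11.Derivable (eqn l m)) : l = m := by
  have : Nonempty A11 := ⟨A11.a⟩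
  have hmodel : IsModel S11 (AtomTruth fun _ _ => True) :=
    atomTruth_isModel fun _ _ _ _ _ => trivial
  refine (atomTruth_eqn hl.1).1 (hmodel.sound ⟨.eqn l m hl.1 hm.1, fun n hn => ?_⟩ h)
  have h1 := hl.2 n
  have h2 := hm.2 n
  simp_all [eqn]

end U11

end RecSys

namespace RecSys

/-! ## The encoding -/

section

variable {k l k' l' : ℕ}

@[simp] theorem enc_nil : enc ([] : Str (Fin k) (Fin l)) = [] := rfl

@[simp] theorem enc_cons (c : Sym (Fin k) (Fin l)) (F : Str (Fin k) (Fin l)) :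
    enc (c :: F) = encSym c ++ enc F := rfl

@[simp] theorem enc_append (F G : Str (Fin k) (Fin l)) : enc (F ++ G) = enc F ++ enc G := by
  simp [enc]

theorem replicate_append_inj {α : Type} {c : α} {m n : ℕ} {X Y : List α} (hX : X.head? ≠ some c)
    (hY : Y.head? ≠ some c) (h : List.replicate m c ++ X = List.replicate n c ++ Y) :
    m = n ∧ X = Y := by
  induction m generalizing n with
  | zero =>
    cases n with
    | zero => simpa using h
    | succ n => simp [List.replicate_succ] at h; simp [h] at hX
  | succ m ih =>
    cases n with
    | zero => simp [List.replicate_succ] at h; simp [← h] at hY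
    | succ n => simp [List.replicate_succ] at h; simpa using ih h

theorem head?_enc (F : Str (Fin k) (Fin l)) : (enc F).head? ≠ some A11.acc := by
  cases F with
  | nil => simp
  | cons c F => cases c <;> simp [encSym]

/-- The first letter of a code tells the kind of symbol, and a block of accents ends where the next
code starts, because no code starts with an accent. -/
theorem enc_injective : (enc : Str (Fin k) (Fin l) → List A11).Injective := by
  intro F G h
  induction F generalizing G with
  | nil =>
    cases G with
    | nil => rfl
    | cons c G => cases c <;> simp [encSym] at h
  | cons c F ih =>
    cases G with
    | nil => cases c <;> simp [encSym] at h
    | cons d G =>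
      cases c <;> cases d <;> simp only [enc_cons, encSym, List.cons_append, List.nil_append,
        List.cons.injEq, reduceCtorEq, false_and, true_and] at h
      case const.const | pred.pred | var.var =>
        obtain ⟨h1, h2⟩ := replicate_append_inj (head?_enc F) (head?_enc G) h
        simp [ih h2]
        try apply Fin.ext
        omega
      all_goals rw [ih h]

/-- A code records only the index of a symbol and not the size of the alphabet, so a string may be
regarded as one over a larger language. -/
theorem enc_mapStr {f : Fin k → Fin k'} {g : Fin l → Fin l'} (hf : ∀ i, (f i).val = i.val)
    (hg : ∀ i, (g i).val = i.val) (F : Str (Fin k) (Fin l)) : enc (mapStr f g F) = enc F := by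
  induction F with
  | nil => rfl
  | cons c F ih => cases c <;> simp_all [Sym.map, encSym, mapStr]

theorem star_notMem_enc (F : Str (Fin k) (Fin l)) : A11.star ∉ enc F := by
  induction F with
  | nil => simp
  | cons c F ih => cases c <;> simp [encSym, ih]

theorem box_notMem_enc (F : Str (Fin k) (Fin l)) : A11.box ∉ enc F := by
  induction F with
  | nil => simp
  | cons c F ih => cases c <;> simp [encSym, ih]

theorem enc_ne_nil {F : Str (Fin k) (Fin l)} (h : F ≠ []) : enc F ≠ [] := by
  rw [← enc_nil (k := k) (l := l)]
  exact enc_injective.ne h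

theorem IsFormula.ne_nil {A P : Type} {F : Str A P} (h : IsFormula F) : F ≠ [] := by
  obtain ⟨c, G, rfl, -⟩ := h.shape
  simp

@[simp] theorem enc_eqn (F G : Str (Fin k) (Fin l)) :
    enc (eqn F G) = A11.sim :: (enc F ++ A11.comma :: enc G) := by simp [eqn, encSym]

@[simp] theorem enc_imp (F G : Str (Fin k) (Fin l)) :
    enc (imp F G) = A11.arrow :: (enc F ++ enc G) := by simp [imp, encSym]

theorem enc_intercalate (ls : List (Str (Fin k) (Fin l))) :
    enc ([Sym.comma].intercalate ls) = [A11.comma].intercalate (ls.map enc) := by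
  induction ls with
  | nil => rfl
  | cons l ls ih => cases ls <;> simp_all [encSym]

theorem enc_atom (p : Fin l) (ls : List (Str (Fin k) (Fin l))) :
    enc (atom p ls) =
      A11.p :: (List.replicate (p.val + 1) A11.acc ++ [A11.comma].intercalate (ls.map enc)) := by
  rw [atom, enc_cons, enc_intercalate]
  rfl

end

theorem star_notMem_encNat (k : ℕ) : A11.star ∉ encNat k := by
  unfold encNat
  split <;> simp

theorem encNat_succ (k : ℕ) : encNat (k + 1) = List.replicate (k + 1) A11.acc := by simp [encNat]

theorem encNat_injective : encNat.Injective := by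
  intro m n h
  unfold encNat at h
  split at h <;> split at h
  · omega
  · cases n <;> simp_all [List.replicate_succ]
  · cases m <;> simp_all [List.replicate_succ]
  · simpa using congrArg List.length h

theorem header_inj {k l k' l' : ℕ} {X Y : List A11}
    (h : encNat k ++ A11.star :: (encNat l ++ A11.star :: X) =
      encNat k' ++ A11.star :: (encNat l' ++ A11.star :: Y)) : k = k' ∧ l = l' ∧ X = Y := by
  obtain ⟨h1, h2⟩ := append_cons_inj (star_notMem_encNat _) (star_notMem_encNat _) h
  obtain ⟨h3, h4⟩ := append_cons_inj (star_notMem_encNat _) (star_notMem_encNat _) h2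
  exact ⟨encNat_injective h1, encNat_injective h3, h4⟩

/-- Strings terminated by stars. -/
def starred (L : List (List A11)) : List A11 := L.flatMap fun s => s ++ [A11.star]

theorem starred_injOn {L L' : List (List A11)} (h : ∀ s ∈ L, A11.star ∉ s)
    (h' : ∀ s ∈ L', A11.star ∉ s) (e : starred L = starred L') : L = L' := by
  induction L generalizing L' with
  | nil =>
    cases L' with
    | nil => rfl
    | cons s L' => simp [starred] at e
  | cons s L ih =>
    cases L' with
    | nil => simp [starred] at e
    | cons s' L' =>
      simp only [List.forall_mem_cons] at h h'
      have e : s ++ A11.star :: starred L = s' ++ A11.star :: starred L' := by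
        simpa [starred] using e
      obtain ⟨rfl, e'⟩ := append_cons_inj h.1 h'.1 e
      rw [ih h.2 h'.2 e']

/-! ### Codes of lists of R-formulas. -/

section

variable {k l : ℕ}

/-- The part of an R-basis string after the numbers of symbols. -/
def encBody (D : List (Str (Fin k) (Fin l))) : List A11 :=
  starred (if D = [] then [[A11.box]] else D.map enc)

/-- The string which encodes a list of R-formulas. -/
def encList (D : List (Str (Fin k) (Fin l))) : List A11 :=
  encNat k ++ A11.star :: (encNat l ++ A11.star :: encBody D)

theorem encSystem_eq (S : RecursiveSystem (Fin k) (Fin l)) : encSystem S = encList S.basis := by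
  simp only [encSystem, encList, encBody, starred]
  split <;> simp [List.flatMap_map]

theorem encBody_of_ne {D : List (Str (Fin k) (Fin l))} (h : D ≠ []) :
    encBody D = starred (D.map enc) := by simp [encBody, h]

theorem encBody_append {D E : List (Str (Fin k) (Fin l))} (h : D ≠ []) :
    encBody (D ++ E) = encBody D ++ starred (E.map enc) := by
  simp [encBody, h, starred]

theorem encBody_concat {D : List (Str (Fin k) (Fin l))} (h : D ≠ []) (F : Str (Fin k) (Fin l)) :
    encBody (D ++ [F]) = encBody D ++ (enc F ++ [A11.star]) := by
  simp [encBody_append h, starred]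

theorem encList_concat {D : List (Str (Fin k) (Fin l))} (h : D ≠ []) (F : Str (Fin k) (Fin l)) :
    encList (D ++ [F]) = encList D ++ (enc F ++ [A11.star]) := by
  simp [encList, encBody_concat h]

theorem encBody_singleton (F : Str (Fin k) (Fin l)) : encBody [F] = enc F ++ [A11.star] := by
  simp [encBody, starred]

theorem star_notMem_pieces (D : List (Str (Fin k) (Fin l))) :
    ∀ s ∈ (if D = [] then [[A11.box]] else D.map enc), A11.star ∉ s := by
  split
  · simp
  · simp only [List.mem_map]
    rintro _ ⟨F, -, rfl⟩
    exact star_notMem_enc F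

theorem encBody_injective : (encBody : List (Str (Fin k) (Fin l)) → List A11).Injective := by
  intro D D' h
  have h := starred_injOn (star_notMem_pieces D) (star_notMem_pieces D') h
  have key : ∀ D : List (Str (Fin k) (Fin l)), [[A11.box]] ≠ D.map enc := by
    intro D h
    have : [A11.box] ∈ D.map enc := h ▸ List.mem_singleton_self _
    obtain ⟨F, -, hF⟩ := List.mem_map.1 this
    exact box_notMem_enc F (hF ▸ List.mem_singleton_self _)
  split_ifs at h with h1 h2 h2
  · rw [h1, h2]
  · exact (key D' h).elim
  · exact (key D h.symm).elim
  · exact List.map_injective_iff.2 enc_injective h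

/-- The axioms of the universal system address R-basis strings through the pattern `u*w*s*` with
nonempty `s`. For an empty list `s` is `□`. -/
theorem encBody_eq_concat (D : List (Str (Fin k) (Fin l))) (hD : ∀ F ∈ D, F ≠ []) :
    ∃ s, s ≠ [] ∧ encBody D = s ++ [A11.star] := by
  rcases List.eq_nil_or_concat D with rfl | ⟨E, F, rfl⟩
  · exact ⟨[A11.box], by simp, rfl⟩
  · rw [List.concat_eq_append] at hD ⊢
    have hF := enc_ne_nil (hD F (by simp))
    rcases eq_or_ne E [] with rfl | hE
    · exact ⟨enc F, hF, encBody_singleton F⟩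
    · exact ⟨encBody E ++ enc F, by simp [hF], by simp [encBody_concat hE]⟩

/-- The stars fix the division into pieces, so a star-free string that extends one code of a list to
another is a single further piece. The list `D` must be nonempty, because otherwise its body is the
placeholder. -/
theorem eq_concat_of_encBody {D E : List (Str (Fin k) (Fin l))} (hD : D ≠ []) {s : List A11}
    (hs : A11.star ∉ s) (h : encBody D ++ (s ++ [A11.star]) = encBody E) :
    ∃ F, s = enc F ∧ E = D ++ [F] := by
  have h : starred (D.map enc ++ [s]) = starred (if E = [] then [[A11.box]] else E.map enc) := by
    rw [← encBody, ← h, encBody_of_ne hD]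
    simp [starred]
  have h := starred_injOn (by
    simp only [List.mem_append, List.mem_map, List.mem_singleton]
    rintro t (⟨F, -, rfl⟩ | rfl)
    · exact star_notMem_enc F
    · exact hs) (star_notMem_pieces E) h
  split_ifs at h with hE
  · have := congrArg List.length h
    cases D <;> simp_all
  · rcases List.eq_nil_or_concat E with rfl | ⟨E, F, rfl⟩
    · exact (hE rfl).elim
    · rw [List.concat_eq_append, List.map_append, List.map_singleton] at h
      obtain ⟨h1, h2⟩ := List.append_inj' h rfl
      refine ⟨F, by simpa using h2, ?_⟩
      rw [List.concat_eq_append, List.map_injective_iff.2 enc_injective h1]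

theorem encList_injective {k' l' : ℕ} {D : List (Str (Fin k) (Fin l))}
    {D' : List (Str (Fin k') (Fin l'))} (h : encList D = encList D') :
    k = k' ∧ l = l' := by
  obtain ⟨h1, h2, -⟩ := header_inj h
  exact ⟨h1, h2⟩

theorem encList_inj {D D' : List (Str (Fin k) (Fin l))} (h : encList D = encList D') : D = D' :=
  encBody_injective (header_inj h).2.2

end

end RecSys

namespace RecSys

/-! ### The axioms of the universal system as closure rules on words. -/

namespace U11

open P11 in
/-- Families of relations between strings that are closed under the rules of the universal
system. -/
structure Closed (X : P11 → List (List A11) → Prop) : Prop where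
  acc_one : X Acc [[.acc]]
  acc_succ {x : List A11} : X Acc [x] → X Acc [x ++ [.acc]]
  n0_box : X N0 [[.box]]
  n0_acc {x : List A11} : X Acc [x] → X N0 [x]
  lt_append {x y : List A11} : X Acc [x] → X Acc [y] → X lt [x, x ++ y]
  le_refl {x : List A11} : X Acc [x] → X le [x, x]
  le_of_lt {x y : List A11} : X lt [x, y] → X le [x, y]
  as_code {x u : List A11} : X le [x, u] → X As [.a :: x, u]
  ps_code {x w : List A11} : X le [x, w] → X Ps [.p :: x, w]
  v_code {x : List A11} : X Acc [x] → X V [.v :: x]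
  l_as {x u : List A11} : X As [x, u] → X L [x, u]
  l_var {x u : List A11} : X V [x] → X N0 [u] → X L [x, u]
  l_op {x y u : List A11} : X As [x, u] → X L [y, u] → X L [x ++ .lpar :: (y ++ [.rpar]), u]
  l_append {x y u : List A11} : X L [x, u] → X L [y, u] → X L [x ++ y, u]
  el_as {x u : List A11} : X As [x, u] → X EL [x, u]
  el_op {x y u : List A11} : X As [x, u] → X EL [y, u] → X EL [x ++ .lpar :: (y ++ [.rpar]), u]
  el_append {x y u : List A11} : X EL [x, u] → X EL [y, u] → X EL [x ++ y, u]
  ll_single {x u : List A11} : X L [x, u] → X LL [x, u]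
  ll_concat {x y u : List A11} : X LL [x, u] → X L [y, u] → X LL [x ++ .comma :: y, u]
  eq_mk {x y u w : List A11} : X N0 [w] → X L [x, u] → X L [y, u] →
    X Eq [.sim :: (x ++ .comma :: y), u, w]
  prf_eq {x u w : List A11} : X Eq [x, u, w] → X PRF [x, u, w]
  prf_nullary {x u w : List A11} : X Ps [x, w] → X N0 [u] → X PRF [x, u, w]
  prf_atom {x y u w : List A11} : X Ps [x, w] → X LL [y, u] → X PRF [x ++ y, u, w]
  ell_single {x u : List A11} : X EL [x, u] → X ELL [x, u]
  ell_concat {x y u : List A11} : X ELL [x, u] → X EL [y, u] → X ELL [x ++ .comma :: y, u]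
  eprf_eqn {x y u w : List A11} : X N0 [w] → X EL [x, u] → X EL [y, u] →
    X EPRF [.sim :: (x ++ .comma :: y), u, w]
  eprf_nullary {x u w : List A11} : X Ps [x, w] → X N0 [u] → X EPRF [x, u, w]
  eprf_atom {x y u w : List A11} : X Ps [x, w] → X ELL [y, u] → X EPRF [x ++ y, u, w]
  rf_prime {x u w : List A11} : X PRF [x, u, w] → X RF [x, u, w]
  rf_imp {x y u w : List A11} : X PRF [x, u, w] → X RF [y, u, w] → X RF [.arrow :: (x ++ y), u, w]
  vv_lt {x y : List A11} : X lt [x, y] → X VV [.v :: x, .v :: y]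
  vv_gt {x y : List A11} : X lt [x, y] → X VV [.v :: y, .v :: x]
  sbL_as {x u z r : List A11} : X As [x, u] → X V [z] → X L [r, u] → X SbL [x, r, z, x, u]
  sbL_same {x u r : List A11} : X V [x] → X L [r, u] → X SbL [x, r, x, r, u]
  sbL_other {x u z r : List A11} : X VV [x, z] → X L [r, u] → X SbL [x, r, z, x, u]
  sbL_op {x y u z r t : List A11} : X As [x, u] → X SbL [y, r, z, t, u] →
    X SbL [x ++ .lpar :: (y ++ [.rpar]), r, z, x ++ .lpar :: (t ++ [.rpar]), u]
  sbL_append {x y u z r t s : List A11} : X SbL [x, r, z, s, u] → X SbL [y, r, z, t, u] →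
    X SbL [x ++ y, r, z, s ++ t, u]
  sbLL_single {x u z r s : List A11} : X SbL [x, r, z, s, u] → X SbLL [x, r, z, s, u]
  sbLL_concat {x y u z r t s : List A11} : X SbLL [x, r, z, s, u] → X SbL [y, r, z, t, u] →
    X SbLL [x ++ .comma :: y, r, z, s ++ .comma :: t, u]
  sbPRF_eqn {x y u w z r t s : List A11} : X N0 [w] → X SbL [x, r, z, s, u] →
    X SbL [y, r, z, t, u] →
    X SbPRF [.sim :: (x ++ .comma :: y), r, z, .sim :: (s ++ .comma :: t), u, w]
  sbPRF_nullary {x u w z r : List A11} : X Ps [x, w] → X V [z] → X L [r, u] →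
    X SbPRF [x, r, z, x, u, w]
  sbPRF_atom {x y u w z r t : List A11} : X Ps [x, w] → X SbLL [y, r, z, t, u] →
    X SbPRF [x ++ y, r, z, x ++ t, u, w]
  sbRF_prime {x u w z r s : List A11} : X SbPRF [x, r, z, s, u, w] → X SbRF [x, r, z, s, u, w]
  sbRF_imp {x y u w z r t s : List A11} : X SbPRF [x, r, z, s, u, w] → X SbRF [y, r, z, t, u, w] →
    X SbRF [.arrow :: (x ++ y), r, z, .arrow :: (s ++ t), u, w]
  sbRF_refl {x u w : List A11} : X RF [x, u, w] → X SbRF [x, x, u, w]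
  sbRF_last {x u w z r s : List A11} : x ≠ [] → r ≠ [] → X SbRF [x ++ z, s, z, r ++ s, u, w] →
    X SbRF [x ++ z, r ++ s, u, w]
  sbRF_inner {x y u w z r t s : List A11} : x ≠ [] → y ≠ [] → r ≠ [] → t ≠ [] →
    X SbRF [x ++ (z ++ y), s, z, r ++ (s ++ t), u, w] → X SbRF [x ++ (z ++ y), r ++ (s ++ t), u, w]
  ap_single {x y : List A11} : X V [x] → X V [y] → X AP [.arrow :: .sim :: (x ++ .comma :: y), x, y]
  ap_cons {x y r t s : List A11} : X V [x] → X V [y] → X AP [r, s, t] →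
    X AP [.arrow :: .sim :: (x ++ .comma :: (y ++ r)), x ++ .comma :: s, y ++ .comma :: t]
  eqA_refl {x u w : List A11} : X N0 [u] → X N0 [w] → X V [x] →
    X EqA [.sim :: (x ++ .comma :: x), u, w]
  eqA_subst {x y u w z s : List A11} : X V [x] → X V [y] → X Eq [z, u, w] →
    X SbPRF [z, x, y, s, u, w] →
    X EqA [.arrow :: (s ++ .arrow :: .sim :: (x ++ .comma :: (y ++ z))), u, w]
  eqA_atom {u w z r t s : List A11} : X AP [r, s, t] → X Ps [z, w] → X N0 [u] →
    X EqA [r ++ .arrow :: (z ++ (s ++ (z ++ t))), u, w]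
  basisPlus_single {x u w : List A11} : X RF [x, u, w] →
    X RBasisPlus [u ++ .star :: (w ++ .star :: (x ++ [.star]))]
  basisPlus_concat {x u w s : List A11} : s ≠ [] → X RF [x, u, w] →
    X RBasisPlus [u ++ .star :: (w ++ .star :: (s ++ [.star]))] →
    X RBasisPlus [u ++ .star :: (w ++ .star :: (s ++ .star :: (x ++ [.star])))]
  basis_nil {u w : List A11} : X N0 [u] → X N0 [w] →
    X RBasis [u ++ .star :: (w ++ [.star, .box, .star])]
  basis_plus {x : List A11} : X RBasisPlus [x] → X RBasis [x]
  bra_single {x u w : List A11} : X RF [x, u, w] →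
    X BRA [u ++ .star :: (w ++ .star :: (x ++ [.star])), x]
  bra_concat {x u w s : List A11} : s ≠ [] → X RF [x, u, w] →
    X RBasisPlus [u ++ .star :: (w ++ .star :: (s ++ [.star]))] →
    X BRA [u ++ .star :: (w ++ .star :: (s ++ .star :: (x ++ [.star]))), x]
  bra_prev {x y u w s : List A11} : s ≠ [] → X RF [x, u, w] →
    X BRA [u ++ .star :: (w ++ .star :: (s ++ [.star])), y] →
    X BRA [u ++ .star :: (w ++ .star :: (s ++ .star :: (x ++ [.star]))), y]
  ra_eqA {x u w s : List A11} : s ≠ [] → X EqA [x, u, w] →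
    X RBasis [u ++ .star :: (w ++ .star :: (s ++ [.star]))] →
    X RA [u ++ .star :: (w ++ .star :: (s ++ [.star])), x]
  ra_bra {x y : List A11} : X BRA [x, y] → X RA [x, y]
  pbra_mk {x u w s : List A11} : s ≠ [] → X PRF [x, u, w] →
    X BRA [u ++ .star :: (w ++ .star :: (s ++ [.star])), x] →
    X PBRA [u ++ .star :: (w ++ .star :: (s ++ [.star])), x]
  dsPlus_single {x u w s : List A11} : s ≠ [] → X N0 [u] → X N0 [w] →
    X RA [u ++ .star :: (w ++ .star :: (s ++ [.star])), x] →
    X DsPlus [u ++ .star :: (w ++ .star :: (x ++ [.star])),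
      u ++ .star :: (w ++ .star :: (s ++ [.star]))]
  dsPlus_ax {x y z : List A11} : X DsPlus [x, y] → X RA [y, z] → X DsPlus [x ++ (z ++ [.star]), y]
  dsPlus_mp {x z r t s : List A11} : x ≠ [] → z ≠ [] → s ≠ [] →
    X DsPlus [x ++ .arrow :: (r ++ (s ++ z)), t] →
    X BRA [x ++ .arrow :: (r ++ (s ++ z)), .arrow :: (r ++ s)] →
    X PBRA [x ++ .arrow :: (r ++ (s ++ z)), r] →
    X RBasisPlus [x ++ .arrow :: (r ++ (s ++ (z ++ (s ++ [.star]))))] →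
    X DsPlus [x ++ .arrow :: (r ++ (s ++ (z ++ (s ++ [.star])))), t]
  dsPlus_subst {x y u w z t s : List A11} : x ≠ [] → z ≠ [] →
    X DsPlus [u ++ .star :: (w ++ (x ++ (y ++ z))), t] →
    X BRA [u ++ .star :: (w ++ (x ++ (y ++ z))), y] → X SbRF [y, s, u, w] →
    X DsPlus [u ++ .star :: (w ++ (x ++ (y ++ (z ++ (s ++ [.star]))))), t]
  ds_nil {u w s : List A11} : s ≠ [] → X N0 [u] → X N0 [w] →
    X RBasis [u ++ .star :: (w ++ .star :: (s ++ [.star]))] →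
    X Ds [u ++ .star :: (w ++ [.star, .box, .star]), u ++ .star :: (w ++ .star :: (s ++ [.star]))]
  ds_plus {x y : List A11} : X DsPlus [x, y] → X Ds [x, y]
  omega_mk {x y u w t : List A11} : X EPRF [x, u, w] → X BRA [t, x] → X Ds [t, y] → X Omega [y ++ x]

/-- The conditions `≠ []` in `Closed` concern exactly the variables that never form a whole argument
of a premise. Here they come from the valuation; all other values are nonempty without being
mentioned. -/
theorem Closed.clauses {X : P11 → List (List A11) → Prop} (hX : Closed X) :
    ∀ c ∈ U11.clauses, ∀ σ : ℕ → List A11, (∀ n, σ n ≠ []) →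
      (∀ q ∈ c.prems, X q.1 (q.2.map (ev σ))) → X c.concl.1 (c.concl.2.map (ev σ)) := by
  simp only [U11.clauses, List.forall_mem_cons, List.not_mem_nil, false_imp_iff, implies_true,
    forall_const, ev, x, y, u, w, z, r, t, s, a, v, p, box, acc, star, sim, lpar, rpar, comma, arrow,
    List.cons_append, List.nil_append, List.append_nil, List.flatMap_cons,
    List.flatMap_nil, List.map_cons, List.map_nil, and_true, and_imp]
  exact ⟨
    fun _ _ => hX.acc_one, fun _ _ => hX.acc_succ, fun _ _ => hX.n0_box, fun _ _ => hX.n0_acc,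
    fun _ _ => hX.lt_append, fun _ _ => hX.le_refl, fun _ _ => hX.le_of_lt, fun _ _ => hX.as_code,
    fun _ _ => hX.ps_code, fun _ _ => hX.v_code, fun _ _ => hX.l_as, fun _ _ => hX.l_var,
    fun _ _ => hX.l_op, fun _ _ => hX.l_append, fun _ _ => hX.el_as, fun _ _ => hX.el_op,
    fun _ _ => hX.el_append, fun _ _ => hX.ll_single, fun _ _ => hX.ll_concat, fun _ _ => hX.eq_mk,
    fun _ _ => hX.prf_eq, fun _ _ => hX.prf_nullary, fun _ _ => hX.prf_atom,
    fun _ _ => hX.ell_single, fun _ _ => hX.ell_concat, fun _ _ => hX.eprf_eqn,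
    fun _ _ => hX.eprf_nullary, fun _ _ => hX.eprf_atom, fun _ _ => hX.rf_prime,
    fun _ _ => hX.rf_imp, fun _ _ => hX.vv_lt, fun _ _ => hX.vv_gt, fun _ _ => hX.sbL_as,
    fun _ _ => hX.sbL_same, fun _ _ => hX.sbL_other, fun _ _ => hX.sbL_op, fun _ _ => hX.sbL_append,
    fun _ _ => hX.sbLL_single, fun _ _ => hX.sbLL_concat, fun _ _ => hX.sbPRF_eqn,
    fun _ _ => hX.sbPRF_nullary, fun _ _ => hX.sbPRF_atom, fun _ _ => hX.sbRF_prime,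
    fun _ _ => hX.sbRF_imp, fun _ _ => hX.sbRF_refl, fun _ hσ => hX.sbRF_last (hσ _) (hσ _),
    fun _ hσ => hX.sbRF_inner (hσ _) (hσ _) (hσ _) (hσ _), fun _ _ => hX.ap_single,
    fun _ _ => hX.ap_cons, fun _ _ => hX.eqA_refl, fun _ _ => hX.eqA_subst, fun _ _ => hX.eqA_atom,
    fun _ _ => hX.basisPlus_single, fun _ hσ => hX.basisPlus_concat (hσ _), fun _ _ => hX.basis_nil,
    fun _ _ => hX.basis_plus, fun _ _ => hX.bra_single, fun _ hσ => hX.bra_concat (hσ _),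
    fun _ hσ => hX.bra_prev (hσ _), fun _ hσ => hX.ra_eqA (hσ _), fun _ _ => hX.ra_bra,
    fun _ hσ => hX.pbra_mk (hσ _), fun _ hσ => hX.dsPlus_single (hσ _), fun _ _ => hX.dsPlus_ax,
    fun _ hσ => hX.dsPlus_mp (hσ _) (hσ _) (hσ _), fun _ hσ => hX.dsPlus_subst (hσ _) (hσ _),
    fun _ hσ => hX.ds_nil (hσ _), fun _ _ => hX.ds_plus, fun _ _ => hX.omega_mk⟩

/-- The assignment of values to the variables of the universal system. -/
def asg (x y u w z r t s : List A11) : ℕ → List A11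
  | 0 => x
  | 1 => y
  | 2 => u
  | 3 => w
  | 4 => z
  | 5 => r
  | 6 => t
  | 7 => s
  | _ => [A11.box]

theorem asg_ne {x y u w z r t s : List A11} (hx : x ≠ []) (hy : y ≠ []) (hu : u ≠ []) (hw : w ≠ [])
    (hz : z ≠ []) (hr : r ≠ []) (ht : t ≠ []) (hs : s ≠ []) (n : ℕ) :
    asg x y u w z r t s n ≠ [] := by
  rcases n with _ | _ | _ | _ | _ | _ | _ | _ | n <;> simp_all [asg]

theorem Closed.of_clauses {X : P11 → List (List A11) → Prop}
    (hX : ∀ {p args}, X p args → ∀ s ∈ args, s ≠ [])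
    (H : ∀ c ∈ U11.clauses, ∀ σ : ℕ → List A11, (∀ n, σ n ≠ []) →
      (∀ q ∈ c.prems, X q.1 (q.2.map (ev σ))) → X c.concl.1 (c.concl.2.map (ev σ))) :
    Closed X := by
  -- The value `□` is assigned to the variables that do not occur in the clause at hand; any
  -- nonempty string would do. The other values are nonempty as arguments of premises or by a side
  -- condition.
  have d : [A11.box] ≠ [] := by simp
  simp only [U11.clauses, List.forall_mem_cons, List.not_mem_nil, false_imp_iff, implies_true,
    forall_const, ev, x, y, u, w, z, r, t, s, a, v, p, box, acc, star, sim, lpar, rpar, comma, arrow,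
    List.cons_append, List.nil_append, List.append_nil, List.flatMap_cons,
    List.flatMap_nil, List.map_cons, List.map_nil, and_true, and_imp] at H
  obtain ⟨H_acc_one, H_acc_succ, H_n0_box, H_n0_acc, H_lt_append, H_le_refl, H_le_of_lt, H_as_code,
    H_ps_code, H_v_code, H_l_as, H_l_var, H_l_op, H_l_append, H_el_as, H_el_op, H_el_append,
    H_ll_single, H_ll_concat, H_eq_mk, H_prf_eq, H_prf_nullary, H_prf_atom, H_ell_single,
    H_ell_concat, H_eprf_eqn, H_eprf_nullary, H_eprf_atom, H_rf_prime, H_rf_imp, H_vv_lt, H_vv_gt,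
    H_sbL_as, H_sbL_same, H_sbL_other, H_sbL_op, H_sbL_append, H_sbLL_single, H_sbLL_concat,
    H_sbPRF_eqn, H_sbPRF_nullary, H_sbPRF_atom, H_sbRF_prime, H_sbRF_imp, H_sbRF_refl, H_sbRF_last,
    H_sbRF_inner, H_ap_single, H_ap_cons, H_eqA_refl, H_eqA_subst, H_eqA_atom, H_basisPlus_single,
    H_basisPlus_concat, H_basis_nil, H_basis_plus, H_bra_single, H_bra_concat, H_bra_prev, H_ra_eqA,
    H_ra_bra, H_pbra_mk, H_dsPlus_single, H_dsPlus_ax, H_dsPlus_mp, H_dsPlus_subst, H_ds_nil,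
    H_ds_plus, H_omega_mk⟩ := H
  exact {
  acc_one := H_acc_one _ (asg_ne d d d d d d d d),
  acc_succ := fun h1 => H_acc_succ _ (asg_ne (hX h1 _ (.head _)) d d d d d d d) h1,
  n0_box := H_n0_box _ (asg_ne d d d d d d d d),
  n0_acc := fun h1 => H_n0_acc _ (asg_ne (hX h1 _ (.head _)) d d d d d d d) h1,
  lt_append := fun h1 h2 => 
    H_lt_append _ (asg_ne (hX h1 _ (.head _)) (hX h2 _ (.head _)) d d d d d d) h1 h2,
  le_refl := fun h1 => H_le_refl _ (asg_ne (hX h1 _ (.head _)) d d d d d d d) h1,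
  le_of_lt := fun h1 => 
    H_le_of_lt _ (asg_ne (hX h1 _ (.head _)) (hX h1 _ (.tail _ (.head _))) d d d d d d) h1,
  as_code := fun h1 => 
    H_as_code _ (asg_ne (hX h1 _ (.head _)) d (hX h1 _ (.tail _ (.head _))) d d d d d) h1,
  ps_code := fun h1 => 
    H_ps_code _ (asg_ne (hX h1 _ (.head _)) d d (hX h1 _ (.tail _ (.head _))) d d d d) h1,
  v_code := fun h1 => H_v_code _ (asg_ne (hX h1 _ (.head _)) d d d d d d d) h1,
  l_as := fun h1 => 
    H_l_as _ (asg_ne (hX h1 _ (.head _)) d (hX h1 _ (.tail _ (.head _))) d d d d d) h1,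
  l_var := fun h1 h2 => H_l_var _ (asg_ne (hX h1 _ (.head _)) d (hX h2 _ (.head _)) d d d d d) h1 h2,
  l_op := fun h1 h2 => 
    H_l_op _ (asg_ne (hX h1 _ (.head _)) (hX h2 _ (.head _)) (hX h1 _ (.tail _ (.head _))) d d d d d) h1 h2,
  l_append := fun h1 h2 => 
    H_l_append _ (asg_ne (hX h1 _ (.head _)) (hX h2 _ (.head _)) (hX h1 _ (.tail _ (.head _))) d d d d d) h1 h2,
  el_as := fun h1 => 
    H_el_as _ (asg_ne (hX h1 _ (.head _)) d (hX h1 _ (.tail _ (.head _))) d d d d d) h1,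
  el_op := fun h1 h2 => 
    H_el_op _ (asg_ne (hX h1 _ (.head _)) (hX h2 _ (.head _)) (hX h1 _ (.tail _ (.head _))) d d d d d) h1 h2,
  el_append := fun h1 h2 => 
    H_el_append _ (asg_ne (hX h1 _ (.head _)) (hX h2 _ (.head _)) (hX h1 _ (.tail _ (.head _))) d d d d d) h1 h2,
  ll_single := fun h1 => 
    H_ll_single _ (asg_ne (hX h1 _ (.head _)) d (hX h1 _ (.tail _ (.head _))) d d d d d) h1,
  ll_concat := fun h1 h2 => 
    H_ll_concat _ (asg_ne (hX h1 _ (.head _)) (hX h2 _ (.head _)) (hX h1 _ (.tail _ (.head _))) d d d d d) h1 h2,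
  eq_mk := fun h1 h2 h3 => 
    H_eq_mk _ (asg_ne (hX h2 _ (.head _)) (hX h3 _ (.head _)) (hX h2 _ (.tail _ (.head _))) (hX h1 _ (.head _)) d d d d) h1 h2 h3,
  prf_eq := fun h1 => 
    H_prf_eq _ (asg_ne (hX h1 _ (.head _)) d (hX h1 _ (.tail _ (.head _))) (hX h1 _ (.tail _ (.tail _ (.head _)))) d d d d) h1,
  prf_nullary := fun h1 h2 => 
    H_prf_nullary _ (asg_ne (hX h1 _ (.head _)) d (hX h2 _ (.head _)) (hX h1 _ (.tail _ (.head _))) d d d d) h1 h2,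
  prf_atom := fun h1 h2 => 
    H_prf_atom _ (asg_ne (hX h1 _ (.head _)) (hX h2 _ (.head _)) (hX h2 _ (.tail _ (.head _))) (hX h1 _ (.tail _ (.head _))) d d d d) h1 h2,
  ell_single := fun h1 => 
    H_ell_single _ (asg_ne (hX h1 _ (.head _)) d (hX h1 _ (.tail _ (.head _))) d d d d d) h1,
  ell_concat := fun h1 h2 => 
    H_ell_concat _ (asg_ne (hX h1 _ (.head _)) (hX h2 _ (.head _)) (hX h1 _ (.tail _ (.head _))) d d d d d) h1 h2,
  eprf_eqn := fun h1 h2 h3 => 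
    H_eprf_eqn _ (asg_ne (hX h2 _ (.head _)) (hX h3 _ (.head _)) (hX h2 _ (.tail _ (.head _))) (hX h1 _ (.head _)) d d d d) h1 h2 h3,
  eprf_nullary := fun h1 h2 => 
    H_eprf_nullary _ (asg_ne (hX h1 _ (.head _)) d (hX h2 _ (.head _)) (hX h1 _ (.tail _ (.head _))) d d d d) h1 h2,
  eprf_atom := fun h1 h2 => 
    H_eprf_atom _ (asg_ne (hX h1 _ (.head _)) (hX h2 _ (.head _)) (hX h2 _ (.tail _ (.head _))) (hX h1 _ (.tail _ (.head _))) d d d d) h1 h2,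
  rf_prime := fun h1 => 
    H_rf_prime _ (asg_ne (hX h1 _ (.head _)) d (hX h1 _ (.tail _ (.head _))) (hX h1 _ (.tail _ (.tail _ (.head _)))) d d d d) h1,
  rf_imp := fun h1 h2 => 
    H_rf_imp _ (asg_ne (hX h1 _ (.head _)) (hX h2 _ (.head _)) (hX h1 _ (.tail _ (.head _))) (hX h1 _ (.tail _ (.tail _ (.head _)))) d d d d) h1 h2,
  vv_lt := fun h1 => 
    H_vv_lt _ (asg_ne (hX h1 _ (.head _)) (hX h1 _ (.tail _ (.head _))) d d d d d d) h1,
  vv_gt := fun h1 => 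
    H_vv_gt _ (asg_ne (hX h1 _ (.head _)) (hX h1 _ (.tail _ (.head _))) d d d d d d) h1,
  sbL_as := fun h1 h2 h3 => 
    H_sbL_as _ (asg_ne (hX h1 _ (.head _)) d (hX h1 _ (.tail _ (.head _))) d (hX h2 _ (.head _)) (hX h3 _ (.head _)) d d) h1 h2 h3,
  sbL_same := fun h1 h2 => 
    H_sbL_same _ (asg_ne (hX h1 _ (.head _)) d (hX h2 _ (.tail _ (.head _))) d d (hX h2 _ (.head _)) d d) h1 h2,
  sbL_other := fun h1 h2 => 
    H_sbL_other _ (asg_ne (hX h1 _ (.head _)) d (hX h2 _ (.tail _ (.head _))) d (hX h1 _ (.tail _ (.head _))) (hX h2 _ (.head _)) d d) h1 h2,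
  sbL_op := fun h1 h2 => 
    H_sbL_op _ (asg_ne (hX h1 _ (.head _)) (hX h2 _ (.head _)) (hX h1 _ (.tail _ (.head _))) d (hX h2 _ (.tail _ (.tail _ (.head _)))) (hX h2 _ (.tail _ (.head _))) (hX h2 _ (.tail _ (.tail _ (.tail _ (.head _))))) d) h1 h2,
  sbL_append := fun h1 h2 => 
    H_sbL_append _ (asg_ne (hX h1 _ (.head _)) (hX h2 _ (.head _)) (hX h1 _ (.tail _ (.tail _ (.tail _ (.tail _ (.head _)))))) d (hX h1 _ (.tail _ (.tail _ (.head _)))) (hX h1 _ (.tail _ (.head _))) (hX h2 _ (.tail _ (.tail _ (.tail _ (.head _))))) (hX h1 _ (.tail _ (.tail _ (.tail _ (.head _)))))) h1 h2,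
  sbLL_single := fun h1 => 
    H_sbLL_single _ (asg_ne (hX h1 _ (.head _)) d (hX h1 _ (.tail _ (.tail _ (.tail _ (.tail _ (.head _)))))) d (hX h1 _ (.tail _ (.tail _ (.head _)))) (hX h1 _ (.tail _ (.head _))) d (hX h1 _ (.tail _ (.tail _ (.tail _ (.head _)))))) h1,
  sbLL_concat := fun h1 h2 => 
    H_sbLL_concat _ (asg_ne (hX h1 _ (.head _)) (hX h2 _ (.head _)) (hX h1 _ (.tail _ (.tail _ (.tail _ (.tail _ (.head _)))))) d (hX h1 _ (.tail _ (.tail _ (.head _)))) (hX h1 _ (.tail _ (.head _))) (hX h2 _ (.tail _ (.tail _ (.tail _ (.head _))))) (hX h1 _ (.tail _ (.tail _ (.tail _ (.head _)))))) h1 h2,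
  sbPRF_eqn := fun h1 h2 h3 => 
    H_sbPRF_eqn _ (asg_ne (hX h2 _ (.head _)) (hX h3 _ (.head _)) (hX h2 _ (.tail _ (.tail _ (.tail _ (.tail _ (.head _)))))) (hX h1 _ (.head _)) (hX h2 _ (.tail _ (.tail _ (.head _)))) (hX h2 _ (.tail _ (.head _))) (hX h3 _ (.tail _ (.tail _ (.tail _ (.head _))))) (hX h2 _ (.tail _ (.tail _ (.tail _ (.head _)))))) h1 h2 h3,
  sbPRF_nullary := fun h1 h2 h3 => 
    H_sbPRF_nullary _ (asg_ne (hX h1 _ (.head _)) d (hX h3 _ (.tail _ (.head _))) (hX h1 _ (.tail _ (.head _))) (hX h2 _ (.head _)) (hX h3 _ (.head _)) d d) h1 h2 h3,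
  sbPRF_atom := fun h1 h2 => 
    H_sbPRF_atom _ (asg_ne (hX h1 _ (.head _)) (hX h2 _ (.head _)) (hX h2 _ (.tail _ (.tail _ (.tail _ (.tail _ (.head _)))))) (hX h1 _ (.tail _ (.head _))) (hX h2 _ (.tail _ (.tail _ (.head _)))) (hX h2 _ (.tail _ (.head _))) (hX h2 _ (.tail _ (.tail _ (.tail _ (.head _))))) d) h1 h2,
  sbRF_prime := fun h1 => 
    H_sbRF_prime _ (asg_ne (hX h1 _ (.head _)) d (hX h1 _ (.tail _ (.tail _ (.tail _ (.tail _ (.head _)))))) (hX h1 _ (.tail _ (.tail _ (.tail _ (.tail _ (.tail _ (.head _))))))) (hX h1 _ (.tail _ (.tail _ (.head _)))) (hX h1 _ (.tail _ (.head _))) d (hX h1 _ (.tail _ (.tail _ (.tail _ (.head _)))))) h1,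
  sbRF_imp := fun h1 h2 => 
    H_sbRF_imp _ (asg_ne (hX h1 _ (.head _)) (hX h2 _ (.head _)) (hX h1 _ (.tail _ (.tail _ (.tail _ (.tail _ (.head _)))))) (hX h1 _ (.tail _ (.tail _ (.tail _ (.tail _ (.tail _ (.head _))))))) (hX h1 _ (.tail _ (.tail _ (.head _)))) (hX h1 _ (.tail _ (.head _))) (hX h2 _ (.tail _ (.tail _ (.tail _ (.head _))))) (hX h1 _ (.tail _ (.tail _ (.tail _ (.head _)))))) h1 h2,
  sbRF_refl := fun h1 => 
    H_sbRF_refl _ (asg_ne (hX h1 _ (.head _)) d (hX h1 _ (.tail _ (.head _))) (hX h1 _ (.tail _ (.tail _ (.head _)))) d d d d) h1,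
  sbRF_last := fun hx hr h1 => 
    H_sbRF_last _ (asg_ne hx d (hX h1 _ (.tail _ (.tail _ (.tail _ (.tail _ (.head _)))))) (hX h1 _ (.tail _ (.tail _ (.tail _ (.tail _ (.tail _ (.head _))))))) (hX h1 _ (.tail _ (.tail _ (.head _)))) hr d (hX h1 _ (.tail _ (.head _)))) h1,
  sbRF_inner := fun hx hy hr ht h1 => 
    H_sbRF_inner _ (asg_ne hx hy (hX h1 _ (.tail _ (.tail _ (.tail _ (.tail _ (.head _)))))) (hX h1 _ (.tail _ (.tail _ (.tail _ (.tail _ (.tail _ (.head _))))))) (hX h1 _ (.tail _ (.tail _ (.head _)))) hr ht (hX h1 _ (.tail _ (.head _)))) h1,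
  ap_single := fun h1 h2 => 
    H_ap_single _ (asg_ne (hX h1 _ (.head _)) (hX h2 _ (.head _)) d d d d d d) h1 h2,
  ap_cons := fun h1 h2 h3 => 
    H_ap_cons _ (asg_ne (hX h1 _ (.head _)) (hX h2 _ (.head _)) d d d (hX h3 _ (.head _)) (hX h3 _ (.tail _ (.tail _ (.head _)))) (hX h3 _ (.tail _ (.head _)))) h1 h2 h3,
  eqA_refl := fun h1 h2 h3 => 
    H_eqA_refl _ (asg_ne (hX h3 _ (.head _)) d (hX h1 _ (.head _)) (hX h2 _ (.head _)) d d d d) h1 h2 h3,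
  eqA_subst := fun h1 h2 h3 h4 => 
    H_eqA_subst _ (asg_ne (hX h1 _ (.head _)) (hX h2 _ (.head _)) (hX h3 _ (.tail _ (.head _))) (hX h3 _ (.tail _ (.tail _ (.head _)))) (hX h3 _ (.head _)) d d (hX h4 _ (.tail _ (.tail _ (.tail _ (.head _)))))) h1 h2 h3 h4,
  eqA_atom := fun h1 h2 h3 => 
    H_eqA_atom _ (asg_ne d d (hX h3 _ (.head _)) (hX h2 _ (.tail _ (.head _))) (hX h2 _ (.head _)) (hX h1 _ (.head _)) (hX h1 _ (.tail _ (.tail _ (.head _)))) (hX h1 _ (.tail _ (.head _)))) h1 h2 h3,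
  basisPlus_single := fun h1 => 
    H_basisPlus_single _ (asg_ne (hX h1 _ (.head _)) d (hX h1 _ (.tail _ (.head _))) (hX h1 _ (.tail _ (.tail _ (.head _)))) d d d d) h1,
  basisPlus_concat := fun hs h1 h2 => 
    H_basisPlus_concat _ (asg_ne (hX h1 _ (.head _)) d (hX h1 _ (.tail _ (.head _))) (hX h1 _ (.tail _ (.tail _ (.head _)))) d d d hs) h1 h2,
  basis_nil := fun h1 h2 => 
    H_basis_nil _ (asg_ne d d (hX h1 _ (.head _)) (hX h2 _ (.head _)) d d d d) h1 h2,
  basis_plus := fun h1 => H_basis_plus _ (asg_ne (hX h1 _ (.head _)) d d d d d d d) h1,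
  bra_single := fun h1 => 
    H_bra_single _ (asg_ne (hX h1 _ (.head _)) d (hX h1 _ (.tail _ (.head _))) (hX h1 _ (.tail _ (.tail _ (.head _)))) d d d d) h1,
  bra_concat := fun hs h1 h2 => 
    H_bra_concat _ (asg_ne (hX h1 _ (.head _)) d (hX h1 _ (.tail _ (.head _))) (hX h1 _ (.tail _ (.tail _ (.head _)))) d d d hs) h1 h2,
  bra_prev := fun hs h1 h2 => 
    H_bra_prev _ (asg_ne (hX h1 _ (.head _)) (hX h2 _ (.tail _ (.head _))) (hX h1 _ (.tail _ (.head _))) (hX h1 _ (.tail _ (.tail _ (.head _)))) d d d hs) h1 h2,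
  ra_eqA := fun hs h1 h2 => 
    H_ra_eqA _ (asg_ne (hX h1 _ (.head _)) d (hX h1 _ (.tail _ (.head _))) (hX h1 _ (.tail _ (.tail _ (.head _)))) d d d hs) h1 h2,
  ra_bra := fun h1 => 
    H_ra_bra _ (asg_ne (hX h1 _ (.head _)) (hX h1 _ (.tail _ (.head _))) d d d d d d) h1,
  pbra_mk := fun hs h1 h2 => 
    H_pbra_mk _ (asg_ne (hX h1 _ (.head _)) d (hX h1 _ (.tail _ (.head _))) (hX h1 _ (.tail _ (.tail _ (.head _)))) d d d hs) h1 h2,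
  dsPlus_single := fun hs h1 h2 h3 => 
    H_dsPlus_single _ (asg_ne (hX h3 _ (.tail _ (.head _))) d (hX h1 _ (.head _)) (hX h2 _ (.head _)) d d d hs) h1 h2 h3,
  dsPlus_ax := fun h1 h2 => 
    H_dsPlus_ax _ (asg_ne (hX h1 _ (.head _)) (hX h1 _ (.tail _ (.head _))) d d (hX h2 _ (.tail _ (.head _))) d d d) h1 h2,
  dsPlus_mp := fun hx hz hs h1 h2 h3 h4 => 
    H_dsPlus_mp _ (asg_ne hx d d d hz (hX h3 _ (.tail _ (.head _))) (hX h1 _ (.tail _ (.head _))) hs) h1 h2 h3 h4,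
  dsPlus_subst := fun hx hz h1 h2 h3 => 
    H_dsPlus_subst _ (asg_ne hx (hX h2 _ (.tail _ (.head _))) (hX h3 _ (.tail _ (.tail _ (.head _)))) (hX h3 _ (.tail _ (.tail _ (.tail _ (.head _))))) hz d (hX h1 _ (.tail _ (.head _))) (hX h3 _ (.tail _ (.head _)))) h1 h2 h3,
  ds_nil := fun hs h1 h2 h3 => 
    H_ds_nil _ (asg_ne d d (hX h1 _ (.head _)) (hX h2 _ (.head _)) d d d hs) h1 h2 h3,
  ds_plus := fun h1 => 
    H_ds_plus _ (asg_ne (hX h1 _ (.head _)) (hX h1 _ (.tail _ (.head _))) d d d d d d) h1,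
  omega_mk := fun h1 h2 h3 => 
    H_omega_mk _ (asg_ne (hX h1 _ (.head _)) (hX h3 _ (.tail _ (.head _))) (hX h1 _ (.tail _ (.head _))) (hX h1 _ (.tail _ (.tail _ (.head _)))) d d (hX h2 _ (.head _)) d) h1 h2 h3 }

theorem der_closed : Closed Der :=
  .of_clauses (fun h => h.1) fun _ hc σ hσ h => Der.of_clause hc σ hσ h

end U11

end RecSys

namespace RecSys

/-! ## Soundness of the universal system -/

theorem RecursiveSystem.ext_basis {A P : Type} [Finite A] [Finite P] {S S' : RecursiveSystem A P}
    (h : S.basis = S'.basis) : S = S' := by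
  cases S
  cases S'
  simp_all

section

variable {A P : Type}

@[simp] theorem subst_eqn (x : ℕ) (r l m : Str A P) :
    subst x r (eqn l m) = eqn (subst x r l) (subst x r m) := inst_eqn _ _ _

@[simp] theorem subst_atom (x : ℕ) (r : Str A P) (p : P) (ls : List (Str A P)) :
    subst x r (atom p ls) = atom p (ls.map (subst x r)) := inst_atom _ _ _

@[simp] theorem subst_imp (x : ℕ) (r F G : Str A P) :
    subst x r (imp F G) = imp (subst x r F) (subst x r G) := inst_imp _ _ _

@[simp] theorem subst_append (x : ℕ) (r F G : Str A P) :
    subst x r (F ++ G) = subst x r F ++ subst x r G := inst_append _ _ _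

theorem subst_self (x : ℕ) (F : Str A P) : subst x [Sym.var x] F = F := by
  rw [subst_eq_inst]
  conv_rhs => rw [← inst_self F]
  congr 1
  funext n
  split <;> simp_all

theorem subst_const (x : ℕ) (r : Str A P) (b : A) (F : Str A P) :
    subst x r (Sym.const b :: F) = Sym.const b :: subst x r F := rfl

theorem subst_lpar (x : ℕ) (r F : Str A P) :
    subst x r (Sym.lpar :: F) = Sym.lpar :: subst x r F := rfl

theorem subst_rpar (x : ℕ) (r : Str A P) :
    subst x r [Sym.rpar] = [Sym.rpar] := rfl

theorem subst_var (x n : ℕ) (r : Str A P) :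
    subst x r [Sym.var n] = if n = x then r else [Sym.var n] := by
  simp [subst_eq_inst]

end

/-- The code of a variable. -/
def codeVar (n : ℕ) : List A11 := A11.v :: List.replicate (n + 1) A11.acc

@[simp] theorem enc_var {k l : ℕ} (n : ℕ) : enc ([Sym.var n] : Str (Fin k) (Fin l)) = codeVar n := by
  simp [encSym, codeVar]

theorem codeVar_injective : codeVar.Injective := by
  intro m n h
  simpa [codeVar] using congrArg List.length h

/-- The code of the premises of an axiom `→ ∼ x₁, y₁ … → ∼ xₙ, yₙ → p x₁, …, xₙ p y₁, …, yₙ`. -/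
def encPairs (xy : List (ℕ × ℕ)) : List A11 :=
  xy.flatMap fun q => A11.arrow :: A11.sim :: (codeVar q.1 ++ A11.comma :: codeVar q.2)

theorem enc_imps_pairs {k l : ℕ} (xy : List (ℕ × ℕ)) (G : Str (Fin k) (Fin l)) :
    enc (imps (xy.map fun q => eqn [Sym.var q.1] [Sym.var q.2]) G) = encPairs xy ++ enc G := by
  induction xy with
  | nil => rfl
  | cons q xy ih =>
    change enc (imp _ (imps _ G)) = _
    rw [enc_imp, ih]
    simp [encPairs, eqn, encSym, codeVar]

theorem intercalate_concat {α : Type} {c : α} {L : List (List α)} (hL : L ≠ []) (s : List α) :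
    [c].intercalate (L ++ [s]) = [c].intercalate L ++ c :: s := by
  induction L with
  | nil => exact (hL rfl).elim
  | cons t L ih =>
    rcases eq_or_ne L [] with rfl | h
    · simp
    · have := ih h
      cases L <;> simp_all

/-- A longer block of accents would cover the position of the star. This is needed for the
substitution rule, whose pattern `u*wxyz` has no star after `w`, so that `w` may be only an initial
part of the number of predicate symbols. -/
theorem le_of_encNat_append {m n : ℕ} {Y Z : List A11}
    (h : encNat m ++ Y = encNat n ++ A11.star :: Z) : m ≤ n := by
  by_contra hlt
  push Not at hlt
  obtain ⟨m, rfl⟩ : ∃ m', m = m' + 1 := ⟨m - 1, by omega⟩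
  rw [encNat_succ] at h
  cases n with
  | zero => simp [encNat, List.replicate_succ] at h
  | succ n =>
    rw [encNat_succ] at h
    have : (_ ++ _)[n + 1]? = (_ ++ _)[n + 1]? := congrArg (fun s => s[n + 1]?) h
    rw [List.getElem?_append_left (by simpa using hlt), List.getElem?_append_right (by simp)] at this
    simp [hlt] at this

/-! ### The intended meaning of the predicate symbols. -/

namespace U11

open P11

/-- The intended meaning of the predicate symbols of the universal system. -/
def Sem : P11 → List (List A11) → Prop
  | .Acc, [x] => ∃ n, x = List.replicate (n + 1) A11.acc
  | .N0, [x] => ∃ n, x = encNat n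
  | .lt, [x, y] => ∃ m n, m < n ∧ x = List.replicate (m + 1) A11.acc ∧
      y = List.replicate (n + 1) A11.acc
  | .le, [x, y] => ∃ m n, m ≤ n ∧ x = List.replicate (m + 1) A11.acc ∧
      y = List.replicate (n + 1) A11.acc
  | .As, [x, u] => ∃ (k : ℕ) (i : Fin k), x = A11.a :: List.replicate (i.val + 1) A11.acc ∧
      u = encNat k
  | .Ps, [x, w] => ∃ (l : ℕ) (j : Fin l), x = A11.p :: List.replicate (j.val + 1) A11.acc ∧
      w = encNat l
  | .V, [x] => ∃ n, x = codeVar n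
  -- A list contains no predicate symbols, so its code is a code for every `l`. The universal
  -- quantifier allows a later choice of `l` to fit the number `w` of predicate symbols.
  | .L, [x, u] => ∃ k, u = encNat k ∧ ∀ l, ∃ F : Str (Fin k) (Fin l), IsList F ∧ x = enc F
  | .EL, [x, u] => ∃ k, u = encNat k ∧ ∀ l, ∃ F : Str (Fin k) (Fin l), IsElemList F ∧ x = enc F
  | .LL, [x, u] => ∃ k, u = encNat k ∧ ∀ l, ∃ Fs : List (Str (Fin k) (Fin l)), Fs ≠ [] ∧
      (∀ F ∈ Fs, IsList F) ∧ x = [A11.comma].intercalate (Fs.map enc)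
  | .Eq, [x, u, w] => ∃ (k l : ℕ) (F G : Str (Fin k) (Fin l)), IsList F ∧ IsList G ∧
      x = enc (eqn F G) ∧ u = encNat k ∧ w = encNat l
  | .PRF, [x, u, w] => ∃ (k l n : ℕ) (F : Str (Fin k) (Fin l)), IsPrime n F ∧
      x = enc F ∧ u = encNat k ∧ w = encNat l
  | .RF, [x, u, w] => ∃ (k l : ℕ) (F : Str (Fin k) (Fin l)), IsFormula F ∧
      x = enc F ∧ u = encNat k ∧ w = encNat l
  | .VV, [x, y] => ∃ m n, m ≠ n ∧ x = codeVar m ∧ y = codeVar n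
  | .SbL, [x, r, z, s, u] => ∃ k n, u = encNat k ∧ z = codeVar n ∧
      ∀ l, ∃ F R : Str (Fin k) (Fin l), IsList F ∧ IsList R ∧ x = enc F ∧ r = enc R ∧
        s = enc (subst n R F)
  | .SbLL, [x, r, z, s, u] => ∃ k n, u = encNat k ∧ z = codeVar n ∧
      ∀ l, ∃ (Fs : List (Str (Fin k) (Fin l))) (R : Str (Fin k) (Fin l)), Fs ≠ [] ∧
        (∀ F ∈ Fs, IsList F) ∧ IsList R ∧ x = [A11.comma].intercalate (Fs.map enc) ∧
        r = enc R ∧ s = [A11.comma].intercalate ((Fs.map (subst n R)).map enc)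
  | .SbPRF, [x, r, z, s, u, w] => ∃ (k l m n : ℕ) (F R : Str (Fin k) (Fin l)), IsPrime m F ∧
      IsList R ∧ x = enc F ∧ r = enc R ∧ z = codeVar n ∧ s = enc (subst n R F) ∧
      u = encNat k ∧ w = encNat l
  | .SbRF, [x, r, z, s, u, w] => ∃ (k l n : ℕ) (F R : Str (Fin k) (Fin l)), IsFormula F ∧
      IsList R ∧ x = enc F ∧ r = enc R ∧ z = codeVar n ∧ s = enc (subst n R F) ∧
      u = encNat k ∧ w = encNat l
  | .SbRF, [x, s, u, w] => ∃ (k l n : ℕ) (F R : Str (Fin k) (Fin l)), IsFormula F ∧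
      IsList R ∧ x = enc F ∧ s = enc (subst n R F) ∧ u = encNat k ∧ w = encNat l
  | .AP, [r, s, t] => ∃ xy : List (ℕ × ℕ), xy ≠ [] ∧ r = encPairs xy ∧
      s = [A11.comma].intercalate (xy.map fun q => codeVar q.1) ∧
      t = [A11.comma].intercalate (xy.map fun q => codeVar q.2)
  | .EqA, [x, u, w] => ∃ (k l : ℕ) (F : Str (Fin k) (Fin l)), IsEqAxiom F ∧
      x = enc F ∧ u = encNat k ∧ w = encNat l
  | .RBasisPlus, [x] => ∃ (k l : ℕ) (S : RecursiveSystem (Fin k) (Fin l)), S.basis ≠ [] ∧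
      x = encList S.basis
  | .RBasis, [x] => ∃ (k l : ℕ) (S : RecursiveSystem (Fin k) (Fin l)), x = encList S.basis
  | .BRA, [x, y] => ∃ (k l : ℕ) (S : RecursiveSystem (Fin k) (Fin l)) (F : Str (Fin k) (Fin l)),
      F ∈ S.basis ∧ x = encList S.basis ∧ y = enc F
  | .RA, [x, y] => ∃ (k l : ℕ) (S : RecursiveSystem (Fin k) (Fin l)) (F : Str (Fin k) (Fin l)),
      S.IsAxiom F ∧ x = encList S.basis ∧ y = enc F
  | .PBRA, [x, y] => ∃ (k l n : ℕ) (S : RecursiveSystem (Fin k) (Fin l)) (F : Str (Fin k) (Fin l)),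
      F ∈ S.basis ∧ IsPrime n F ∧ x = encList S.basis ∧ y = enc F
  | .DsPlus, [x, y] => ∃ (k l : ℕ) (S : RecursiveSystem (Fin k) (Fin l))
      (D : List (Str (Fin k) (Fin l))), D ≠ [] ∧ S.IsDerivation D ∧ x = encList D ∧
      y = encList S.basis
  | .Ds, [x, y] => ∃ (k l : ℕ) (S : RecursiveSystem (Fin k) (Fin l))
      (D : List (Str (Fin k) (Fin l))), S.IsDerivation D ∧ x = encList D ∧ y = encList S.basis
  | .Omega, [z] => ∃ (k l : ℕ) (S : RecursiveSystem (Fin k) (Fin l)) (F : Str (Fin k) (Fin l)),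
      S.Derivable F ∧ z = encList S.basis ++ enc F
  -- These two predicates only limit the formulas admitted to `Omega`, whose meaning as given here
  -- demands derivability alone; no information about them is used.
  | .ELL, _ => True
  | .EPRF, _ => True
  | _, _ => False

/-- The rule treats the derivation as if it were an R-basis string. `BRA` and `PBRA` then certify
that `→ r s` and the prime `r` are steps, and `RBasisPlus` of the extended string certifies that `s`
is the code of a formula; where `x` and `z` are cut is irrelevant. -/
theorem sem_dsPlus_mp {x z r t s : List A11} (h1 : Sem DsPlus [x ++ .arrow :: (r ++ (s ++ z)), t])
    (h2 : Sem BRA [x ++ .arrow :: (r ++ (s ++ z)), .arrow :: (r ++ s)])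
    (h3 : Sem PBRA [x ++ .arrow :: (r ++ (s ++ z)), r])
    (h4 : Sem RBasisPlus [x ++ .arrow :: (r ++ (s ++ (z ++ (s ++ [.star]))))]) :
    Sem DsPlus [x ++ .arrow :: (r ++ (s ++ (z ++ (s ++ [.star])))), t] := by
  obtain ⟨k, l, S, D, hD, hder, e, rfl⟩ := h1
  obtain ⟨k₁, l₁, S₁, H, hH, e₁, eH⟩ := h2
  obtain ⟨k₂, l₂, n, S₂, R, hR, hp, e₂, rfl⟩ := h3
  obtain ⟨k₃, l₃, S₃, hS₃, e₃⟩ := h4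
  rw [e] at e₁ e₂
  obtain ⟨rfl, rfl⟩ := encList_injective e₁
  obtain ⟨rfl, rfl⟩ := encList_injective e₂
  have hH' : H ∈ D := encList_inj e₁ ▸ hH
  have hR' : R ∈ D := encList_inj e₂ ▸ hR
  have e₄ : encList D ++ (s ++ [A11.star]) = encList S₃.basis := by rw [← e₃, ← e]; simp
  have e₅ := e₄
  simp only [encList, List.append_assoc, List.cons_append] at e₅
  obtain ⟨rfl, rfl, e₆⟩ := header_inj e₅
  -- `s` is part of the code of the formula `H`, and codes of formulas contain no star.
  have hs : A11.star ∉ s := by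
    intro h
    have : A11.star ∈ enc H := by rw [← eH]; simp [h]
    exact star_notMem_enc H this
  obtain ⟨G, rfl, hG⟩ := eq_concat_of_encBody hD hs e₆
  have hHG : H = imp R G := enc_injective (by rw [← eH, enc_imp])
  refine ⟨_, _, S, D ++ [G], by simp, ?_, by rw [e₃, hG], rfl⟩
  exact hder.mp D R G (.prime n R hp) (S₃.isFormula G (by simp [hG])) hR' (hHG ▸ hH')

/-- Because `w` may be a shortened numeral, `SbRF` may refer to a language with fewer predicate
symbols than that of the derivation. Embedding the smaller language does not alter codes, so the
substitution is also one in the larger language. -/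
theorem sem_dsPlus_subst {x y u w z t s : List A11}
    (h1 : Sem DsPlus [u ++ .star :: (w ++ (x ++ (y ++ z))), t])
    (h2 : Sem BRA [u ++ .star :: (w ++ (x ++ (y ++ z))), y]) (h3 : Sem SbRF [y, s, u, w]) :
    Sem DsPlus [u ++ .star :: (w ++ (x ++ (y ++ (z ++ (s ++ [.star]))))), t] := by
  obtain ⟨k, l, S, D, hD, hder, e, rfl⟩ := h1
  obtain ⟨k₁, l₁, S₁, F, hF, e₁, rfl⟩ := h2
  obtain ⟨k₂, l₂, n, F₂, R, hF₂, hR, e₂, rfl, rfl, rfl⟩ := h3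
  rw [e] at e₁
  obtain ⟨rfl, rfl⟩ := encList_injective e₁
  have hF' : F ∈ D := encList_inj e₁ ▸ hF
  have e₃ := e
  rw [encList] at e₃
  obtain ⟨h1, h2⟩ := append_cons_inj (star_notMem_encNat _) (star_notMem_encNat _) e₃
  obtain rfl := encNat_injective h1
  have hl := le_of_encNat_append h2
  have key := enc_mapStr (f := (id : Fin k₂ → Fin k₂)) (g := Fin.castLE hl) (fun _ => rfl)
    fun _ => rfl
  have hFF : F = mapStr id (Fin.castLE hl) F₂ := enc_injective (by rw [key, e₂])
  refine ⟨_, _, S, D ++ [subst n (mapStr id (Fin.castLE hl) R) F], by simp,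
    hder.subst D F n _ hF' hR.map, ?_, rfl⟩
  have hs : enc (subst n (mapStr id (Fin.castLE hl) R) F) = enc (subst n R F₂) := by
    rw [hFF, ← mapStr_subst, key]
  rw [encList_concat hD, ← e, hs]
  simp

theorem sem_closed : Closed Sem where
  acc_one := ⟨0, rfl⟩
  acc_succ := by
    rintro _ ⟨n, rfl⟩
    exact ⟨n + 1, by rw [List.replicate_succ' (n := n + 1)]⟩
  n0_box := ⟨0, rfl⟩
  n0_acc := by
    rintro _ ⟨n, rfl⟩
    exact ⟨n + 1, (encNat_succ n).symm⟩
  lt_append := by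
    rintro _ _ ⟨m, rfl⟩ ⟨n, rfl⟩
    exact ⟨m, m + n + 1, by omega, rfl, by rw [List.replicate_append_replicate]; congr 1; omega⟩
  le_refl := by
    rintro _ ⟨m, rfl⟩
    exact ⟨m, m, le_rfl, rfl, rfl⟩
  le_of_lt := by
    rintro _ _ ⟨m, n, h, rfl, rfl⟩
    exact ⟨m, n, h.le, rfl, rfl⟩
  as_code := by
    rintro _ _ ⟨m, n, h, rfl, rfl⟩
    exact ⟨n + 1, ⟨m, by omega⟩, rfl, (encNat_succ n).symm⟩
  ps_code := by
    rintro _ _ ⟨m, n, h, rfl, rfl⟩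
    exact ⟨n + 1, ⟨m, by omega⟩, rfl, (encNat_succ n).symm⟩
  v_code := by
    rintro _ ⟨n, rfl⟩
    exact ⟨n, rfl⟩
  l_as := by
    rintro _ _ ⟨k, i, rfl, rfl⟩
    exact ⟨k, rfl, fun l => ⟨_, .const i, by simp [encSym]⟩⟩
  l_var := by
    rintro _ _ ⟨n, rfl⟩ ⟨k, rfl⟩
    exact ⟨k, rfl, fun l => ⟨_, .var n, by simp [-enc_cons]⟩⟩
  l_op := by
    rintro _ _ _ ⟨k, i, rfl, rfl⟩ ⟨k', hk, h⟩
    obtain rfl := encNat_injective hk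
    refine ⟨k, rfl, fun l => ?_⟩
    obtain ⟨F, hF, rfl⟩ := h l
    exact ⟨_, .op i F hF, by simp [encSym]⟩
  l_append := by
    rintro _ _ _ ⟨k, rfl, h⟩ ⟨k', hk, h'⟩
    obtain rfl := encNat_injective hk
    refine ⟨k, rfl, fun l => ?_⟩
    obtain ⟨F, hF, rfl⟩ := h l
    obtain ⟨G, hG, rfl⟩ := h' l
    exact ⟨_, .append F G hF hG, by simp⟩
  el_as := by
    rintro _ _ ⟨k, i, rfl, rfl⟩
    exact ⟨k, rfl, fun l => ⟨_, ⟨.const i, by simp [VarFree]⟩, by simp [encSym]⟩⟩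
  el_op := by
    rintro _ _ _ ⟨k, i, rfl, rfl⟩ ⟨k', hk, h⟩
    obtain rfl := encNat_injective hk
    refine ⟨k, rfl, fun l => ?_⟩
    obtain ⟨F, hF, rfl⟩ := h l
    exact ⟨_, ⟨.op i F hF.1, by simpa [VarFree] using hF.2⟩, by simp [encSym]⟩
  el_append := by
    rintro _ _ _ ⟨k, rfl, h⟩ ⟨k', hk, h'⟩
    obtain rfl := encNat_injective hk
    refine ⟨k, rfl, fun l => ?_⟩
    obtain ⟨F, hF, rfl⟩ := h l
    obtain ⟨G, hG, rfl⟩ := h' l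
    exact ⟨_, ⟨.append F G hF.1 hG.1, by simp [hF.2, hG.2]⟩, by simp⟩
  ll_single := by
    rintro _ _ ⟨k, rfl, h⟩
    refine ⟨k, rfl, fun l => ?_⟩
    obtain ⟨F, hF, rfl⟩ := h l
    exact ⟨[F], by simp, by simpa, by simp⟩
  ll_concat := by
    rintro _ _ _ ⟨k, rfl, h⟩ ⟨k', hk, h'⟩
    obtain rfl := encNat_injective hk
    refine ⟨k, rfl, fun l => ?_⟩
    obtain ⟨Fs, hne, hFs, rfl⟩ := h l
    obtain ⟨F, hF, rfl⟩ := h' l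
    refine ⟨Fs ++ [F], by simp, ?_, ?_⟩
    · simpa [or_imp, forall_and] using ⟨hFs, hF⟩
    · rw [List.map_append, List.map_singleton, intercalate_concat (by simpa)]
  eq_mk := by
    rintro _ _ _ _ ⟨l, rfl⟩ ⟨k, rfl, h⟩ ⟨k', hk, h'⟩
    obtain rfl := encNat_injective hk
    obtain ⟨F, hF, rfl⟩ := h l
    obtain ⟨G, hG, rfl⟩ := h' l
    exact ⟨k, l, F, G, hF, hG, by simp, rfl, rfl⟩
  prf_eq := by
    rintro _ _ _ ⟨k, l, F, G, hF, hG, rfl, rfl, rfl⟩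
    exact ⟨k, l, 2, _, .eqn F G hF hG, rfl, rfl, rfl⟩
  prf_nullary := by
    rintro _ _ _ ⟨l, j, rfl, rfl⟩ ⟨k, rfl⟩
    exact ⟨k, l, 0, _, .atom j [] (by simp), by simp [enc_atom], rfl, rfl⟩
  prf_atom := by
    rintro _ _ _ _ ⟨l, j, rfl, rfl⟩ ⟨k, rfl, h⟩
    obtain ⟨Fs, -, hFs, rfl⟩ := h l
    exact ⟨k, l, _, _, .atom j Fs hFs, by simp [enc_atom], rfl, rfl⟩
  ell_single := fun _ => trivial
  ell_concat := fun _ _ => trivial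
  eprf_eqn := fun _ _ _ => trivial
  eprf_nullary := fun _ _ => trivial
  eprf_atom := fun _ _ => trivial
  rf_prime := by
    rintro _ _ _ ⟨k, l, n, F, hF, rfl, rfl, rfl⟩
    exact ⟨k, l, F, .prime n F hF, rfl, rfl, rfl⟩
  rf_imp := by
    rintro _ _ _ _ ⟨k, l, n, F, hF, rfl, rfl, rfl⟩ ⟨k', l', G, hG, rfl, hk, hl⟩
    obtain rfl := encNat_injective hk
    obtain rfl := encNat_injective hl
    exact ⟨k, l, _, .imp n F G hF hG, by simp, rfl, rfl⟩
  vv_lt := by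
    rintro _ _ ⟨m, n, h, rfl, rfl⟩
    exact ⟨m, n, h.ne, rfl, rfl⟩
  vv_gt := by
    rintro _ _ ⟨m, n, h, rfl, rfl⟩
    exact ⟨n, m, h.ne', rfl, rfl⟩
  sbL_as := by
    rintro _ _ _ _ ⟨k, i, rfl, rfl⟩ ⟨n, rfl⟩ ⟨k', hk, h⟩
    obtain rfl := encNat_injective hk
    refine ⟨k, n, rfl, rfl, fun l => ?_⟩
    obtain ⟨R, hR, rfl⟩ := h l
    exact ⟨_, R, .const i, hR, by simp [encSym], rfl, by simp [subst, encSym]⟩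
  sbL_same := by
    rintro _ _ _ ⟨n, rfl⟩ ⟨k, rfl, h⟩
    refine ⟨k, n, rfl, rfl, fun l => ?_⟩
    obtain ⟨R, hR, rfl⟩ := h l
    exact ⟨_, R, .var n, hR, by simp [-enc_cons], rfl, by simp [subst_var]⟩
  sbL_other := by
    rintro _ _ _ _ ⟨m, n, hmn, rfl, rfl⟩ ⟨k, rfl, h⟩
    refine ⟨k, n, rfl, rfl, fun l => ?_⟩
    obtain ⟨R, hR, rfl⟩ := h l
    exact ⟨_, R, .var m, hR, by simp [-enc_cons], rfl, by simp [subst_var, hmn, -enc_cons]⟩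
  sbL_op := by
    rintro _ _ _ _ _ _ ⟨k, i, rfl, rfl⟩ ⟨k', n, hk, rfl, h⟩
    obtain rfl := encNat_injective hk
    refine ⟨k, n, rfl, rfl, fun l => ?_⟩
    obtain ⟨F, R, hF, hR, rfl, rfl, rfl⟩ := h l
    exact ⟨_, R, .op i F hF, hR, by simp [encSym], rfl,
      by simp [subst_const, subst_lpar, subst_rpar, encSym]⟩
  sbL_append := by
    rintro _ _ _ _ _ _ _ ⟨k, n, rfl, rfl, h⟩ ⟨k', n', hk, hn, h'⟩
    obtain rfl := encNat_injective hk
    obtain rfl := codeVar_injective hn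
    refine ⟨k, n, rfl, rfl, fun l => ?_⟩
    obtain ⟨F, R, hF, hR, rfl, rfl, rfl⟩ := h l
    obtain ⟨G, R', hG, hR', rfl, e, rfl⟩ := h' l
    obtain rfl := enc_injective e
    exact ⟨_, R, .append F G hF hG, hR, by simp, rfl, by simp⟩
  sbLL_single := by
    rintro _ _ _ _ _ ⟨k, n, rfl, rfl, h⟩
    refine ⟨k, n, rfl, rfl, fun l => ?_⟩
    obtain ⟨F, R, hF, hR, rfl, rfl, rfl⟩ := h l
    exact ⟨[F], R, by simp, by simpa, hR, by simp, rfl, by simp⟩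
  sbLL_concat := by
    rintro _ _ _ _ _ _ _ ⟨k, n, rfl, rfl, h⟩ ⟨k', n', hk, hn, h'⟩
    obtain rfl := encNat_injective hk
    obtain rfl := codeVar_injective hn
    refine ⟨k, n, rfl, rfl, fun l => ?_⟩
    obtain ⟨Fs, R, hne, hFs, hR, rfl, rfl, rfl⟩ := h l
    obtain ⟨G, R', hG, hR', rfl, e, rfl⟩ := h' l
    obtain rfl := enc_injective e
    refine ⟨Fs ++ [G], R, by simp, ?_, hR, ?_, rfl, ?_⟩
    · simpa [or_imp, forall_and] using ⟨hFs, hG⟩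
    · rw [List.map_append, List.map_singleton, intercalate_concat (by simpa)]
    · rw [List.map_append, List.map_singleton, List.map_append, List.map_singleton,
        intercalate_concat (by simpa)]
  sbPRF_eqn := by
    rintro _ _ _ _ _ _ _ _ ⟨l, rfl⟩ ⟨k, n, rfl, rfl, h⟩ ⟨k', n', hk, hn, h'⟩
    obtain rfl := encNat_injective hk
    obtain rfl := codeVar_injective hn
    obtain ⟨F, R, hF, hR, rfl, rfl, rfl⟩ := h l
    obtain ⟨G, R', hG, hR', rfl, e, rfl⟩ := h' l
    obtain rfl := enc_injective e
    exact ⟨k, l, 2, n, _, R, .eqn F G hF hG, hR, by simp, rfl, rfl, by simp, rfl, rfl⟩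
  sbPRF_nullary := by
    rintro _ _ _ _ _ ⟨l, j, rfl, rfl⟩ ⟨n, rfl⟩ ⟨k, rfl, h⟩
    obtain ⟨R, hR, rfl⟩ := h l
    exact ⟨k, l, 0, n, _, R, .atom j [] (by simp), hR, by simp [enc_atom], rfl, rfl,
      by simp [enc_atom], rfl, rfl⟩
  sbPRF_atom := by
    rintro _ _ _ _ _ _ _ ⟨l, j, rfl, rfl⟩ ⟨k, n, rfl, rfl, h⟩
    obtain ⟨Fs, R, hne, hFs, hR, rfl, rfl, rfl⟩ := h l
    exact ⟨k, l, _, n, _, R, .atom j Fs hFs, hR, by simp [enc_atom], rfl, rfl,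
      by simp [enc_atom], rfl, rfl⟩
  sbRF_prime := by
    rintro _ _ _ _ _ _ ⟨k, l, m, n, F, R, hF, hR, rfl, rfl, rfl, rfl, rfl, rfl⟩
    exact ⟨k, l, n, F, R, .prime m F hF, hR, rfl, rfl, rfl, rfl, rfl, rfl⟩
  sbRF_imp := by
    rintro _ _ _ _ _ _ _ _ ⟨k, l, m, n, F, R, hF, hR, rfl, rfl, rfl, rfl, rfl, rfl⟩
      ⟨k', l', n', G, R', hG, hR', rfl, e, hn, rfl, hk, hl⟩
    obtain rfl := encNat_injective hk
    obtain rfl := encNat_injective hl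
    obtain rfl := codeVar_injective hn
    obtain rfl := enc_injective e
    exact ⟨k, l, n, _, R, .imp m F G hF hG, hR, by simp, rfl, rfl, by simp, rfl, rfl⟩
  sbRF_refl := by
    rintro _ _ _ ⟨k, l, F, hF, rfl, rfl, rfl⟩
    -- Replacing a variable by itself realizes the trivial substitution.
    exact ⟨k, l, 0, F, _, hF, .var 0, rfl, by rw [subst_self], rfl, rfl⟩
  sbRF_last := by
    rintro _ _ _ _ _ _ - - ⟨k, l, n, F, R, hF, hR, hx, -, -, hs, hu, hw⟩
    exact ⟨k, l, n, F, R, hF, hR, hx, hs, hu, hw⟩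
  sbRF_inner := by
    rintro _ _ _ _ _ _ _ _ - - - - ⟨k, l, n, F, R, hF, hR, hx, -, -, hs, hu, hw⟩
    exact ⟨k, l, n, F, R, hF, hR, hx, hs, hu, hw⟩
  ap_single := by
    rintro _ _ ⟨m, rfl⟩ ⟨n, rfl⟩
    exact ⟨[(m, n)], by simp, by simp [encPairs], by simp, by simp⟩
  ap_cons := by
    rintro _ _ _ _ _ ⟨m, rfl⟩ ⟨n, rfl⟩ ⟨xy, hxy, rfl, rfl, rfl⟩
    obtain ⟨q, xy, rfl⟩ := List.exists_cons_of_ne_nil hxy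
    exact ⟨(m, n) :: q :: xy, by simp, by simp [encPairs], by simp, by simp⟩
  eqA_refl := by
    rintro _ _ _ ⟨k, rfl⟩ ⟨l, rfl⟩ ⟨n, rfl⟩
    exact ⟨k, l, _, .refl n, by simp [-enc_cons], rfl, rfl⟩
  eqA_subst := by
    rintro _ _ _ _ _ _ ⟨m, rfl⟩ ⟨n, rfl⟩ ⟨k, l, F, G, hF, hG, rfl, rfl, rfl⟩
      ⟨k', l', i, n', F', R, hF', hR, e, eR, en, rfl, hk, hl⟩
    obtain rfl := encNat_injective hk
    obtain rfl := encNat_injective hl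
    obtain rfl := codeVar_injective en
    obtain rfl := enc_injective e
    rw [← enc_var (k := k) (l := l)] at eR
    obtain rfl := enc_injective eR
    exact ⟨k, l, _, .subst m n F G hF hG, by simp [-enc_cons], rfl, rfl⟩
  eqA_atom := by
    rintro _ _ _ _ _ _ ⟨xy, hxy, rfl, rfl, rfl⟩ ⟨l, j, rfl, rfl⟩ ⟨k, rfl⟩
    refine ⟨k, l, _, .atom j xy hxy, ?_, rfl, rfl⟩
    rw [enc_imps_pairs]
    simp [enc_atom, Function.comp_def, -enc_cons]
  basisPlus_single := by
    rintro _ _ _ ⟨k, l, F, hF, rfl, rfl, rfl⟩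
    exact ⟨k, l, ⟨[F], by simpa⟩, by simp, by simp [encList, encBody_singleton]⟩
  basisPlus_concat := by
    rintro _ _ _ _ - ⟨k, l, F, hF, rfl, rfl, rfl⟩ ⟨k', l', S, hS, e⟩
    obtain ⟨rfl, rfl, e'⟩ := header_inj e
    refine ⟨k, l, ⟨S.basis ++ [F], ?_⟩, by simp, ?_⟩
    · simpa [or_imp, forall_and] using ⟨S.isFormula, hF⟩
    · rw [encList_concat hS, ← e]
      simp
  basis_nil := by
    rintro _ _ ⟨k, rfl⟩ ⟨l, rfl⟩
    exact ⟨k, l, ⟨[], by simp⟩, by simp [encList, encBody, starred]⟩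
  basis_plus := by
    rintro _ ⟨k, l, S, -, e⟩
    exact ⟨k, l, S, e⟩
  bra_single := by
    rintro _ _ _ ⟨k, l, F, hF, rfl, rfl, rfl⟩
    exact ⟨k, l, ⟨[F], by simpa⟩, F, by simp, by simp [encList, encBody_singleton], rfl⟩
  bra_concat := by
    rintro _ _ _ _ - ⟨k, l, F, hF, rfl, rfl, rfl⟩ ⟨k', l', S, hS, e⟩
    obtain ⟨rfl, rfl, e'⟩ := header_inj e
    refine ⟨k, l, ⟨S.basis ++ [F], ?_⟩, F, by simp, ?_, rfl⟩
    · simpa [or_imp, forall_and] using ⟨S.isFormula, hF⟩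
    · rw [encList_concat hS, ← e]
      simp
  bra_prev := by
    rintro _ _ _ _ _ - ⟨k, l, F, hF, rfl, rfl, rfl⟩ ⟨k', l', S, G, hG, e, rfl⟩
    obtain ⟨rfl, rfl, e'⟩ := header_inj e
    refine ⟨k, l, ⟨S.basis ++ [F], ?_⟩, G, by simp [hG], ?_, rfl⟩
    · simpa [or_imp, forall_and] using ⟨S.isFormula, hF⟩
    · rw [encList_concat (List.ne_nil_of_mem hG), ← e]
      simp
  ra_eqA := by
    rintro _ _ _ _ - ⟨k, l, F, hF, rfl, rfl, rfl⟩ ⟨k', l', S, e⟩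
    obtain ⟨rfl, rfl, e'⟩ := header_inj e
    exact ⟨k, l, S, F, Or.inl hF, e, rfl⟩
  ra_bra := by
    rintro _ _ ⟨k, l, S, F, hF, e, rfl⟩
    exact ⟨k, l, S, F, Or.inr hF, e, rfl⟩
  pbra_mk := by
    rintro _ _ _ _ - ⟨k, l, n, F, hF, rfl, rfl, rfl⟩ ⟨k', l', S, G, hG, e, e'⟩
    obtain ⟨rfl, rfl, -⟩ := header_inj e
    obtain rfl := enc_injective e'
    exact ⟨k, l, n, S, F, hG, hF, e, rfl⟩
  dsPlus_single := by
    rintro _ _ _ _ - ⟨k, rfl⟩ ⟨l, rfl⟩ ⟨k', l', S, F, hF, e, rfl⟩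
    obtain ⟨rfl, rfl, -⟩ := header_inj e
    exact ⟨k, l, S, [] ++ [F], by simp, .ax [] F .nil hF,
      by simp [encList, encBody_singleton], e⟩
  dsPlus_ax := by
    rintro _ _ _ ⟨k, l, S, D, hD, hder, rfl, rfl⟩ ⟨k', l', S', F, hF, e, rfl⟩
    obtain ⟨rfl, rfl⟩ := encList_injective e
    -- The code determines the whole system, so the axiom belongs to the system of the derivation.
    obtain rfl := RecursiveSystem.ext_basis (encList_inj e)
    exact ⟨k, l, S, D ++ [F], by simp, hder.ax D F hF, (encList_concat hD F).symm, rfl⟩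
  dsPlus_mp := fun _ _ _ => sem_dsPlus_mp
  dsPlus_subst := fun _ _ => sem_dsPlus_subst
  ds_nil := by
    rintro _ _ _ - ⟨k, rfl⟩ ⟨l, rfl⟩ ⟨k', l', S, e⟩
    obtain ⟨rfl, rfl, -⟩ := header_inj e
    exact ⟨k, l, S, [], .nil, by simp [encList, encBody, starred], e⟩
  ds_plus := by
    rintro _ _ ⟨k, l, S, D, -, h⟩
    exact ⟨k, l, S, D, h⟩
  omega_mk := by
    rintro _ _ _ _ _ - ⟨k, l, S, F, hF, rfl, rfl⟩ ⟨k', l', S', D, hD, e, rfl⟩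
    obtain ⟨rfl, rfl⟩ := encList_injective e
    exact ⟨k, l, S', F, ⟨D, hD, encList_inj e ▸ hF⟩, rfl⟩

theorem Der.sem {p : P11} {args : List (List A11)} (h : Der p args) : Sem p args := by
  obtain ⟨args', e, h'⟩ := sound sem_closed.clauses (by
    simp only [List.mem_map]
    rintro _ ⟨s, hs, rfl⟩
    exact isElemList_constStr id (h.1 s hs)) h.2
  rwa [List.map_injective_iff.2 constStr_injective e]

end U11

end RecSys

namespace RecSys

/-! ## Completeness of the universal system -/

namespace U11

open P11

theorem der_acc (n : ℕ) : Der Acc [List.replicate (n + 1) A11.acc] := by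
  induction n with
  | zero => exact der_closed.acc_one
  | succ n ih =>
    rw [List.replicate_succ' (n := n + 1)]
    exact der_closed.acc_succ ih

theorem der_n0 (n : ℕ) : Der N0 [encNat n] := by
  cases n with
  | zero => exact der_closed.n0_box
  | succ n =>
    rw [encNat_succ]
    exact der_closed.n0_acc (der_acc n)

theorem der_lt {m n : ℕ} (h : m < n) :
    Der lt [List.replicate (m + 1) A11.acc, List.replicate (n + 1) A11.acc] := by
  obtain ⟨d, rfl⟩ := Nat.exists_eq_add_of_lt h
  have := der_closed.lt_append (der_acc m) (der_acc d)
  rwa [List.replicate_append_replicate, show m + 1 + (d + 1) = m + d + 1 + 1 by omega] at this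

theorem der_le {i k : ℕ} (h : i < k) : Der le [List.replicate (i + 1) A11.acc, encNat k] := by
  obtain ⟨k, rfl⟩ : ∃ k', k = k' + 1 := ⟨k - 1, by omega⟩
  rw [encNat_succ]
  rcases (Nat.lt_succ_iff.1 h).eq_or_lt with rfl | h
  · exact der_closed.le_refl (der_acc i)
  · exact der_closed.le_of_lt (der_lt h)

theorem der_as {k : ℕ} (i : Fin k) :
    Der As [A11.a :: List.replicate (i.val + 1) A11.acc, encNat k] :=
  der_closed.as_code (der_le i.isLt)

theorem der_ps {l : ℕ} (j : Fin l) :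
    Der Ps [A11.p :: List.replicate (j.val + 1) A11.acc, encNat l] :=
  der_closed.ps_code (der_le j.isLt)

theorem der_v (n : ℕ) : Der V [codeVar n] := der_closed.v_code (der_acc n)

theorem der_vv {m n : ℕ} (h : m ≠ n) : Der VV [codeVar m, codeVar n] := by
  rcases h.lt_or_gt with h | h
  · exact der_closed.vv_lt (der_lt h)
  · exact der_closed.vv_gt (der_lt h)

section

variable {k l : ℕ} {F R : Str (Fin k) (Fin l)} {Fs : List (Str (Fin k) (Fin l))}

theorem der_list (hF : IsList F) : Der L [enc F, encNat k] := by
  induction hF with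
  | const i => simpa [encSym] using der_closed.l_as (der_as i)
  | var n => simpa [-enc_cons] using der_closed.l_var (der_v n) (der_n0 k)
  | op i F _ ih => simpa [encSym] using der_closed.l_op (der_as i) ih
  | append F G _ _ ih ih' => simpa using der_closed.l_append ih ih'

theorem der_elemList (hF : IsList F) (hv : VarFree F) : Der EL [enc F, encNat k] := by
  induction hF with
  | const i => simpa [encSym] using der_closed.el_as (der_as i)
  | var n => exact (hv n (by simp)).elim
  | op i F _ ih =>
    simpa [encSym] using der_closed.el_op (der_as i) (ih fun n hn => hv n (by simp [hn]))
  | append F G _ _ ih ih' =>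
    rw [varFree_append] at hv
    simpa using der_closed.el_append (ih hv.1) (ih' hv.2)

theorem der_lists (hne : Fs ≠ []) (hFs : ∀ F ∈ Fs, IsList F) :
    Der LL [[A11.comma].intercalate (Fs.map enc), encNat k] := by
  induction Fs using List.reverseRecOn with
  | nil => exact (hne rfl).elim
  | append_singleton Fs F ih =>
    have hF := der_list (hFs F (by simp))
    rcases eq_or_ne Fs [] with rfl | h
    · simpa using der_closed.ll_single hF
    · rw [List.map_append, List.map_singleton, intercalate_concat (by simpa)]
      exact der_closed.ll_concat (ih h fun F hF => hFs F (by simp [hF])) hF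

theorem der_elemLists (hne : Fs ≠ []) (hFs : ∀ F ∈ Fs, IsElemList F) :
    Der ELL [[A11.comma].intercalate (Fs.map enc), encNat k] := by
  induction Fs using List.reverseRecOn with
  | nil => exact (hne rfl).elim
  | append_singleton Fs F ih =>
    have hF := hFs F (by simp)
    have hF := der_elemList hF.1 hF.2
    rcases eq_or_ne Fs [] with rfl | h
    · simpa using der_closed.ell_single hF
    · rw [List.map_append, List.map_singleton, intercalate_concat (by simpa)]
      exact der_closed.ell_concat (ih h fun F hF => hFs F (by simp [hF])) hF

theorem der_eqn {G : Str (Fin k) (Fin l)} (hF : IsList F) (hG : IsList G) :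
    Der Eq [enc (eqn F G), encNat k, encNat l] := by
  simpa using der_closed.eq_mk (der_n0 l) (der_list hF) (der_list hG)

theorem der_prime {n : ℕ} (hF : IsPrime n F) : Der PRF [enc F, encNat k, encNat l] := by
  cases hF with
  | eqn F G hF hG => exact der_closed.prf_eq (der_eqn hF hG)
  | atom p ls hls =>
    rcases eq_or_ne ls [] with rfl | h
    · simpa [enc_atom] using der_closed.prf_nullary (der_ps p) (der_n0 k)
    · simpa [enc_atom] using der_closed.prf_atom (der_ps p) (der_lists h hls)

theorem der_elemPrime {n : ℕ} (hF : IsElemPrime n F) : Der EPRF [enc F, encNat k, encNat l] := by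
  obtain ⟨hF, hv⟩ := hF
  cases hF with
  | eqn F G hF hG =>
    have h1 : VarFree F := fun n hn => hv n (by simp [eqn, hn])
    have h2 : VarFree G := fun n hn => hv n (by simp [eqn, hn])
    simpa using der_closed.eprf_eqn (der_n0 l) (der_elemList hF h1) (der_elemList hG h2)
  | atom p ls hls =>
    rcases eq_or_ne ls [] with rfl | h
    · simpa [enc_atom] using der_closed.eprf_nullary (der_ps p) (der_n0 k)
    · have : ∀ F ∈ ls, IsElemList F := by
        refine fun F hF => ⟨hls F hF, fun n hn => hv n ?_⟩
        refine List.mem_cons_of_mem _ ?_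
        clear h hls hv
        induction ls with
        | nil => simp at hF
        | cons G ls ih =>
          rcases List.mem_cons.1 hF with rfl | hF
          · cases ls <;> simp [hn]
          · have := ih hF
            cases ls <;> simp_all
      simpa [enc_atom] using der_closed.eprf_atom (der_ps p) (der_elemLists h this)

theorem der_formula (hF : IsFormula F) : Der RF [enc F, encNat k, encNat l] := by
  induction hF with
  | prime n F hF => exact der_closed.rf_prime (der_prime hF)
  | imp n F G hF _ ih => simpa using der_closed.rf_imp (der_prime hF) ih

theorem der_sbList (n : ℕ) (hF : IsList F) (hR : IsList R) :
    Der SbL [enc F, enc R, codeVar n, enc (subst n R F), encNat k] := by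
  have hr := der_list hR
  induction hF with
  | const i => simpa [subst_const, subst, encSym] using der_closed.sbL_as (der_as i) (der_v n) hr
  | var m =>
    rcases eq_or_ne m n with rfl | h
    · simpa [subst_var, -enc_cons] using der_closed.sbL_same (der_v m) hr
    · simpa [subst_var, -enc_cons, h] using der_closed.sbL_other (der_vv h) hr
  | op i F _ ih =>
    simpa [subst_const, subst_lpar, subst_rpar, encSym] using der_closed.sbL_op (der_as i) ih
  | append F G _ _ ih ih' => simpa using der_closed.sbL_append ih ih'

theorem der_sbLists (n : ℕ) (hne : Fs ≠ []) (hFs : ∀ F ∈ Fs, IsList F) (hR : IsList R) :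
    Der SbLL [[A11.comma].intercalate (Fs.map enc), enc R, codeVar n,
      [A11.comma].intercalate ((Fs.map (subst n R)).map enc), encNat k] := by
  induction Fs using List.reverseRecOn with
  | nil => exact (hne rfl).elim
  | append_singleton Fs F ih =>
    have hF := der_sbList n (hFs F (by simp)) hR
    rcases eq_or_ne Fs [] with rfl | h
    · simpa using der_closed.sbLL_single hF
    · rw [List.map_append, List.map_append, List.map_append, List.map_singleton,
        List.map_singleton, List.map_singleton, intercalate_concat (by simpa),
        intercalate_concat (by simpa)]
      exact der_closed.sbLL_concat (ih h fun F hF => hFs F (by simp [hF])) hF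

theorem der_sbPrime (n : ℕ) {m : ℕ} (hF : IsPrime m F) (hR : IsList R) :
    Der SbPRF [enc F, enc R, codeVar n, enc (subst n R F), encNat k, encNat l] := by
  cases hF with
  | eqn F G hF hG =>
    simpa using der_closed.sbPRF_eqn (der_n0 l) (der_sbList n hF hR) (der_sbList n hG hR)
  | atom p ls hls =>
    rcases eq_or_ne ls [] with rfl | h
    · simpa [enc_atom] using der_closed.sbPRF_nullary (der_ps p) (der_v n) (der_list hR)
    · simpa [enc_atom] using der_closed.sbPRF_atom (der_ps p) (der_sbLists n h hls hR)

theorem der_sbFormula (n : ℕ) (hF : IsFormula F) (hR : IsList R) :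
    Der SbRF [enc F, enc R, codeVar n, enc (subst n R F), encNat k, encNat l] := by
  induction hF with
  | prime m F hF => exact der_closed.sbRF_prime (der_sbPrime n hF hR)
  | imp m F G hF _ ih => simpa using der_closed.sbRF_imp (der_sbPrime n hF hR) ih

theorem subst_of_notMem {A P : Type} {n : ℕ} {R F : Str A P} (h : Sym.var n ∉ F) :
    subst n R F = F := by
  conv_rhs => rw [← inst_self F]
  rw [subst_eq_inst]
  refine inst_congr fun m hm => ?_
  rw [if_neg]
  rintro rfl
  exact h hm

theorem subst_ne_nil {A P : Type} {n : ℕ} {R F : Str A P} (hR : R ≠ []) (hF : F ≠ []) :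
    subst n R F ≠ [] := by
  cases F with
  | nil => exact (hF rfl).elim
  | cons c F =>
    cases c <;> simp [subst_eq_inst]
    split <;> simp [hR]

/-- The rules forgetting the variable and the inserted list ask for an occurrence of the variable
with something before it; this is available because formulas never begin with a variable. The part
after the occurrence may be empty, hence two rules. If the variable does not occur, nothing changes
and the reflexive rule applies. -/
theorem der_subst (n : ℕ) (hF : IsFormula F) (hR : IsList R) :
    Der SbRF [enc F, enc (subst n R F), encNat k, encNat l] := by
  by_cases h : Sym.var n ∈ F
  · have hs := der_sbFormula n hF hR
    obtain ⟨X, Y, rfl⟩ := List.append_of_mem h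
    have hX : X ≠ [] := by
      rintro rfl
      obtain ⟨c, G, e, hc⟩ := hF.shape
      simp only [List.nil_append, List.cons.injEq] at e
      rw [← e.1] at hc
      exact hc
    have hsX : subst n R X ≠ [] := subst_ne_nil hR.ne_nil hX
    have e1 : enc (X ++ Sym.var n :: Y) = enc X ++ (codeVar n ++ enc Y) := by
      rw [← List.singleton_append, enc_append, enc_append, enc_var]
    have e2 : enc (subst n R (X ++ Sym.var n :: Y)) =
        enc (subst n R X) ++ (enc R ++ enc (subst n R Y)) := by
      rw [← List.singleton_append, subst_append, subst_append, subst_var, if_pos rfl, enc_append,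
        enc_append]
    rw [e1, e2] at hs ⊢
    rcases eq_or_ne Y [] with rfl | hY
    · have : subst n R [] = [] := rfl
      rw [this] at hs ⊢
      simp only [enc_nil, List.append_nil] at hs ⊢
      exact der_closed.sbRF_last (enc_ne_nil hX) (enc_ne_nil hsX) hs
    · exact der_closed.sbRF_inner (enc_ne_nil hX) (enc_ne_nil hY) (enc_ne_nil hsX)
        (enc_ne_nil (subst_ne_nil hR.ne_nil hY)) hs
  · rw [subst_of_notMem h]
    exact der_closed.sbRF_refl (der_formula hF)

theorem der_pairs {xy : List (ℕ × ℕ)} (h : xy ≠ []) :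
    Der AP [encPairs xy, [A11.comma].intercalate (xy.map fun q => codeVar q.1),
      [A11.comma].intercalate (xy.map fun q => codeVar q.2)] := by
  induction xy with
  | nil => exact (h rfl).elim
  | cons q xy ih =>
    rcases eq_or_ne xy [] with rfl | hxy
    · simpa [encPairs] using der_closed.ap_single (der_v q.1) (der_v q.2)
    · have := der_closed.ap_cons (der_v q.1) (der_v q.2) (ih hxy)
      obtain ⟨q', xy, rfl⟩ := List.exists_cons_of_ne_nil hxy
      simpa [encPairs] using this

theorem der_eqAxiom (hF : IsEqAxiom F) : Der EqA [enc F, encNat k, encNat l] := by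
  cases hF with
  | refl n => simpa [-enc_cons] using der_closed.eqA_refl (der_n0 k) (der_n0 l) (der_v n)
  | subst m n F G hF hG =>
    have := der_sbPrime n (.eqn F G hF hG) (IsList.var m)
    rw [enc_var] at this
    have := der_closed.eqA_subst (der_v m) (der_v n) (der_eqn hF hG) this
    simpa [-enc_cons] using this
  | atom p xy h =>
    rw [enc_imps_pairs]
    have := der_closed.eqA_atom (der_pairs h) (der_ps p) (der_n0 k)
    simpa [enc_atom, Function.comp_def, -enc_cons] using this

theorem encList_eq_of_body {s : List A11} (h : encBody Fs = s ++ [A11.star]) :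
    encList Fs = encNat k ++ A11.star :: (encNat l ++ A11.star :: (s ++ [A11.star])) := by
  rw [encList, h]

theorem encList_concat_eq {s : List A11} (hne : Fs ≠ []) (h : encBody Fs = s ++ [A11.star]) :
    encList (Fs ++ [F]) = encNat k ++ A11.star :: (encNat l ++ A11.star ::
      (s ++ A11.star :: (enc F ++ [A11.star]))) := by
  rw [encList_concat hne, encList_eq_of_body h]
  simp

theorem encList_singleton : encList [F] =
    encNat k ++ A11.star :: (encNat l ++ A11.star :: (enc F ++ [A11.star])) := by
  rw [encList, encBody_singleton]

theorem der_basisPlus (hne : Fs ≠ []) (hFs : ∀ F ∈ Fs, IsFormula F) :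
    Der RBasisPlus [encList Fs] := by
  induction Fs using List.reverseRecOn with
  | nil => exact (hne rfl).elim
  | append_singleton Fs F ih =>
    have hF := der_formula (hFs F (by simp))
    rcases eq_or_ne Fs [] with rfl | h
    · rw [List.nil_append, encList_singleton]
      exact der_closed.basisPlus_single hF
    · have hFs' : ∀ F ∈ Fs, IsFormula F := fun F hF => hFs F (by simp [hF])
      have ih := ih h hFs'
      obtain ⟨s, hs, e⟩ := encBody_eq_concat Fs fun F hF => (hFs' F hF).ne_nil
      rw [encList_eq_of_body e] at ih
      rw [encList_concat_eq h e]
      exact der_closed.basisPlus_concat hs hF ih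

theorem der_basis (hFs : ∀ F ∈ Fs, IsFormula F) : Der RBasis [encList Fs] := by
  rcases eq_or_ne Fs [] with rfl | h
  · simpa [encList, encBody, starred] using der_closed.basis_nil (der_n0 k) (der_n0 l)
  · exact der_closed.basis_plus (der_basisPlus h hFs)

theorem der_bra (hFs : ∀ F ∈ Fs, IsFormula F) (hF : F ∈ Fs) : Der BRA [encList Fs, enc F] := by
  induction Fs using List.reverseRecOn with
  | nil => simp at hF
  | append_singleton Fs G ih =>
    have hG := der_formula (hFs G (by simp))
    rcases eq_or_ne Fs [] with rfl | h
    · obtain rfl : F = G := by simpa using hF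
      rw [List.nil_append, encList_singleton]
      exact der_closed.bra_single hG
    · have hFs' : ∀ F ∈ Fs, IsFormula F := fun F hF => hFs F (by simp [hF])
      obtain ⟨s, hs, e⟩ := encBody_eq_concat Fs fun F hF => (hFs' F hF).ne_nil
      have hb := der_basisPlus h hFs'
      rw [encList_concat_eq h e]
      rw [encList_eq_of_body e] at ih hb
      rcases List.mem_append.1 hF with hF | hF
      · exact der_closed.bra_prev hs hG (ih hFs' hF)
      · obtain rfl := List.mem_singleton.1 hF
        exact der_closed.bra_concat hs hG hb

theorem der_pbra {n : ℕ} (hFs : ∀ F ∈ Fs, IsFormula F) (hF : F ∈ Fs) (hp : IsPrime n F) :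
    Der PBRA [encList Fs, enc F] := by
  have hb := der_bra hFs hF
  obtain ⟨s, hs, e⟩ := encBody_eq_concat Fs fun F hF => (hFs F hF).ne_nil
  rw [encList_eq_of_body e] at hb ⊢
  exact der_closed.pbra_mk hs (der_prime hp) hb

theorem der_axiom {S : RecursiveSystem (Fin k) (Fin l)} (hF : S.IsAxiom F) :
    Der RA [encList S.basis, enc F] := by
  rcases hF with hF | hF
  · have hb := der_basis S.isFormula
    obtain ⟨s, hs, e⟩ := encBody_eq_concat S.basis fun F hF => (S.isFormula F hF).ne_nil
    rw [encList_eq_of_body e] at hb ⊢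
    exact der_closed.ra_eqA hs (der_eqAxiom hF) hb
  · exact der_closed.ra_bra (der_bra S.isFormula hF)

/-- A step is preceded by the star that closes the header or the previous step and followed by its
own star, so both contexts demanded by the rules are nonempty. -/
theorem encList_split (hF : F ∈ Fs) : ∃ x z, x ≠ [] ∧ z ≠ [] ∧
    encList Fs = encNat k ++ A11.star :: (encNat l ++ (x ++ (enc F ++ z))) := by
  obtain ⟨X, Y, rfl⟩ := List.append_of_mem hF
  refine ⟨A11.star :: starred (X.map enc), A11.star :: starred (Y.map enc), by simp, by simp, ?_⟩
  rw [encList, encBody_of_ne (by simp)]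
  simp [starred]

/-- Each rule for building derivations has its counterpart in the universal system. A derivation is
a list of formulas, so `BRA`, `PBRA` and `RBasisPlus` apply to its code as they do to a basis. -/
theorem der_derivation {S : RecursiveSystem (Fin k) (Fin l)} {D : List (Str (Fin k) (Fin l))}
    (hD : S.IsDerivation D) (hne : D ≠ []) : Der DsPlus [encList D, encList S.basis] := by
  induction hD with
  | nil => exact (hne rfl).elim
  | ax D F _ hF ih =>
    have ha := der_axiom hF
    rcases eq_or_ne D [] with rfl | h
    · obtain ⟨s, hs, e⟩ := encBody_eq_concat S.basis fun F hF => (S.isFormula F hF).ne_nil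
      rw [encList_eq_of_body e] at ha ⊢
      rw [List.nil_append, encList_singleton]
      exact der_closed.dsPlus_single hs (der_n0 k) (der_n0 l) ha
    · rw [encList_concat h]
      exact der_closed.dsPlus_ax (ih h) ha
  | mp D F G hD hF hG hFD h ih =>
    have hfD := hD.isFormula
    have hne := List.ne_nil_of_mem h
    obtain ⟨n, hp⟩ := hF.isPrime_of_imp (hfD _ h)
    have hpb := der_pbra hfD hFD hp
    have hb := der_bra hfD h
    have hbp : Der RBasisPlus [encList (D ++ [G])] := der_basisPlus (by simp) (by
      simpa [or_imp, forall_and] using ⟨hfD, hG⟩)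
    obtain ⟨x, z, hx, hz, e⟩ := encList_split h
    -- In the pattern of this rule the string before the arrow includes the header.
    have e' : encList D = (encNat k ++ A11.star :: (encNat l ++ x)) ++
        A11.arrow :: (enc F ++ (enc G ++ z)) := by simp [e]
    have ih := ih hne
    rw [encList_concat hne] at hbp ⊢
    rw [e'] at ih hb hpb hbp ⊢
    rw [enc_imp] at hb
    have := der_closed.dsPlus_mp (by simp) hz (enc_ne_nil hG.ne_nil) ih hb hpb (by simpa using hbp)
    simpa using this
  | subst D F n R hD hF hR ih =>
    have hne := List.ne_nil_of_mem hF
    have hfD := hD.isFormula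
    have hb := der_bra hfD hF
    have ih := ih hne
    obtain ⟨x, z, hx, hz, e⟩ := encList_split hF
    rw [encList_concat hne]
    rw [e] at ih hb ⊢
    simpa using der_closed.dsPlus_subst hx hz ih hb (der_subst n (hfD F hF) hR)

theorem der_omega {S : RecursiveSystem (Fin k) (Fin l)} (h : S.Derivable F) {u w : List A11}
    (hF : Der EPRF [enc F, u, w]) : Der Omega [encList S.basis ++ enc F] := by
  obtain ⟨D, hD, hFD⟩ := h
  exact der_closed.omega_mk hF (der_bra hD.isFormula hFD)
    (der_closed.ds_plus (der_derivation hD (List.ne_nil_of_mem hFD)))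

/-- The universal system derives exactly the elementary prime formulas that are derivable in the
encoded system. -/
theorem der_omega_iff {S : RecursiveSystem (Fin k) (Fin l)} {n : ℕ} (hF : IsElemPrime n F) :
    Der Omega [encSystem S ++ enc F] ↔ S.Derivable F := by
  rw [encSystem_eq]
  refine ⟨fun h => ?_, fun h => der_omega h (der_elemPrime hF)⟩
  obtain ⟨k', l', S', F', hF', e⟩ := h.sem
  have e₁ := e
  simp only [encList, List.append_assoc, List.cons_append] at e₁
  obtain ⟨rfl, rfl, -⟩ := header_inj e₁
  obtain ⟨s, -, hs⟩ := encBody_eq_concat S.basis fun F hF => (S.isFormula F hF).ne_nil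
  obtain ⟨s', -, hs'⟩ := encBody_eq_concat S'.basis fun F hF => (S'.isFormula F hF).ne_nil
  -- Codes of formulas contain no star, so the last star separates the R-basis string from the
  -- formula; reversal turns it into the first star.
  have e₂ := congrArg List.reverse e
  rw [encList_eq_of_body hs, encList_eq_of_body hs'] at e₂
  simp only [List.reverse_append, List.reverse_cons, List.append_assoc, List.nil_append,
    List.cons_append] at e₂
  obtain ⟨h1, -⟩ := append_cons_inj (by simpa using star_notMem_enc F)
    (by simpa using star_notMem_enc F') e₂
  obtain rfl := enc_injective (List.reverse_injective h1)
  obtain rfl := RecursiveSystem.ext_basis (encList_inj (List.append_cancel_right e))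
  exact hF'

end

end U11

end RecSys

namespace RecSys

/-! ## The recursively enumerable sets of statements and theorems -/

namespace U11

open P11

/-- Soundness for the interpretation that accepts everything already shows that the arguments are
words, free of brackets. -/
theorem exists_der {p : P11} {ls : List (Str A11 P11)} (hls : ∀ l ∈ ls, IsElemList l)
    (h : S11.Derivable (atom p ls)) : ∃ args, ls = args.map (constStr id) ∧ Der p args := by
  obtain ⟨args, rfl, -⟩ := sound (M := fun _ _ => True) (fun _ _ _ _ _ => trivial) hls h
  refine ⟨args, rfl, fun s hs => ?_, h⟩
  rintro rfl
  exact (hls _ (List.mem_map_of_mem hs)).1.ne_nil rfl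

theorem exists_pair_of_map {α β : Type} {f : α → β} {b b' : β} {L : List α}
    (h : [b, b'] = L.map f) : ∃ a a', L = [a, a'] ∧ b = f a ∧ b' = f a' := by
  obtain ⟨a, L', rfl, rfl, h'⟩ := List.map_eq_cons_iff.1 h.symm
  obtain ⟨a', L'', rfl, rfl, h''⟩ := List.map_eq_cons_iff.1 h'
  obtain rfl := List.map_eq_nil_iff.1 h''
  exact ⟨a, a', rfl, rfl, rfl⟩

/-- The clause for unary statements, or for unary theorems if `b` holds. -/
def statementClause (b : Bool) : Clause A11 P11 (P11 ⊕ Unit) :=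
  ⟨[(.inl Ps, [x, w]), (.inl EL, [y, u]), (.inl RBasis, [t])] ++
    if b then [(.inl Omega, [t ++ (x ++ y)])] else [], (.inr (), [t ++ (x ++ y)])⟩

theorem statementClause_wf (b : Bool) : (statementClause b).Wf :=
  Clause.wf_of_isSafe (by cases b <;> rfl)

/-- The strings described by the clause for unary statements or theorems. -/
def IsDescribed (b : Bool) (z : List A11) : Prop :=
  ∃ x y u w t, Der Ps [x, w] ∧ Der EL [y, u] ∧ Der RBasis [t] ∧ (b → Der Omega [z]) ∧
    z = t ++ (x ++ y)

/-- Interpreting the new symbol by the described strings gives a model of the extended system, so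
nothing else is derivable; conversely one application of the new clause derives each described
string. -/
theorem recEnum_isDescribed (b : Bool) : RecEnum {z | IsDescribed b z} := by
  have hwf : ∀ c ∈ [statementClause b], c.Wf := by simpa using statementClause_wf b
  let R : Unit → List (Str A11 P11) → Prop :=
    fun _ ls => ∃ z, IsDescribed b z ∧ ls = [constStr id z]
  have hmodel : IsModel (S11.extend [statementClause b] hwf)
      (RecursiveSystem.ExtTruth S11 R) := by
    refine RecursiveSystem.extTruth_isModel ?_ ?_
    · intro _ ls hls h
      -- Derivable equality in the universal system is identity, so the congruence axiom is
      -- harmless.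
      convert h using 1
      exact List.map_congr_left fun q hq =>
        (eq_of_derivable_eqn (hls q hq).1 (hls q hq).2.1 (hls q hq).2.2).symm
    · simp only [List.mem_singleton, forall_eq]
      intro σ hσ h
      have h1 := h (.inl Ps, [x, w]) (by simp [statementClause])
      have h2 := h (.inl EL, [y, u]) (by simp [statementClause])
      have h3 := h (.inl RBasis, [t]) (by simp [statementClause])
      simp only [RecursiveSystem.ExtRel, List.map_cons, List.map_nil, x, y, u, w, t, inst_var,
        inst_nil, List.append_nil] at h1 h2 h3
      obtain ⟨args, e1, h1⟩ := exists_der (by simp [hσ]) h1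
      obtain ⟨args', e2, h2⟩ := exists_der (by simp [hσ]) h2
      obtain ⟨args'', e3, h3⟩ := exists_der (by simp [hσ]) h3
      obtain ⟨x', w', rfl, f1, -⟩ := exists_pair_of_map e1
      obtain ⟨y', u', rfl, f2, -⟩ := exists_pair_of_map e2
      obtain ⟨t', ht, f3⟩ := List.map_eq_singleton_iff.1 e3.symm
      subst ht
      refine ⟨t' ++ (x' ++ y'), ⟨x', y', u', w', t', h1, h2, h3, ?_, rfl⟩, ?_⟩
      · rintro rfl
        have h4 := h (.inl Omega, [U11.t ++ (U11.x ++ U11.y)]) (by simp [statementClause])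
        simp only [RecursiveSystem.ExtRel, List.map_cons, List.map_nil, x, y, t, inst_var,
          inst_nil, List.append_nil, inst_append, f1, f2, ← f3, ← constStr_append] at h4
        exact ⟨by simp [h3.1], h4⟩
      · simp [statementClause, x, y, t, f1, f2, f3]
  refine ⟨A11, P11 ⊕ Unit, inferInstance, inferInstance, S11.extend [statementClause b] hwf,
    Function.Embedding.refl _, .inr (), fun l => ?_⟩
  have : Nonempty A11 := ⟨A11.a⟩
  constructor
  · rintro ⟨hl, h⟩
    have hl := hl 0
    have e : List.ofFn (fun _ : Fin 1 => l) = [l] := rfl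
    rw [e] at h
    have h := hmodel.sound (n := 1) ⟨.atom _ [l] (by simp [hl.1]), by
      simpa [atom, VarFree] using hl.2⟩ h
    obtain ⟨m, hm, rfl⟩ := hl.exists_map (Equiv.refl _) (Sum.inl : P11 → P11 ⊕ Unit)
    obtain ⟨z, hz, e⟩ := (RecursiveSystem.extTruth_atom (ls := [m]) (by simp [hm.1])).1 h
    refine ⟨z, hz, ?_⟩
    simp only [List.cons.injEq, and_true] at e
    simp [e, constStr, Sym.map]
  · rintro ⟨z, hz, rfl⟩
    obtain ⟨x', y', u', w', t', h1, h2, h3, h4, rfl⟩ := hz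
    have hx := h1.1 x' (by simp)
    have hy := h2.1 y' (by simp)
    have hu := h2.1 u' (by simp)
    have hw := h1.1 w' (by simp)
    have ht := h3.1 t' (by simp)
    refine ⟨fun _ => isElemList_constStr _ (by simp [ht]), ?_⟩
    have hd : [A11.box] ≠ [] := by simp
    have key := (statementClause_wf b).derivable (S := S11.extend [statementClause b] hwf)
      (g := Sum.inl) (by simp [RecursiveSystem.extend])
      (fun n => isElemList_constStr id (asg_ne hx hy hu hw hd hd ht hd n)) ?_
    · have e : List.ofFn (fun _ : Fin 1 => (constStr (Function.Embedding.refl A11)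
        (t' ++ (x' ++ y')) : Str A11 (P11 ⊕ Unit))) =
          [constStr (Function.Embedding.refl A11) (t' ++ (x' ++ y'))] := rfl
      rw [e]
      simpa [statementClause, x, y, t, asg, constStr, Sym.map, Function.comp_def] using key
    · have lift_der : ∀ p args, Der p args → (S11.extend [statementClause b] hwf).Derivable
          (atom (.inl p) (args.map fun s => lift (constStr id s))) := by
        intro p args h
        simpa [Function.comp_def] using h.2.lift (hB := hwf)
      have k1 := lift_der _ _ h1
      have k2 := lift_der _ _ h2
      have k3 := lift_der _ _ h3
      intro q hq
      simp only [statementClause, List.mem_append, List.mem_cons, List.not_mem_nil, or_false] at hq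
      rcases hq with (rfl | rfl | rfl) | hq
      · simpa [x, w, asg] using k1
      · simpa [y, u, asg] using k2
      · simpa [t, asg] using k3
      · cases b with
        | false => simp at hq
        | true =>
          obtain rfl : q = _ := by simpa using hq
          simpa [x, y, t, asg] using lift_der _ _ (h4 rfl)

theorem _root_.RecSys.IsPrime.exists_of_one {A P : Type} {F : Str A P} (h : IsPrime 1 F) :
    ∃ p l, IsList l ∧ F = atom p [l] := by
  generalize hn : 1 = n at h
  cases h with
  | eqn => omega
  | atom p ls hls =>
    obtain ⟨l, rfl⟩ := List.length_eq_one_iff.1 hn.symm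
    exact ⟨p, l, hls l (by simp), rfl⟩

/-- An equation has two arguments, so a unary elementary prime formula is a predicate symbol
followed by one elementary list. The numbers `u` and `w` are not linked to the R-basis string, in
accordance with formulas that need not belong to the system. -/
theorem isDescribed_iff (z : List A11) : IsDescribed false z ↔ IsStatement 1 z := by
  constructor
  · rintro ⟨x, y, u, w, t, h1, h2, h3, -, rfl⟩
    obtain ⟨l, j, rfl, -⟩ := h1.sem
    obtain ⟨k, -, h⟩ := h2.sem
    obtain ⟨k', l', S, rfl⟩ := h3.sem
    -- The meaning of `EL` leaves the number of predicate symbols open; it is chosen to match that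
    -- of `Ps`.
    obtain ⟨F, hF, rfl⟩ := h l
    refine ⟨_, _, ⟨k', l', S, (encSystem_eq S).symm⟩, ⟨k, l, atom j [F],
      ⟨.atom j [F] (by simp [hF.1]), ?_⟩, by simp [enc_atom]⟩, rfl⟩
    simpa [atom, VarFree] using hF.2
  · rintro ⟨_, _, ⟨k, l, S, rfl⟩, ⟨k', l', F, ⟨hF, hv⟩, rfl⟩, rfl⟩
    obtain ⟨p, m, hm, rfl⟩ := hF.exists_of_one
    have hv : VarFree m := by simpa [atom, VarFree] using hv
    refine ⟨_, _, _, _, _, der_ps p, der_elemList hm hv, der_basis S.isFormula, by simp, ?_⟩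
    simp [encSystem_eq, enc_atom]

theorem der_omega_iff_derivable {z : List A11} (hz : z ≠ []) :
    Der Omega [z] ↔ S11.Derivable (atom Omega [constStr id z]) := by
  simp [Der, hz]

theorem recEnum_statements : RecEnum Bs1 := by
  convert recEnum_isDescribed false using 1
  ext z
  exact (isDescribed_iff z).symm

theorem recEnum_theorems : RecEnum Omegas1 := by
  convert recEnum_isDescribed true using 1
  ext z
  change IsTheorem 1 z ↔ _
  rw [IsTheorem, ← isDescribed_iff]
  constructor
  · rintro ⟨⟨x, y, u, w, t, h1, h2, h3, -, rfl⟩, h⟩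
    exact ⟨x, y, u, w, t, h1, h2, h3,
      fun _ => (der_omega_iff_derivable (by simp [h3.1])).2 h, rfl⟩
  · rintro ⟨x, y, u, w, t, h1, h2, h3, h, rfl⟩
    exact ⟨⟨x, y, u, w, t, h1, h2, h3, by simp, rfl⟩, (h rfl).2⟩

end U11

end RecSys

namespace RecSys

/-! ## The diagonal argument -/

theorem IsElemList.append {A P : Type} {l m : Str A P} (hl : IsElemList l) (hm : IsElemList m) :
    IsElemList (l ++ m) := ⟨.append _ _ hl.1 hm.1, varFree_append.2 ⟨hl.2, hm.2⟩⟩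

/-! ### Derived rules of equality. -/

section equality

variable {A P : Type} [Finite A] [Finite P] {S : RecursiveSystem A P}

theorem derivable_eqn_refl {l : Str A P} (hl : IsElemList l) : S.Derivable (eqn l l) :=
  S.derivable_isModel.refl l hl

theorem derivable_eqn_symm {l m : Str A P} (hl : IsElemList l) (hm : IsElemList m)
    (h : S.Derivable (eqn l m)) : S.Derivable (eqn m l) := by
  -- The instance takes `∼ l, l` and `∼ l, m` to `∼ m, l`: the variable `1`, with value `m`, stands
  -- on the left of the equation and is replaced by the variable `0` in the first premise.
  have := S.derivable_isModel.subst (fun n => if n = 0 then l else m)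
    (fun n => by split <;> assumption) 0 1 [.var 1] [.var 0] (.var 1) (.var 0)
  simp [subst_eq_inst] at this
  exact this (derivable_eqn_refl hl) h

theorem derivable_eqn_trans {l m r : Str A P} (hl : IsElemList l) (hm : IsElemList m)
    (hr : IsElemList r) (h : S.Derivable (eqn l m)) (h' : S.Derivable (eqn m r)) :
    S.Derivable (eqn l r) := by
  have := S.derivable_isModel.subst (fun n => if n = 0 then m else if n = 1 then r else l)
    (fun n => by split_ifs <;> assumption) 0 1 [.var 2] [.var 1] (.var 2) (.var 1)
  simp [subst_eq_inst] at this
  exact this h h'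

/-- There is no separate congruence axiom for concatenation. The substitution axiom exchanges first
the left factor and then the right one, starting from trivial equations. -/
theorem derivable_eqn_append {l l' m m' : Str A P} (hl : IsElemList l) (hl' : IsElemList l')
    (hm : IsElemList m) (hm' : IsElemList m') (h : S.Derivable (eqn l l'))
    (h' : S.Derivable (eqn m m')) : S.Derivable (eqn (l ++ m) (l' ++ m')) := by
  have h1 := S.derivable_isModel.subst (fun n => if n = 0 then l else if n = 1 then l' else m)
    (fun n => by split_ifs <;> assumption) 0 1 ([.var 0] ++ [.var 2])
    ([.var 1] ++ [.var 2]) (.append _ _ (.var 0) (.var 2)) (.append _ _ (.var 1) (.var 2))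
  have h2 := S.derivable_isModel.subst (fun n => if n = 0 then m else if n = 1 then m' else l')
    (fun n => by split_ifs <;> assumption) 0 1 ([.var 2] ++ [.var 0])
    ([.var 2] ++ [.var 1]) (.append _ _ (.var 2) (.var 0)) (.append _ _ (.var 2) (.var 1))
  simp [subst_eq_inst] at h1 h2
  exact derivable_eqn_trans (hl.append hm) (hl'.append hm) (hl'.append hm')
    (h1 (derivable_eqn_refl (hl.append hm)) h) (h2 (derivable_eqn_refl (hl'.append hm)) h')

theorem derivable_atom_congr {p : P} {l m : Str A P} (hl : IsElemList l) (hm : IsElemList m)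
    (h : S.Derivable (eqn l m)) (h' : S.Derivable (atom p [l])) : S.Derivable (atom p [m]) :=
  S.derivable_isModel.atom p [(l, m)] (by simpa using ⟨hl, hm, h⟩) h'

end equality

theorem inst_constStr_self {A P B : Type} (σ : ℕ → Str A P) (f : B → A) (s : List B) :
    inst σ (constStr f s) = constStr f s := inst_varFree σ (by simp [VarFree, constStr])

theorem mapStr_constStr {A P A' P' B : Type} (f : A → A') (g : P → P') (h : B → A) (s : List B) :
    mapStr f g (constStr h s) = constStr (f ∘ h) s := by
  simp [mapStr, constStr, Sym.map, Function.comp_def]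

/-! ### The diagonal extension and its model. -/

namespace Diagonal

variable {A P : Type}

/-- The clauses which define the encoding `code` (the predicate symbol `false`), a homomorphism of
strings, and diagonalization (the predicate symbol `true`). -/
noncomputable def clauses (f : A11 → A) (p : P) (code : A11 → List A11) (π : List A11) :
    List (Clause A P (P ⊕ Bool)) :=
  Finset.univ.toList.map (fun c => ⟨[], (.inr false, [constStr f [c], constStr f (code c)])⟩) ++
    [⟨[(.inr false, [[.var 0], [.var 1]]), (.inr false, [[.var 2], [.var 3]])],
      (.inr false, [[.var 0] ++ [.var 2], [.var 1] ++ [.var 3]])⟩,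
    ⟨[(.inr false, [[.var 0], [.var 1]]),
        (.inl p, [[.var 0] ++ (constStr f π ++ [.var 1])])],
      (.inr true, [[.var 0]])⟩]

theorem clauses_wf {f : A11 → A} {p : P} {code : A11 → List A11} {π : List A11}
    (hc : ∀ c, code c ≠ []) (hπ : π ≠ []) : ∀ c ∈ clauses f p code π, c.Wf := by
  have h1 : ∀ m n, IsList ([.var m] ++ [.var n] : Str A P) :=
    fun m n => .append _ _ (.var m) (.var n)
  have h2 : IsList ([.var 0] ++ (constStr f π ++ [.var 1]) : Str A P) :=
    .append _ _ (.var 0) (.append _ _ (isElemList_constStr f hπ).1 (.var 1))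
  intro c hc'
  simp only [clauses, List.mem_append, List.mem_map, List.mem_cons, List.not_mem_nil,
    or_false] at hc'
  rcases hc' with ⟨c, -, rfl⟩ | rfl | rfl
  · intro q hq l hl
    obtain rfl : q = _ := by simpa using hq
    simp only [List.mem_cons, List.not_mem_nil, or_false] at hl
    rcases hl with rfl | rfl
    · exact (isElemList_constStr f (by simp)).1
    · exact (isElemList_constStr f (hc c)).1
  · intro q hq l hl
    simp only [List.mem_cons, List.not_mem_nil, or_false] at hq
    rcases hq with rfl | rfl | rfl
    all_goals
      simp only [List.mem_cons, List.not_mem_nil, or_false] at hl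
      rcases hl with rfl | rfl
    all_goals first | exact h1 _ _ | exact .var _
  · intro q hq l hl
    simp only [List.mem_cons, List.not_mem_nil, or_false] at hq
    rcases hq with rfl | rfl | rfl
    all_goals simp only [List.mem_cons, List.not_mem_nil, or_false] at hl
    · exact hl ▸ .var _
    · rcases hl with rfl | rfl <;> exact .var _
    · exact hl ▸ h2

variable [Finite A] [Finite P]

/-- The interpretation of the new predicate symbols, up to derivable equality. -/
def Rel (S : RecursiveSystem A P) (f : A11 → A) (p : P) (code : A11 → List A11) (π : List A11) :
    Bool → List (Str A P) → Prop
  | false, ls => ∃ l m s, ls = [l, m] ∧ s ≠ [] ∧ IsElemList l ∧ IsElemList m ∧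
      S.Derivable (eqn l (constStr f s)) ∧ S.Derivable (eqn m (constStr f (s.flatMap code)))
  | true, ls => ∃ l s, ls = [l] ∧ s ≠ [] ∧ IsElemList l ∧ S.Derivable (eqn l (constStr f s)) ∧
      S.Derivable (atom p [l ++ (constStr f π ++ constStr f (s.flatMap code))])

section

variable {S : RecursiveSystem A P} {f : A11 → A} {p : P} {code : A11 → List A11} {π : List A11}

theorem flatMap_ne_nil (hc : ∀ c, code c ≠ []) {s : List A11} (hs : s ≠ []) :
    s.flatMap code ≠ [] := by
  obtain ⟨c, s, rfl⟩ := List.exists_cons_of_ne_nil hs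
  simp [hc c]

/-- The system `S` may derive equations between different lists, so the exact graph of the encoding
need not respect the congruence axioms. Closing it under derivable equality repairs this, and the
rules of equality show that the clauses remain true. -/
theorem isModel (hc : ∀ c, code c ≠ []) (hπ : π ≠ []) :
    IsModel (S.extend (clauses f p code π) (clauses_wf hc hπ))
      (RecursiveSystem.ExtTruth S (Rel S f p code π)) := by
  have hcs : ∀ {s : List A11}, s ≠ [] → IsElemList (constStr f s : Str A P) :=
    fun hs => isElemList_constStr f hs
  have hcd : ∀ {s : List A11}, s ≠ [] → IsElemList (constStr f (s.flatMap code) : Str A P) :=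
    fun hs => isElemList_constStr f (flatMap_ne_nil hc hs)
  refine RecursiveSystem.extTruth_isModel ?_ ?_
  · rintro (_ | _) ls hls
    · rintro ⟨l, m, s, e, hs, hl, hm, h1, h2⟩
      obtain ⟨q, ls, rfl, rfl, e'⟩ := List.map_eq_cons_iff.1 e
      obtain ⟨q', rfl, rfl⟩ := List.map_eq_singleton_iff.1 e'
      simp only [List.forall_mem_cons] at hls
      obtain ⟨⟨-, hl', h⟩, ⟨-, hm', h'⟩, -⟩ := hls
      exact ⟨q.2, q'.2, s, rfl, hs, hl', hm',
        derivable_eqn_trans hl' hl (hcs hs) (derivable_eqn_symm hl hl' h) h1,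
        derivable_eqn_trans hm' hm (hcd hs) (derivable_eqn_symm hm hm' h') h2⟩
    · rintro ⟨l, s, e, hs, hl, h1, h2⟩
      obtain ⟨q, rfl, rfl⟩ := List.map_eq_singleton_iff.1 e
      simp only [List.forall_mem_cons] at hls
      obtain ⟨⟨-, hl', h⟩, -⟩ := hls
      have hw := (isElemList_constStr (P := P) f hπ).append (hcd hs)
      exact ⟨q.2, s, rfl, hs, hl',
        derivable_eqn_trans hl' hl (hcs hs) (derivable_eqn_symm hl hl' h) h1,
        derivable_atom_congr (hl.append hw) (hl'.append hw)
          (derivable_eqn_append hl hl' hw hw h (derivable_eqn_refl hw)) h2⟩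
  · intro c hc' σ hσ h
    simp only [clauses, List.mem_append, List.mem_map, List.mem_cons, List.not_mem_nil,
      or_false] at hc'
    rcases hc' with ⟨c, -, rfl⟩ | rfl | rfl
    · have h1 : IsElemList (constStr f [c] : Str A P) := hcs (by simp)
      have h2 : IsElemList (constStr f (code c) : Str A P) := isElemList_constStr f (hc c)
      exact ⟨constStr f [c], constStr f (code c), [c], by simp [inst_constStr_self], by simp,
        h1, h2, derivable_eqn_refl h1, by simpa using derivable_eqn_refl h2⟩
    · simp only [List.forall_mem_cons] at h
      obtain ⟨⟨l, m, s, e, hs, hl, hm, h1, h2⟩, ⟨l', m', s', e', hs', hl', hm', h1', h2'⟩, -⟩ := h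
      simp only [List.map_cons, List.map_nil, inst_var, inst_nil, List.append_nil,
        List.cons.injEq, and_true] at e e'
      obtain ⟨rfl, rfl⟩ := e
      obtain ⟨rfl, rfl⟩ := e'
      refine ⟨σ 0 ++ σ 2, σ 1 ++ σ 3, s ++ s', by simp, by simp [hs], hl.append hl',
        hm.append hm', ?_, ?_⟩
      · rw [constStr_append]
        exact derivable_eqn_append hl (hcs hs) hl' (hcs hs') h1 h1'
      · rw [List.flatMap_append, constStr_append]
        exact derivable_eqn_append hm (hcd hs) hm' (hcd hs') h2 h2'
    · simp only [List.forall_mem_cons] at h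
      obtain ⟨⟨l, m, s, e, hs, hl, hm, h1, h2⟩, h3, -⟩ := h
      simp only [List.map_cons, List.map_nil, inst_var, inst_nil, List.append_nil,
        List.cons.injEq, and_true] at e
      obtain ⟨rfl, rfl⟩ := e
      have h3 : S.Derivable (atom p [σ 0 ++ (constStr f π ++ σ 1)]) := by
        simpa [RecursiveSystem.ExtRel, inst_constStr_self] using h3
      have hw := isElemList_constStr (P := P) f hπ
      refine ⟨σ 0, s, by simp, hs, hl, h1, derivable_atom_congr (hl.append (hw.append hm))
        (hl.append (hw.append (hcd hs))) ?_ h3⟩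
      exact derivable_eqn_append hl hl (hw.append hm) (hw.append (hcd hs)) (derivable_eqn_refl hl)
        (derivable_eqn_append hw hw hm (hcd hs) (derivable_eqn_refl hw) h2)

theorem derivable_code (hc : ∀ c, code c ≠ []) (hπ : π ≠ []) {s : List A11} (hs : s ≠ []) :
    (S.extend (clauses f p code π) (clauses_wf hc hπ)).Derivable
      (atom (.inr false) [constStr f s, constStr f (s.flatMap code)]) := by
  have single : ∀ c, (S.extend (clauses f p code π) (clauses_wf hc hπ)).Derivable
      (atom (.inr false) [constStr f [c], constStr f (code c)]) := by
    intro c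
    have hmem : (⟨[], (.inr false, [constStr f [c], constStr f (code c)])⟩ :
        Clause A P (P ⊕ Bool)) ∈ clauses f p code π :=
      List.mem_append_left _ (List.mem_map_of_mem (by simp))
    have := (clauses_wf hc hπ _ hmem).derivable (g := Sum.inl)
      (S := S.extend (clauses f p code π) (clauses_wf hc hπ))
      (List.mem_append_right _ (List.mem_map_of_mem hmem))
      (fun _ => isElemList_constStr f (s := [c]) (by simp)) (by simp)
    simpa [inst_constStr_self, mapStr_constStr] using this
  induction s with
  | nil => exact (hs rfl).elim
  | cons c s ih =>
    rcases eq_or_ne s [] with rfl | h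
    · simpa using single c
    · have hmem : (⟨[(.inr false, [[.var 0], [.var 1]]), (.inr false, [[.var 2], [.var 3]])],
          (.inr false, [[.var 0] ++ [.var 2], [.var 1] ++ [.var 3]])⟩ :
          Clause A P (P ⊕ Bool)) ∈ clauses f p code π := by simp [clauses]
      have := (clauses_wf hc hπ _ hmem).derivable (g := Sum.inl)
        (S := S.extend (clauses f p code π) (clauses_wf hc hπ))
        (List.mem_append_right _ (List.mem_map_of_mem hmem))
        (σ := fun n => match n with
          | 0 => constStr f [c]
          | 1 => constStr f (code c)
          | 2 => constStr f s
          | _ => constStr f (s.flatMap code)) (by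
            intro n
            split
            all_goals apply isElemList_constStr
            · simp
            · exact hc c
            · exact h
            · exact flatMap_ne_nil hc h) (by
            simp only [List.forall_mem_cons]
            refine ⟨?_, ?_, by simp⟩
            · simpa [mapStr_constStr] using single c
            · simpa [mapStr_constStr] using ih h)
      simpa [mapStr_constStr, ← constStr_append] using this

theorem derivable_diagonal (hc : ∀ c, code c ≠ []) (hπ : π ≠ []) {s : List A11} (hs : s ≠ [])
    (h : S.Derivable (atom p [constStr f (s ++ (π ++ s.flatMap code))])) :
    (S.extend (clauses f p code π) (clauses_wf hc hπ)).Derivable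
      (atom (.inr true) [constStr f s]) := by
  have hmem : (⟨[(.inr false, [[.var 0], [.var 1]]),
        (.inl p, [[.var 0] ++ (constStr f π ++ [.var 1])])],
      (.inr true, [[.var 0]])⟩ : Clause A P (P ⊕ Bool)) ∈ clauses f p code π := by simp [clauses]
  have := (clauses_wf hc hπ _ hmem).derivable (g := Sum.inl)
    (S := S.extend (clauses f p code π) (clauses_wf hc hπ))
    (List.mem_append_right _ (List.mem_map_of_mem hmem))
    (σ := fun n => match n with
      | 0 => constStr f s
      | _ => constStr f (s.flatMap code)) (by
        intro n
        split
        all_goals apply isElemList_constStr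
        · exact hs
        · exact flatMap_ne_nil hc hs) (by
        simp only [List.forall_mem_cons]
        refine ⟨?_, ?_, by simp⟩
        · simpa [mapStr_constStr] using derivable_code hc hπ hs
        · have := h.lift (hB := clauses_wf (f := f) (p := p) hc hπ)
          simpa [mapStr_constStr, inst_constStr_self] using this)
  simpa [mapStr_constStr] using this

end

/-- The complement of the set of unary theorems is not recursively enumerable. -/
theorem not_recEnum : ¬ RecEnum (Bs1 \ Omegas1) := by
  rintro ⟨A, P, _, _, S, f, p, hR⟩
  have hR : ∀ l : Str A P, IsElemList l →
      (S.Derivable (atom p [l]) ↔ ∃ s ∈ Bs1 \ Omegas1, l = constStr f s) := by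
    intro l hl
    rw [← hR l]
    exact ⟨fun h => ⟨fun _ => hl, h⟩, fun h => h.2⟩
  obtain ⟨k, ⟨eA⟩⟩ := Finite.exists_equiv_fin A
  obtain ⟨l, ⟨eP⟩⟩ := Finite.exists_equiv_fin (P ⊕ Bool)
  have : Nonempty A := ⟨f A11.a⟩
  let code : A11 → List A11 := fun c => encSym (Sym.const (eA (f c)) : Sym (Fin k) (Fin l))
  -- The numbering of the symbols is fixed before the clauses are written, so the clause for the
  -- diagonal symbol can mention the code of that very symbol without circularity.
  let π : List A11 := A11.p :: List.replicate ((eP (.inr true)).val + 1) A11.acc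
  have hc : ∀ c, code c ≠ [] := fun c => by simp [code, encSym]
  have hπ : π ≠ [] := by simp [π]
  let S₁ := S.extend (clauses f p code π) (clauses_wf hc hπ)
  -- Only systems over initial segments of the natural numbers have codes; renaming does not affect
  -- derivability.
  let S₂ := S₁.rename eA eP
  let y := encSystem S₂
  let F : List A11 → Str (Fin k) (Fin l) := fun s => atom (eP (.inr true)) [constStr (eA ∘ f) s]
  have hF : ∀ s, s ≠ [] → IsElemPrime 1 (F s) := by
    intro s hs
    have := isElemList_constStr (P := Fin l) (eA ∘ f) hs
    exact ⟨.atom _ [_] (by simpa using this.1), by simpa [F, atom, VarFree] using this.2⟩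
  have hz : ∀ s, y ++ enc (F s) = y ++ (π ++ s.flatMap code) := by
    intro s
    have : enc (constStr (eA ∘ f) s : Str (Fin k) (Fin l)) = s.flatMap code := by
      simp [enc, constStr, List.flatMap_map, code]
    simp [F, enc_atom, this, π]
  have hy : y ≠ [] := by
    simp [y, encSystem_eq, encList]
  have hstmt : ∀ s, s ≠ [] → y ++ enc (F s) ∈ Bs1 := fun s hs =>
    ⟨y, enc (F s), ⟨k, l, S₂, rfl⟩, ⟨k, l, F s, hF s hs, rfl⟩, rfl⟩
  have hthm : ∀ s, s ≠ [] → (y ++ enc (F s) ∈ Omegas1 ↔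
      S₁.Derivable (atom (.inr true) [constStr f s])) := by
    intro s hs
    have e : F s = mapStr eA eP (atom (.inr true) [constStr f s]) := by
      simp [F, mapStr_constStr]
    have h1 := U11.der_omega_iff (S := S₂) (hF s hs)
    rw [e, RecursiveSystem.derivable_rename, ← e,
      U11.der_omega_iff_derivable (List.append_ne_nil_of_left_ne_nil hy _)] at h1
    rw [← h1]
    exact ⟨fun h => h.2, fun h => ⟨hstmt s hs, h⟩⟩
  have hmodel := isModel (S := S) (f := f) (p := p) hc hπ
  have hsound : ∀ s, s ≠ [] → S₁.Derivable (atom (.inr true) [constStr f s]) →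
      Rel S f p code π true [constStr f s] := by
    intro s hs h
    have hel := isElemList_constStr (P := P ⊕ Bool) f hs
    have := hmodel.sound (n := 1) ⟨.atom _ [_] (by simpa using hel.1), by
      simpa [atom, VarFree] using hel.2⟩ h
    have hel' := isElemList_constStr (P := P) f hs
    have hrel : RecursiveSystem.ExtRel S (Rel S f p code π) (.inr true) [constStr f s] :=
      (RecursiveSystem.extTruth_atom (by simpa using hel'.1)).1
        (by simpa [mapStr_constStr] using this)
    exact hrel
  -- Soundness yields only a word `s` with `∼ y, s` derivable in `S` and `p` true of `y π code(s)`.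
  -- The latter says that the diagonal atom at `s` is underivable, but the equation carries
  -- derivability over from `y` to `s`.
  have hnot : ¬ S₁.Derivable (atom (.inr true) [constStr f y]) := by
    intro h
    obtain ⟨_, s, e, hs, hl, h1, h2⟩ := hsound y hy h
    obtain rfl : constStr f y = _ := by simpa using e
    rw [← constStr_append, ← constStr_append] at h2
    obtain ⟨z, hzm, e⟩ := (hR _ (isElemList_constStr f (by simp [hy]))).1 h2
    have hinj : (constStr f : List A11 → Str A P).Injective :=
      List.map_injective_iff.2 fun _ _ h => f.injective (Sym.const.inj h)
    have e := hinj e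
    rw [← e, ← hz, Set.mem_sdiff, hthm s hs] at hzm
    refine hzm.2 ?_
    have h1 := h1.lift (hB := clauses_wf (f := f) (p := p) hc hπ)
    rw [lift, mapStr_eqn, mapStr_constStr, mapStr_constStr] at h1
    exact derivable_atom_congr (isElemList_constStr f hy) (isElemList_constStr f hs) h1 h
  -- Since the diagonal atom at `y` is underivable, its statement lies in the complement, so `p`
  -- holds of it and the diagonal clause derives the atom after all.
  refine hnot (derivable_diagonal hc hπ hy ?_)
  rw [hR _ (isElemList_constStr f (by simp [hy]))]
  refine ⟨_, ?_, rfl⟩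
  rw [← hz, Set.mem_sdiff, hthm y hy]
  exact ⟨hstmt y hy, hnot⟩

end Diagonal

end RecSys

theorem mainTheorem1 :
    RecSys.RecEnum RecSys.Bs1 ∧ RecSys.RecEnum RecSys.Omegas1 ∧
      ¬ RecSys.RecEnum (RecSys.Bs1 \ RecSys.Omegas1) :=
  ⟨RecSys.U11.recEnum_statements, RecSys.U11.recEnum_theorems, RecSys.Diagonal.not_recEnum⟩
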